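/- For $n\ge 1$ let $\Lambda_n=[-1,1]^2\cap\frac1n\mathbb Z^2$ with its nearest-neighbour graph structure and graph distance $d_{\Lambda_n}$. For $\emptyset\ne B\subseteq\Lambda_n$, the Gaussian free field (GFF) on $\Lambda_n$ vanishing on $B$ is the random function $\phi:\Lambda_n\to\mathbb R$ with law proportional to $$\exp\Big(-\tfrac12\sum_{\{x,y\}:\,x\sim y}(\phi(y)-\phi(x))^2\Big)\prod_{x\notin B}d\phi(x)\prod_{x\in B}\delta_0(d\phi(x)).$$ The boundary condition is Dirichlet if $B=\partial\Lambda_n$, the set of points of $\Lambda_n$ on the boundary of $[-1,1]^2$, and free (rooted at $x_0$) if $B=\{x_0\}$ with $x_0\in\Lambda_n$ arbitrary. For $T>0$, a coupled pair is a pair $(\phi_1,\phi_2)$ of GFFs with the same boundary condition as a GFF $\phi$, such that a.s. $e^{iT\phi_1}=e^{iT\phi_2}=e^{iT\phi}$ (pointwise on $\Lambda_n$), and $\phi_1,\phi_2$ are conditionally independent given $e^{iT\phi}$. Define the random set $I\subseteq\Lambda_n$ as follows. - Dirichlet case: $I$ is the set of vertices connected to $\partial\Lambda_n$ inside $\{\phi_1=\phi_2\}$.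 - Free case: for $m\in\mathbb Z$ let $\hat I_m$ be the connected component of $\{\phi_1=\phi_2+m\frac{2\pi}T\}$ with the largest number of vertices (ties are broken by a deterministic rule; $\hat I_m=\emptyset$ if that set is empty). If there is exactly one $m$ for which $\hat I_m$ has $d_{\Lambda_n}$-diameter larger than $n/2$, then $I=\hat I_m$ for this $m$; otherwise $I=\emptyset$. For $x\in\Lambda_n$, let $O(x)=\emptyset$ if $x\in I$, and otherwise let $O(x)$ be the connected component of $\Lambda_n\setminus I$ containing $x$. **Proposition.** There is $T_0>0$ such that for every $T\in(0,T_0)$ the following hold. 1. There is $K=K(T)>0$ such that for all $n\ge1$, for every coupled pair with Dirichlet boundary condition, or with free boundary condition rooted at any $x_0\in\Lambda_n$, and for all $x,y\in\Lambda_n$: $(\phi_1-\phi_2)(x)$ is square-integrable, $$\mathbb E\big[(\phi_1-\phi_2)^2(x)\big]\le K,$$ and $$\Big|\mathbb E\big[(\phi_1-\phi_2)(x)\,(\phi_1-\phi_2)(y)\,\mathbf 1_{O(x)=O(y)\neq\emptyset}\big]\Big|\le e^{-K d_{\Lambda_n}(x,y)}.$$ In the Dirichlet case the last bound also holds with $\mathbf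 1_{O(x)=O(y)}$ in place of $\mathbf 1_{O(x)=O(y)\ne\emptyset}$, and without any indicator: $$\Big|\mathbb E\big[(\phi_1-\phi_2)(x)\,(\phi_1-\phi_2)(y)\big]\Big|\le e^{-K d_{\Lambda_n}(x,y)}.$$ 2. There is $K=K(T)>0$ such that for all $n\ge1$, for $\phi$ a GFF on $\Lambda_n$ with Dirichlet boundary condition, and for every $f:\Lambda_n\to\mathbb R$ (in particular, for the restriction to $\Lambda_n$ of any bounded function on $[-1,1]^2$), the variable $n^{-2}\langle\phi,f\rangle=n^{-2}\sum_{x\in\Lambda_n}\phi(x)f(x)$ is square-integrable and $$\mathbb E\Big[\mathrm{Var}\Big(\tfrac1{n^2}\langle\phi,f\rangle\,\Big|\,e^{iT\phi}\Big)\Big]\le K\,\frac{\|f\|_\infty^2}{n^2},\qquad \|f\|_\infty=\max_{x\in\Lambda_n}|f(x)|.$$ -/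

import Mathlib

open MeasureTheory ProbabilityTheory

universe u

/-! ### Clusters in a graph -/

section Clusters

variable {V : Type*} (G : SimpleGraph V)

/-- The connected component of `x` in the subgraph induced by `S`. It is empty when `x ∉ S`,
because the support of a walk starting at `x` contains `x`. -/
def clusterOf (S : Set V) (x : V) : Set V :=
  {y | ∃ w : G.Walk x y, ∀ z ∈ w.support, z ∈ S}

theorem exists_largest_cluster [Finite V] {S : Set V} (hS : S.Nonempty) :
    ∃ x ∈ S, ∀ y ∈ S, (clusterOf G S y).ncard ≤ (clusterOf G S x).ncard :=
  Set.exists_max_image S (fun x => (clusterOf G S x).ncard) S.toFinite hS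

open Classical in
/-- The largest connected component of `S` (largest number of vertices). Ties are broken by a
deterministic rule, which depends on `G` and `S` only. It is empty when `S` is empty. -/
noncomputable def largestCluster [Finite V] (S : Set V) : Set V :=
  if hS : S.Nonempty then clusterOf G S (exists_largest_cluster G hS).choose else ∅

end Clusters

/-! ### The Gaussian free field on a finite graph -/

section GFF

variable {V : Type*} [Fintype V] (G : SimpleGraph V)

open Classical in
/-- The Dirichlet energy `⟨φ, φ⟩_∇`: half the sum over directed edges, that is, the sum over
undirected edges, of `(φ y - φ x) ^ 2`. -/
noncomputable def dirichletEnergy (φ : V → ℝ) : ℝ :=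
  (1 / 2) * ∑ x, ∑ y, if G.Adj x y then (φ y - φ x) ^ 2 else 0

open Classical in
/-- Lebesgue measure in the coordinates off `B`, and a unit mass at `0` in those on `B`. -/
noncomputable def gffReference (B : Set V) : Measure (V → ℝ) :=
  Measure.pi fun x => if x ∈ B then Measure.dirac (0 : ℝ) else volume

/-- The measure with density `exp (- ⟨φ, φ⟩_∇ / 2)`, before normalisation. -/
noncomputable def gffWeight (B : Set V) : Measure (V → ℝ) :=
  (gffReference B).withDensity fun φ => ENNReal.ofReal (Real.exp (-(dirichletEnergy G φ) / 2))

/-- The law of the Gaussian free field on `G` which vanishes on `B`. -/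
noncomputable def gffLaw (B : Set V) : Measure (V → ℝ) :=
  (gffWeight G B Set.univ)⁻¹ • gffWeight G B

/-- `φ` is a Gaussian free field on `G` which vanishes on `B`. -/
structure IsGFF {Ω : Type*} [MeasurableSpace Ω] (B : Set V) (μ : Measure Ω)
    (φ : Ω → V → ℝ) : Prop where
  measurable : Measurable φ
  law : μ.map φ = gffLaw G B

/-- The field of phases `exp (i T φ)`. -/
noncomputable def phase (T : ℝ) (φ : V → ℝ) : V → ℂ :=
  fun x => Complex.exp (Complex.I * (T : ℂ) * (φ x : ℂ))

/-- The σ-algebra generated by the random field of phases `exp (i T φ)`. -/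
@[reducible] noncomputable def phaseSigma {Ω : Type*} (T : ℝ) (φ : Ω → V → ℝ) :
    MeasurableSpace Ω :=
  MeasurableSpace.comap (fun ω => phase T (φ ω)) inferInstance

/-- `φ₁` and `φ₂` are Gaussian free fields with the same boundary condition as `φ` and the same
phases as `φ`, conditionally independent given these phases. -/
structure IsCoupledGFF {Ω : Type*} [MeasurableSpace Ω] (B : Set V) (T : ℝ) (μ : Measure Ω)
    (φ φ₁ φ₂ : Ω → V → ℝ) : Prop where
  gff : IsGFF G B μ φ
  gff₁ : IsGFF G B μ φ₁
  gff₂ : IsGFF G B μ φ₂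
  phase₁ : ∀ᵐ ω ∂μ, phase T (φ₁ ω) = phase T (φ ω)
  phase₂ : ∀ᵐ ω ∂μ, phase T (φ₂ ω) = phase T (φ ω)
  condIndep : ∀ A₁ A₂ : Set (V → ℝ), MeasurableSet A₁ → MeasurableSet A₂ →
    μ⟦φ₁ ⁻¹' A₁ ∩ φ₂ ⁻¹' A₂ | phaseSigma T φ⟧ =ᵐ[μ]
      μ⟦φ₁ ⁻¹' A₁ | phaseSigma T φ⟧ * μ⟦φ₂ ⁻¹' A₂ | phaseSigma T φ⟧

end GFF

/-! ### The box -/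

/-- The vertices of `[-1, 1] ^ 2 ∩ n⁻¹ ℤ ^ 2`, for `1 ≤ n`, in integer coordinates: `(i, j)` with
`|i|, |j| ≤ n` stands for the point `(i / n, j / n)`. -/
abbrev Box (n : ℕ) : Type :=
  {p : ℤ × ℤ // p ∈ Finset.Icc (-(n : ℤ)) n ×ˢ Finset.Icc (-(n : ℤ)) n}

/-- The nearest-neighbour graph on the box. Its distance `(boxGraph n).dist` is the graph
distance. -/
def boxGraph (n : ℕ) : SimpleGraph (Box n) where
  Adj p q := |p.1.1 - q.1.1| + |p.1.2 - q.1.2| = 1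
  symm := ⟨fun p q h => by rw [abs_sub_comm q.1.1, abs_sub_comm q.1.2]; exact h⟩
  loopless := ⟨fun p h => by simp at h⟩

/-- The vertices of the box that lie on the boundary of the square `[-1, 1] ^ 2`. -/
def boxBoundary (n : ℕ) : Set (Box n) :=
  {p | |p.1.1| = (n : ℤ) ∨ |p.1.2| = (n : ℤ)}

/-! ### The random sets `I` and `O(x)` for a pair of fields -/

section Islands

variable {n : ℕ}

/-- Dirichlet case: the vertices that are connected to the boundary inside the set where the two
fields agree. -/
def dirichletSea (φ₁ φ₂ : Box n → ℝ) : Set (Box n) :=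
  {x | ∃ b ∈ boxBoundary n, x ∈ clusterOf (boxGraph n) {z | φ₁ z = φ₂ z} b}

/-- Free case: the largest connected component of `{φ₁ = φ₂ + 2 π m / T}`. -/
noncomputable def levelSea (T : ℝ) (φ₁ φ₂ : Box n → ℝ) (m : ℤ) : Set (Box n) :=
  largestCluster (boxGraph n) {z | φ₁ z = φ₂ z + m * (2 * Real.pi / T)}

/-- `S` has diameter larger than `n / 2` for the graph distance of the box. -/
def HasLargeDiam (S : Set (Box n)) : Prop :=
  ∃ x ∈ S, ∃ y ∈ S, (n : ℝ) / 2 < (boxGraph n).dist x y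

open Classical in
/-- Free case: `levelSea T φ₁ φ₂ m` for the unique `m` for which it has diameter larger than
`n / 2`, and the empty set if there is no such `m` or more than one. -/
noncomputable def freeSea (T : ℝ) (φ₁ φ₂ : Box n → ℝ) : Set (Box n) :=
  if h : ∃! m : ℤ, HasLargeDiam (levelSea T φ₁ φ₂ m) then levelSea T φ₁ φ₂ h.choose else ∅

/-- `O(x)`: the connected component of `x` in the complement of `I`; empty when `x ∈ I`. If `I` is
empty, this is the whole box. -/
def island (I : Set (Box n)) (x : Box n) : Set (Box n) :=
  clusterOf (boxGraph n) Iᶜ x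

end Islands

/-! ### Clusters -/

section ClusterLemmas

variable {V : Type*} {G : SimpleGraph V} {S S' : Set V} {x y z : V}

/-! Equality of phases makes `φ₁ - φ₂` equal to `2π/T` times an integer labelling `k`, and the
argument is a Peierls estimate for `k`. A vertex is bad when `k` changes across one of its edges.
Then `φ₁` or `φ₂` has a gradient of size at least `π/T` there. Gaussian exponential moments, from a
Cameron-Martin shift (`lintegral_exp_gffWeight_le`), show that a prescribed set of `m` vertices is
entirely bad with probability at most `q ^ m`, where `q` is tiny for small `T`
(`measure_steep_difference_le`, `IsCoupledGFF.rareBad`). No independence of the two fields is used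
for this.

The geometric input is that an island, a component of the complement of a connected set `I`, has a
connected complement. Its inner boundary is therefore connected for king moves
(`boundary_component_eq`). If `I` has large diameter and its outer neighbours are all bad, this
boundary is a chain of bad vertices that either is of order `n` long or encloses the island
(`IsFence.exists_hasBadChain`). With Dirichlet conditions such an `I` always exists. With free
conditions it exists unless some bad chain is long: one label then has a cluster joining the left
side to the right side, and this cluster contains more than half of all vertices (`isSea_labelSea`).

Counting chains against powers of `q` gives exponential tails for islands. For the moments, the
difference between `k x` and the constant label of `I` is read at a neighbour `z ∈ I` of the
starting vertex of the chain. Summing over all deterministic pairs of starting vertex and neighbour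
replaces a random increment by increments between fixed points, whose eighth moments grow
polynomially; Hölder's inequality then beats them with the rare event. Fourth moments follow, and
Cauchy-Schwarz gives the bound on a common island.

Without the indicator one needs symmetry. Given the phases, the labels of each field have Boltzmann
weights. Exchanging `φ₁` and `φ₂` on the island of `x` preserves the total energy, because the
fields agree just outside it. The exchange preserves the joint law and flips the sign of `(φ₁ -
φ₂)(x)` only, so pairs in distinct islands contribute zero
(`IsCoupledGFF.integral_distinct_islands`). For the conditional variance, a second field resampled
from the conditional law given the phases forms a coupled pair with the first; the conditional
variance is half the mean square of the difference, and the two-point bound is summable. -/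

theorem mem_clusterOf_self (hx : x ∈ S) : x ∈ clusterOf G S x :=
  ⟨SimpleGraph.Walk.nil, by simpa using hx⟩

theorem clusterOf_subset : clusterOf G S x ⊆ S := by
  rintro y ⟨w, hw⟩
  exact hw y w.end_mem_support

theorem apply_of_mem_clusterOf {k : V → ℤ} {m : ℤ} (h : y ∈ clusterOf G {z | k z = m} x) :
    k y = m := by
  have h' := clusterOf_subset h
  exact h'

theorem left_mem_of_mem_clusterOf (h : y ∈ clusterOf G S x) : x ∈ S := by
  obtain ⟨w, hw⟩ := h
  exact hw x w.start_mem_support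

theorem clusterOf_symm (h : y ∈ clusterOf G S x) : x ∈ clusterOf G S y := by
  obtain ⟨w, hw⟩ := h
  exact ⟨w.reverse, by simpa using hw⟩

theorem clusterOf_trans (h : y ∈ clusterOf G S x) (h' : z ∈ clusterOf G S y) :
    z ∈ clusterOf G S x := by
  obtain ⟨w, hw⟩ := h
  obtain ⟨w', hw'⟩ := h'
  refine ⟨w.append w', fun t ht => ?_⟩
  rcases (SimpleGraph.Walk.mem_support_append_iff w w').1 ht with h | h
  exacts [hw t h, hw' t h]

theorem mem_clusterOf_of_adj (hx : x ∈ S) (hy : y ∈ S) (h : G.Adj x y) : y ∈ clusterOf G S x :=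
  ⟨h.toWalk, by simp [hx, hy]⟩

theorem clusterOf_step (h : y ∈ clusterOf G S x) (hz : z ∈ S) (hyz : G.Adj y z) :
    z ∈ clusterOf G S x :=
  clusterOf_trans h (mem_clusterOf_of_adj (clusterOf_subset h) hz hyz)

theorem clusterOf_mono (hS : S ⊆ S') : clusterOf G S x ⊆ clusterOf G S' x := by
  rintro y ⟨w, hw⟩
  exact ⟨w, fun z hz => hS (hw z hz)⟩

theorem clusterOf_eq_of_mem (h : y ∈ clusterOf G S x) : clusterOf G S y = clusterOf G S x :=
  Set.ext fun _ => ⟨fun h' => clusterOf_trans h h', fun h' => clusterOf_trans (clusterOf_symm h) h'⟩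

theorem clusterOf_induction {p : V → Prop} (h : y ∈ clusterOf G S x) (hx : p x)
    (hp : ∀ a ∈ clusterOf G S x, ∀ b ∈ S, G.Adj a b → p a → p b) : p y := by
  obtain ⟨w, hw⟩ := h
  induction w with
  | nil => exact hx
  | @cons u v t huv w ih =>
    have hu : u ∈ S := hw u (by simp)
    have hv : v ∈ S := hw v (by simp)
    have huv' : v ∈ clusterOf G S u := mem_clusterOf_of_adj hu hv huv
    refine ih (hp u (mem_clusterOf_self hu) v hv huv hx) ?_ (fun z hz => hw z (by simp [hz]))
    intro a ha b hb hab
    exact hp a (clusterOf_trans huv' ha) b hb hab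

theorem clusterOf_eq_apply {β : Type*} {f : V → β} (h : y ∈ clusterOf G S x)
    (hf : ∀ a ∈ S, ∀ b ∈ S, G.Adj a b → f a = f b) : f y = f x :=
  clusterOf_induction (p := fun t => f t = f x) h rfl
    fun a ha b hb hab hfa => (hf a (clusterOf_subset ha) b hb hab).symm.trans hfa

/-- Any two points of `S` are joined by a walk inside `S`. -/
def ConnectedIn (G : SimpleGraph V) (S : Set V) : Prop :=
  ∀ x ∈ S, ∀ y ∈ S, y ∈ clusterOf G S x

theorem connectedIn_clusterOf : ConnectedIn G (clusterOf G S x) := by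
  have key : ∀ y ∈ clusterOf G S x, y ∈ clusterOf G (clusterOf G S x) x := by
    intro y hy
    refine clusterOf_induction hy (mem_clusterOf_self
      (mem_clusterOf_self (left_mem_of_mem_clusterOf hy))) ?_
    intro a ha b hb hab h
    exact clusterOf_step h (clusterOf_step ha hb hab) hab
  exact fun a ha b hb => clusterOf_trans (clusterOf_symm (key a ha)) (key b hb)

/-- A component of the complement of a connected set has a connected complement. -/
theorem ConnectedIn.compl_clusterOf_compl {A : Set V} (hA : ConnectedIn G A) (hne : A.Nonempty)
    (hG : G.Preconnected) (x : V) : ConnectedIn G (clusterOf G Aᶜ x)ᶜ := by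
  obtain ⟨a, ha⟩ := hne
  have hsub : A ⊆ (clusterOf G Aᶜ x)ᶜ := fun z hz hz' => clusterOf_subset hz' hz
  have key : ∀ y ∈ (clusterOf G Aᶜ x)ᶜ, a ∈ clusterOf G (clusterOf G Aᶜ x)ᶜ y := by
    intro y hy
    obtain ⟨w⟩ := hG y a
    induction w with
    | nil => exact mem_clusterOf_self hy
    | @cons u v t huv w ih =>
      by_cases hu : u ∈ A
      · exact clusterOf_mono hsub (hA u hu _ ha)
      -- Before it meets `A` the walk cannot enter the removed component, since the vertex it comes
      -- from would then belong to that component too.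
      · have hv : v ∈ (clusterOf G Aᶜ x)ᶜ := fun hv => hy (clusterOf_step hv hu huv.symm)
        exact clusterOf_trans (mem_clusterOf_of_adj hy hv huv) (ih ha hv)
  exact fun y hy z hz => clusterOf_trans (key y hy) (clusterOf_symm (key z hz))

/-- The points of `O` that have a neighbour outside. -/
def innerBoundary (G : SimpleGraph V) (O : Set V) : Set V :=
  {z | z ∈ O ∧ ∃ a, a ∉ O ∧ G.Adj z a}

theorem innerBoundary_nonempty {O : Set V} (hG : G.Preconnected) (hx : x ∈ O) (hy : y ∉ O) :
    (innerBoundary G O).Nonempty := by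
  by_contra h
  obtain ⟨w⟩ := hG x y
  have hall : y ∈ clusterOf G Set.univ x := ⟨w, by simp⟩
  refine hy (clusterOf_induction (p := (· ∈ O)) hall hx fun a _ b _ hab ha => ?_)
  by_contra hb
  exact h ⟨a, ha, b, hb, hab⟩

theorem mem_of_adj_clusterOf_compl {A : Set V} {a : V} (hz : z ∈ clusterOf G Aᶜ x)
    (ha : a ∉ clusterOf G Aᶜ x) (hza : G.Adj z a) : a ∈ A := by
  by_contra h
  exact ha (clusterOf_step hz h hza)

end ClusterLemmas

/-! ### Coordinates in the box -/

section BoxCoordinates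

variable {n : ℕ}

theorem Box.bounds (p : Box n) :
    -(n : ℤ) ≤ p.1.1 ∧ p.1.1 ≤ n ∧ -(n : ℤ) ≤ p.1.2 ∧ p.1.2 ≤ n := by
  have := p.2
  simp only [Finset.mem_product, Finset.mem_Icc] at this
  tauto

/-- The point of the box with the given coordinates. -/
def Box.mk (i j : ℤ) (hi : -(n : ℤ) ≤ i ∧ i ≤ n) (hj : -(n : ℤ) ≤ j ∧ j ≤ n) : Box n :=
  ⟨(i, j), by simp only [Finset.mem_product, Finset.mem_Icc]; exact ⟨hi, hj⟩⟩

theorem boxGraph_adj {p q : Box n} : (boxGraph n).Adj p q ↔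
    (p.1.1 - q.1.1).natAbs + (p.1.2 - q.1.2).natAbs = 1 := by
  change |p.1.1 - q.1.1| + |p.1.2 - q.1.2| = 1 ↔ _
  rw [Int.abs_eq_natAbs, Int.abs_eq_natAbs]
  omega

/-- The distance for the maximum of the coordinates. -/
def supDist (p q : Box n) : ℕ := max (p.1.1 - q.1.1).natAbs (p.1.2 - q.1.2).natAbs

/-- The distance for the sum of the coordinates. -/
def l1Dist (p q : Box n) : ℕ := (p.1.1 - q.1.1).natAbs + (p.1.2 - q.1.2).natAbs

theorem column_mem_clusterOf {S : Set (Box n)} {i j j' : ℤ} (hi : -(n : ℤ) ≤ i ∧ i ≤ n)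
    (hj : -(n : ℤ) ≤ j ∧ j ≤ n) (hj' : -(n : ℤ) ≤ j' ∧ j' ≤ n)
    (hS : ∀ t (ht : -(n : ℤ) ≤ t ∧ t ≤ n), Box.mk i t hi ht ∈ S) :
    Box.mk i j' hi hj' ∈ clusterOf (boxGraph n) S (Box.mk i j hi hj) := by
  have key : ∀ k : ℕ, ∀ hk : -(n : ℤ) ≤ -(n : ℤ) + k ∧ -(n : ℤ) + k ≤ n,
      Box.mk i (-(n : ℤ) + k) hi hk ∈
        clusterOf (boxGraph n) S (Box.mk i (-(n : ℤ)) hi (by omega)) := by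
    intro k
    induction k with
    | zero => intro hk; simpa using mem_clusterOf_self (hS _ _)
    | succ k ih =>
      intro hk
      refine clusterOf_step (ih (by omega)) (hS _ _) ?_
      rw [boxGraph_adj]; simp only [Box.mk]; omega
  have h1 := key (j + n).toNat (by omega)
  have h2 := key (j' + n).toNat (by omega)
  have e1 : Box.mk i (-(n : ℤ) + (j + n).toNat) hi (by omega) = Box.mk i j hi hj := by
    simp only [Box.mk]; congr 2; omega
  have e2 : Box.mk i (-(n : ℤ) + (j' + n).toNat) hi (by omega) = Box.mk i j' hi hj' := by
    simp only [Box.mk]; congr 2; omega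
  rw [e1] at h1
  rw [e2] at h2
  exact clusterOf_trans (clusterOf_symm h1) h2

theorem row_mem_clusterOf {S : Set (Box n)} {i i' j : ℤ} (hi : -(n : ℤ) ≤ i ∧ i ≤ n)
    (hi' : -(n : ℤ) ≤ i' ∧ i' ≤ n) (hj : -(n : ℤ) ≤ j ∧ j ≤ n)
    (hS : ∀ t (ht : -(n : ℤ) ≤ t ∧ t ≤ n), Box.mk t j ht hj ∈ S) :
    Box.mk i' j hi' hj ∈ clusterOf (boxGraph n) S (Box.mk i j hi hj) := by
  have key : ∀ k : ℕ, ∀ hk : -(n : ℤ) ≤ -(n : ℤ) + k ∧ -(n : ℤ) + k ≤ n,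
      Box.mk (-(n : ℤ) + k) j hk hj ∈
        clusterOf (boxGraph n) S (Box.mk (-(n : ℤ)) j (by omega) hj) := by
    intro k
    induction k with
    | zero => intro hk; simpa using mem_clusterOf_self (hS _ _)
    | succ k ih =>
      intro hk
      refine clusterOf_step (ih (by omega)) (hS _ _) ?_
      rw [boxGraph_adj]; simp only [Box.mk]; omega
  have h1 := key (i + n).toNat (by omega)
  have h2 := key (i' + n).toNat (by omega)
  have e1 : Box.mk (-(n : ℤ) + (i + n).toNat) j (by omega) hj = Box.mk i j hi hj := by
    simp only [Box.mk]; congr 2; omega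
  have e2 : Box.mk (-(n : ℤ) + (i' + n).toNat) j (by omega) hj = Box.mk i' j hi' hj := by
    simp only [Box.mk]; congr 2; omega
  rw [e1] at h1
  rw [e2] at h2
  exact clusterOf_trans (clusterOf_symm h1) h2

theorem boxGraph_preconnected : (boxGraph n).Preconnected := by
  intro p q
  have hp := p.bounds
  have hq := q.bounds
  obtain ⟨w, -⟩ := column_mem_clusterOf (n := n) (S := Set.univ) (i := p.1.1) (j := p.1.2) (j' := q.1.2)
    (by omega) (by omega) (by omega) (fun _ _ => trivial)
  obtain ⟨w', -⟩ := row_mem_clusterOf (n := n) (S := Set.univ) (i := p.1.1) (i' := q.1.1) (j := q.1.2)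
    (by omega) (by omega) (by omega) (fun _ _ => trivial)
  exact ⟨w.append w'⟩

theorem l1Dist_le_length {p q : Box n} (w : (boxGraph n).Walk p q) : l1Dist p q ≤ w.length := by
  induction w with
  | nil => simp [l1Dist]
  | cons h w ih =>
    rw [boxGraph_adj] at h
    simp only [l1Dist, SimpleGraph.Walk.length_cons] at ih ⊢
    omega

theorem exists_adj_l1Dist_lt {p q : Box n} (h : p ≠ q) :
    ∃ r, (boxGraph n).Adj p r ∧ l1Dist r q + 1 = l1Dist p q := by
  have hp := p.bounds
  have hq := q.bounds
  have hne : ¬ (p.1.1 = q.1.1 ∧ p.1.2 = q.1.2) := fun h' => h (Subtype.ext (Prod.ext h'.1 h'.2))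
  by_cases h1 : p.1.1 = q.1.1
  · by_cases h2 : p.1.2 < q.1.2
    · refine ⟨Box.mk p.1.1 (p.1.2 + 1) (by omega) (by omega), ?_, ?_⟩
      · rw [boxGraph_adj]; simp only [Box.mk]; omega
      · simp only [l1Dist, Box.mk]; omega
    · refine ⟨Box.mk p.1.1 (p.1.2 - 1) (by omega) (by omega), ?_, ?_⟩
      · rw [boxGraph_adj]; simp only [Box.mk]; omega
      · simp only [l1Dist, Box.mk]; omega
  · by_cases h2 : p.1.1 < q.1.1
    · refine ⟨Box.mk (p.1.1 + 1) p.1.2 (by omega) (by omega), ?_, ?_⟩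
      · rw [boxGraph_adj]; simp only [Box.mk]; omega
      · simp only [l1Dist, Box.mk]; omega
    · refine ⟨Box.mk (p.1.1 - 1) p.1.2 (by omega) (by omega), ?_, ?_⟩
      · rw [boxGraph_adj]; simp only [Box.mk]; omega
      · simp only [l1Dist, Box.mk]; omega

theorem boxGraph_dist (p q : Box n) : (boxGraph n).dist p q = l1Dist p q := by
  apply le_antisymm
  · obtain ⟨k, hk⟩ : ∃ k, l1Dist p q = k := ⟨_, rfl⟩
    induction k generalizing p with
    | zero =>
      have : p = q := by
        simp only [l1Dist] at hk
        exact Subtype.ext (Prod.ext (by omega) (by omega))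
      simp [this]
    | succ k ih =>
      have hne : p ≠ q := by rintro rfl; simp [l1Dist] at hk
      obtain ⟨r, hr, hrq⟩ := exists_adj_l1Dist_lt hne
      have h1 := ih r (by omega)
      obtain ⟨w, hw⟩ := (boxGraph_preconnected (n := n) r q).exists_walk_length_eq_dist
      have := SimpleGraph.dist_le (SimpleGraph.Walk.cons hr w)
      simp only [SimpleGraph.Walk.length_cons] at this
      omega
  · obtain ⟨w, hw⟩ := (boxGraph_preconnected (n := n) p q).exists_walk_length_eq_dist
    exact hw ▸ l1Dist_le_length w

/-- The points outside a square whose side is shorter than that of the box are connected. -/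
theorem connectedIn_compl_square {e : Box n} {r : ℕ} (hr : r < n) :
    ConnectedIn (boxGraph n) {z | r < supDist z e} := by
  have he := e.bounds
  -- As `r < n`, the square misses an entire column `a` and an entire row `b`. Every outside point
  -- reaches their crossing by an L-shaped path along its own free column or row.
  obtain ⟨a, ha, hae⟩ : ∃ a : ℤ, (-(n : ℤ) ≤ a ∧ a ≤ n) ∧ r < (a - e.1.1).natAbs := by
    by_cases h : 0 ≤ e.1.1
    · exact ⟨-n, by omega, by omega⟩
    · exact ⟨n, by omega, by omega⟩
  obtain ⟨b, hb, hbe⟩ : ∃ b : ℤ, (-(n : ℤ) ≤ b ∧ b ≤ n) ∧ r < (b - e.1.2).natAbs := by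
    by_cases h : 0 ≤ e.1.2
    · exact ⟨-n, by omega, by omega⟩
    · exact ⟨n, by omega, by omega⟩
  have key : ∀ x : Box n, r < supDist x e →
      Box.mk a b ha hb ∈ clusterOf (boxGraph n) {z | r < supDist z e} x := by
    intro x hx
    have hxb := x.bounds
    by_cases h1 : r < (x.1.1 - e.1.1).natAbs
    · refine clusterOf_trans
        (column_mem_clusterOf (i := x.1.1) (j := x.1.2) (j' := b) (by omega) (by omega) hb ?_)
        (row_mem_clusterOf _ ha hb ?_)
      · intro t ht; simp only [Set.mem_ofPred_eq, supDist, Box.mk]; omega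
      · intro t ht; simp only [Set.mem_ofPred_eq, supDist, Box.mk]; omega
    · have h2 : r < (x.1.2 - e.1.2).natAbs := by simp only [supDist] at hx; omega
      refine clusterOf_trans
        (row_mem_clusterOf (i := x.1.1) (i' := a) (j := x.1.2) (by omega) ha (by omega) ?_)
        (column_mem_clusterOf ha _ hb ?_)
      · intro t ht; simp only [Set.mem_ofPred_eq, supDist, Box.mk]; omega
      · intro t ht; simp only [Set.mem_ofPred_eq, supDist, Box.mk]; omega
  exact fun x hx y hy => clusterOf_trans (key x hx) (clusterOf_symm (key y hy))

end BoxCoordinates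

/-! ### Boundaries of simply connected sets -/

section BoundaryConnectivity

/-- A closed discrete one-form on a rectangle is exact. -/
theorem exists_potential_of_closed {M : Type*} [AddCommGroup M] (N : ℕ) (H W : ℕ → ℕ → M)
    (hcl : ∀ i < N, ∀ j < N, H i j + W (i + 1) j = W i j + H i (j + 1)) :
    ∃ g : ℕ → ℕ → M, (∀ i < N, ∀ j ≤ N, g (i + 1) j = g i j + H i j) ∧
      (∀ i ≤ N, ∀ j < N, g i (j + 1) = g i j + W i j) := by
  -- The potential integrates the form along the bottom row and then up the column; closedness is
  -- needed only for horizontal increments.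
  refine ⟨fun i j => ∑ s ∈ Finset.range i, H s 0 + ∑ t ∈ Finset.range j, W i t, ?_, ?_⟩
  · intro i hi j
    induction j with
    | zero => intro _; simp [Finset.sum_range_succ]
    | succ j ih =>
      intro hj
      have h1 := ih (by omega)
      have h2 := hcl i hi j (by omega)
      simp only [Finset.sum_range_succ _ j] at h1 ⊢
      rw [← add_assoc, h1, add_assoc, h2]
      abel
  · intro i _ j _
    simp [Finset.sum_range_succ, add_assoc]

variable {n : ℕ}

/-- A cohomological substitute for the Jordan curve theorem. The jump of the indicator of `O`, kept
only across boundary edges that start in `U`, is a closed one-form on the simply connected box,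
hence has a potential. The potential is constant on `O` and on its complement, so all boundary edges
carry the same jump, and none can be left out of `U`. -/
theorem boundary_component_eq {O U : Set (Box n)} (hO : ConnectedIn (boxGraph n) O)
    (hOc : ConnectedIn (boxGraph n) Oᶜ) (hUO : U ⊆ innerBoundary (boxGraph n) O)
    (hne : U.Nonempty)
    (hU : ∀ z ∈ U, ∀ z' ∈ innerBoundary (boxGraph n) O, supDist z z' ≤ 1 → z' ∈ U) :
    U = innerBoundary (boxGraph n) O := by
  classical
  -- `P i j` is the point of the box with lower left corner at the origin
  let cl : ℕ → ℤ := fun i => min (-(n : ℤ) + i) n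
  have hcl : ∀ i, -(n : ℤ) ≤ cl i ∧ cl i ≤ n := fun i => by simp only [cl]; omega
  let P : ℕ → ℕ → Box n := fun i j => Box.mk (cl i) (cl j) (hcl i) (hcl j)
  let o : Box n → ℤ := fun p => if p ∈ O then 1 else 0
  let ω : Box n → Box n → ℤ := fun p q =>
    if (p ∈ O ∧ q ∉ O ∧ p ∈ U) ∨ (q ∈ O ∧ p ∉ O ∧ q ∈ U) then o q - o p else 0
  have hω0 : ∀ p q, (p ∈ O ↔ q ∈ O) → ω p q = 0 := by
    intro p q h
    simp only [ω, o]
    split_ifs <;> grind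
  have hωanti : ∀ p q, ω q p = - ω p q := by
    intro p q
    simp only [ω]
    split_ifs <;> grind
  -- Vertices of one unit square are within king distance 1, so its inner boundary vertices lie all
  -- in `U` or all outside `U`. On that square the form is the full differential of the indicator or
  -- zero, hence closed.
  have hplaq : ∀ i < 2 * n, ∀ j < 2 * n, ω (P i j) (P (i + 1) j) + ω (P (i + 1) j) (P (i + 1) (j + 1))
      = ω (P i j) (P i (j + 1)) + ω (P i (j + 1)) (P (i + 1) (j + 1)) := by
    intro i hi j hj
    have a1 : (boxGraph n).Adj (P i j) (P (i + 1) j) := by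
      rw [boxGraph_adj]; simp only [P, cl, Box.mk]; omega
    have a2 : (boxGraph n).Adj (P (i + 1) j) (P (i + 1) (j + 1)) := by
      rw [boxGraph_adj]; simp only [P, cl, Box.mk]; omega
    have a3 : (boxGraph n).Adj (P i j) (P i (j + 1)) := by
      rw [boxGraph_adj]; simp only [P, cl, Box.mk]; omega
    have a4 : (boxGraph n).Adj (P i (j + 1)) (P (i + 1) (j + 1)) := by
      rw [boxGraph_adj]; simp only [P, cl, Box.mk]; omega
    have hst : ∀ z ∈ [P i j, P (i + 1) j, P i (j + 1), P (i + 1) (j + 1)],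
        ∀ z' ∈ [P i j, P (i + 1) j, P i (j + 1), P (i + 1) (j + 1)],
        z' ∈ innerBoundary (boxGraph n) O → z ∈ U → z' ∈ U := by
      intro z hz z' hz' hb hzU
      refine hU z hzU z' hb ?_
      simp only [List.mem_cons, List.not_mem_nil, or_false] at hz hz'
      rcases hz with rfl | rfl | rfl | rfl <;> rcases hz' with rfl | rfl | rfl | rfl <;>
        simp only [supDist, P, cl, Box.mk] <;> omega
    have hb : ∀ z a, z ∈ O → a ∉ O → (boxGraph n).Adj z a → z ∈ innerBoundary (boxGraph n) O :=
      fun z a hz ha hza => ⟨hz, a, ha, hza⟩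
    simp only [List.mem_cons, List.not_mem_nil, or_false] at hst
    generalize P i j = a at *
    generalize P (i + 1) j = b at *
    generalize P i (j + 1) = c at *
    generalize P (i + 1) (j + 1) = d at *
    have b1 := hb a b
    have b2 := hb b a
    have b3 := hb a c
    have b4 := hb c a
    have b5 := hb b d
    have b6 := hb d b
    have b7 := hb c d
    have b8 := hb d c
    have s1 := a1.symm
    have s2 := a2.symm
    have s3 := a3.symm
    have s4 := a4.symm
    have hst' : ∀ z z', (z = a ∨ z = b ∨ z = c ∨ z = d) → (z' = a ∨ z' = b ∨ z' = c ∨ z' = d) →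
      z' ∈ innerBoundary (boxGraph n) O → z ∈ U → z' ∈ U := fun z z' h h' => hst z h z' h'
    have tab := hst' a b; have tac := hst' a c; have tad := hst' a d
    have tba := hst' b a; have tbc := hst' b c; have tbd := hst' b d
    have tca := hst' c a; have tcb := hst' c b; have tcd := hst' c d
    have tda := hst' d a; have tdb := hst' d b; have tdc := hst' d c
    clear hst hst' hb
    simp only [true_or, or_true, forall_const, a1, a2, a3, a4, s1, s2, s3, s4] at *
    simp only [ω, o]
    -- Only membership of the four corners in `O` and `U` matters once the coordinates are
    -- forgotten, which leaves sixteen configurations.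
    by_cases ha : a ∈ O <;> by_cases hb : b ∈ O <;> by_cases hc : c ∈ O <;> by_cases hd : d ∈ O <;>
      simp only [ha, hb, hc, hd, true_and, false_and, and_false, not_true_eq_false, not_false_eq_true,
        or_false, false_or, if_true, if_false, forall_const, false_implies] at * <;>
      split_ifs <;> grind
  obtain ⟨g, hg1, hg2⟩ := exists_potential_of_closed (2 * n) (fun i j => ω (P i j) (P (i + 1) j))
    (fun i j => ω (P i j) (P i (j + 1))) hplaq
  let g' : Box n → ℤ := fun p => g (p.1.1 + n).toNat (p.1.2 + n).toNat
  have hP : ∀ p : Box n, P (p.1.1 + n).toNat (p.1.2 + n).toNat = p := by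
    intro p
    have := p.bounds
    refine Subtype.ext (Prod.ext ?_ ?_) <;> simp only [P, cl, Box.mk] <;> omega
  have hgadj : ∀ p q, (boxGraph n).Adj p q → g' q - g' p = ω p q := by
    have right : ∀ p q : Box n, q.1.1 = p.1.1 + 1 → q.1.2 = p.1.2 → g' q - g' p = ω p q := by
      intro p q h1 h2
      have hp := p.bounds
      have hq := q.bounds
      have := hg1 (p.1.1 + n).toNat (by omega) (p.1.2 + n).toNat (by omega)
      have e1 : (q.1.1 + n).toNat = (p.1.1 + n).toNat + 1 := by omega
      simp only [g']
      rw [e1, h2, this, hP, ← e1, ← h2, hP]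
      ring
    have up : ∀ p q : Box n, q.1.1 = p.1.1 → q.1.2 = p.1.2 + 1 → g' q - g' p = ω p q := by
      intro p q h1 h2
      have hp := p.bounds
      have hq := q.bounds
      have := hg2 (p.1.1 + n).toNat (by omega) (p.1.2 + n).toNat (by omega)
      have e1 : (q.1.2 + n).toNat = (p.1.2 + n).toNat + 1 := by omega
      simp only [g']
      rw [e1, h1, this, hP, ← e1, ← h1, hP]
      ring
    intro p q h
    rw [boxGraph_adj] at h
    rcases (by omega : (q.1.1 = p.1.1 + 1 ∧ q.1.2 = p.1.2) ∨ (p.1.1 = q.1.1 + 1 ∧ p.1.2 = q.1.2) ∨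
      (q.1.1 = p.1.1 ∧ q.1.2 = p.1.2 + 1) ∨ (p.1.1 = q.1.1 ∧ p.1.2 = q.1.2 + 1)) with h | h | h | h
    · exact right p q h.1 h.2
    · have := right q p h.1 h.2; have := hωanti p q; omega
    · exact up p q h.1 h.2
    · have := up q p h.1 h.2; have := hωanti p q; omega
  have hgO : ∀ p ∈ O, ∀ q ∈ O, g' q = g' p := fun p hp q hq =>
    clusterOf_eq_apply (hO p hp q hq) fun a ha b hb hab => by
      have := hgadj a b hab; rw [hω0 a b (by simp [ha, hb])] at this; omega
  have hgOc : ∀ p ∉ O, ∀ q ∉ O, g' q = g' p := fun p hp q hq =>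
    clusterOf_eq_apply (hOc p hp q hq) fun a ha b hb hab => by
      have := hgadj a b hab
      rw [hω0 a b (by simp only [Set.mem_compl_iff] at ha hb; simp [ha, hb])] at this; omega
  refine hUO.antisymm ?_
  rintro z ⟨hzO, a, haO, hza⟩
  obtain ⟨z', hz'⟩ := hne
  obtain ⟨hz'O, a', ha'O, hza'⟩ := hUO hz'
  have h1 := hgadj z a hza
  have h2 := hgadj z' a' hza'
  -- The jumps across an arbitrary boundary edge and across one starting in `U` coincide; the latter
  -- is nonzero.
  rw [hgO z hzO z' hz'O, hgOc a haO a' ha'O, h1] at h2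
  by_contra hzU
  simp only [ω, o, hzO, haO, hzU, hz'O, ha'O, hz'] at h2
  simp at h2

end BoundaryConnectivity

/-! ### Chains of bad vertices -/

section BadChains

variable {n : ℕ}

/-- Two distinct vertices are adjacent when a chess king can move from one to the other. -/
def kingGraph (n : ℕ) : SimpleGraph (Box n) where
  Adj p q := p ≠ q ∧ supDist p q ≤ 1
  symm := ⟨fun p q h => ⟨h.1.symm, by have := h.2; simp only [supDist] at this ⊢; omega⟩⟩
  loopless := ⟨fun _ h => h.1 rfl⟩

/-- `v` has a neighbour with a different label. -/
def IsBad (k : Box n → ℤ) (v : Box n) : Prop := ∃ u, (boxGraph n).Adj v u ∧ k u ≠ k v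

/-- There is a self-avoiding king walk of `L` steps from `e`, at least a quarter of the vertices of
which are bad. -/
def HasBadChain (k : Box n → ℤ) (e : Box n) (L : ℕ) : Prop :=
  ∃ l : List (Box n), l.IsChain (fun a b => supDist a b ≤ 1) ∧ l.head? = some e ∧ l.Nodup ∧
    l.length = L + 1 ∧ ∃ F : Finset (Box n), (∀ v ∈ F, v ∈ l ∧ IsBad k v) ∧ L + 1 ≤ 4 * F.card

theorem supDist_le_length {p q : Box n} (w : (kingGraph n).Walk p q) :
    supDist p q ≤ w.length := by
  induction w with
  | nil => simp [supDist]
  | cons h w ih =>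
    have := h.2
    simp only [supDist, SimpleGraph.Walk.length_cons] at ih this ⊢
    omega

theorem exists_king_path {T : Set (Box n)} {p q : Box n} (h : q ∈ clusterOf (kingGraph n) T p) :
    ∃ l : List (Box n), l.IsChain (fun a b => supDist a b ≤ 1) ∧ l.head? = some p ∧ l.Nodup ∧
      supDist p q + 1 ≤ l.length ∧ ∀ v ∈ l, v ∈ T := by
  classical
  obtain ⟨w, hw⟩ := h
  refine ⟨w.bypass.support, ?_, ?_, w.bypass_isPath.support_nodup, ?_, ?_⟩
  · exact (SimpleGraph.Walk.isChain_adj_support w.bypass).imp fun a b hab => hab.2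
  · cases w.bypass <;> rfl
  · rw [SimpleGraph.Walk.length_support]
    exact Nat.succ_le_succ (supDist_le_length _)
  · exact fun v hv => hw v (w.support_bypass_subset_support hv)

/-- A self-avoiding path in `T` has at least `supDist p q + 1` vertices; cutting it to exactly that
many leaves a chain all of whose vertices are bad, more than the required quarter. -/
theorem hasBadChain_of_mem_clusterOf {k : Box n → ℤ} {T : Set (Box n)} (hT : ∀ v ∈ T, IsBad k v)
    {p q : Box n} (h : q ∈ clusterOf (kingGraph n) T p) : HasBadChain k p (supDist p q) := by
  classical
  obtain ⟨l, hl, hp, hnd, hlen, hlT⟩ := exists_king_path h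
  have hnd' : (l.take (supDist p q + 1)).Nodup := hnd.sublist (List.take_sublist _ _)
  have hlen' : (l.take (supDist p q + 1)).length = supDist p q + 1 := by
    rw [List.length_take]; omega
  refine ⟨l.take (supDist p q + 1), hl.take _, ?_, hnd', hlen',
    (l.take (supDist p q + 1)).toFinset, ?_, ?_⟩
  · rw [List.head?_take]; simpa using hp
  · intro v hv
    rw [List.mem_toFinset] at hv
    exact ⟨hv, hT v (hlT v (List.mem_of_mem_take hv))⟩
  · rw [List.toFinset_card_of_nodup hnd', hlen']; omega

theorem connectedIn_innerBoundary {O : Set (Box n)} (hO : ConnectedIn (boxGraph n) O)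
    (hOc : ConnectedIn (boxGraph n) Oᶜ) :
    ConnectedIn (kingGraph n) (innerBoundary (boxGraph n) O) := by
  intro z hz z' hz'
  have := boundary_component_eq (U := clusterOf (kingGraph n) (innerBoundary (boxGraph n) O) z)
    hO hOc clusterOf_subset ⟨z, mem_clusterOf_self hz⟩ fun a ha b hb hab => by
      by_cases h : a = b
      · exact h ▸ ha
      · exact clusterOf_step ha hb ⟨h, hab⟩
  rw [this]
  exact hz'

/-- A connected set of large diameter, every vertex adjacent to which is bad. -/
structure IsFence (I : Set (Box n)) (k : Box n → ℤ) : Prop where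
  connected : ConnectedIn (boxGraph n) I
  far : ∃ u ∈ I, ∃ v ∈ I, n < 2 * l1Dist u v
  bad : ∀ z, z ∉ I → ∀ a ∈ I, (boxGraph n).Adj z a → IsBad k z

/-- The inner boundary of the island is a king-connected set of bad vertices. The chain joins one of
them, `e`, to a farthest one, so its length controls the extent of the boundary. The neighbour `z`
in `I` is recorded because it carries the label of the sea. -/
theorem IsFence.exists_hasBadChain {I : Set (Box n)} {k : Box n → ℤ} (hI : IsFence I k)
    {x : Box n} (hx : x ∉ I) :
    ∃ e z L, z ∈ I ∧ (boxGraph n).Adj e z ∧ HasBadChain k e L ∧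
      (n < 8 * L ∨ ∀ y ∈ island I x, supDist e y ≤ L) := by
  classical
  obtain ⟨u, hu, v, hv, huv⟩ := hI.far
  set O := island I x with hOdef
  have hOI : ∀ z ∈ O, z ∉ I := fun z hz => clusterOf_subset hz
  have hO : ConnectedIn (boxGraph n) O := connectedIn_clusterOf
  have hOc : ConnectedIn (boxGraph n) Oᶜ :=
    hI.connected.compl_clusterOf_compl ⟨u, hu⟩ boxGraph_preconnected x
  obtain ⟨e, he⟩ := innerBoundary_nonempty (O := O) boxGraph_preconnected (mem_clusterOf_self hx)
    (fun h => hOI u h hu)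
  obtain ⟨e', he', hmax⟩ := Set.exists_max_image (innerBoundary (boxGraph n) O)
    (fun y => supDist e y) (Set.toFinite _) ⟨e, he⟩
  have hadj : ∀ z ∈ O, ∀ a ∉ O, (boxGraph n).Adj z a → a ∈ I := fun z hz a ha hza =>
    mem_of_adj_clusterOf_compl hz ha hza
  obtain ⟨heO, z, hzO, hez⟩ := he
  refine ⟨e, z, supDist e e', hadj e heO z hzO hez, hez, ?_, ?_⟩
  · refine hasBadChain_of_mem_clusterOf (T := innerBoundary (boxGraph n) O) ?_
      (connectedIn_innerBoundary hO hOc e ⟨heO, z, hzO, hez⟩ e' he')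
    rintro w ⟨hw, a, ha, hwa⟩
    exact hI.bad w (hOI w hw) a (hadj w hw a ha hwa) hwa
  -- If the island left the square of radius `L` around `e` with `8L ≤ n`, it would contain
  -- everything outside that square, trapping `I` inside: the diameter of `I` would be at most `4L ≤
  -- n / 2`.
  · by_contra! hcon
    obtain ⟨hn, y, hy, hyL⟩ := hcon
    have hn0 : 0 < n := by
      have := u.bounds; have := v.bounds
      simp only [l1Dist] at huv; omega
    -- A path outside the square that left `O` would produce an inner boundary vertex farther from
    -- `e` than the farthest one.
    have hall : ∀ w, supDist e e' < supDist w e → w ∈ O := by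
      intro w hw
      have hyL' : supDist e e' < supDist y e := by simp only [supDist] at hyL ⊢; omega
      refine clusterOf_induction (p := (· ∈ O))
        (connectedIn_compl_square (e := e) (r := supDist e e') (by omega) y hyL' w hw) hy ?_
      intro a ha b hb hab haO
      by_contra hbO
      have h1 := hmax a ⟨haO, b, hbO, hab⟩
      have h2 := clusterOf_subset ha
      rw [Set.mem_ofPred_eq] at h2
      simp only [supDist] at h1 h2
      omega
    have hu' : ¬ supDist e e' < supDist u e := fun h => hOI u (hall u h) hu
    have hv' : ¬ supDist e e' < supDist v e := fun h => hOI v (hall v h) hv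
    clear hall hmax
    generalize supDist e e' = R at hu' hv' hn
    simp only [supDist, l1Dist] at hu' hv' huv
    omega

/-- Without long bad chains every island sits in a square of radius at most `n / 8`, whence the
diameter `n / 4`. -/
theorem IsFence.supDist_le {I : Set (Box n)} {k : Box n → ℤ} (hI : IsFence I k)
    (hk : ∀ e L, n < 8 * L → ¬ HasBadChain k e L) {x y y' : Box n}
    (hy : y ∈ island I x) (hy' : y' ∈ island I x) : 8 * supDist y y' ≤ 2 * n := by
  obtain ⟨e, z, L, -, -, hL, h⟩ := hI.exists_hasBadChain (left_mem_of_mem_clusterOf hy)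
  rcases h with h | h
  · exact absurd hL (hk e L h)
  · have h1 := h y hy
    have h2 := h y' hy'
    have h3 : ¬ n < 8 * L := fun h => hk e L h hL
    simp only [supDist] at *
    omega

end BadChains

/-! ### The sea of a labelling -/

section LabelSea

variable {n : ℕ}

theorem hasLargeDiam_iff {S : Set (Box n)} :
    HasLargeDiam S ↔ ∃ x ∈ S, ∃ y ∈ S, n < 2 * l1Dist x y := by
  have : ∀ x y : Box n, (n : ℝ) / 2 < (boxGraph n).dist x y ↔ n < 2 * l1Dist x y := by
    intro x y
    rw [boxGraph_dist, div_lt_iff₀ two_pos, mul_comm]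
    exact_mod_cast Iff.rfl
  simp only [HasLargeDiam, this]

theorem isFence_clusterOf_label {k : Box n → ℤ} {l r : Box n}
    (hr : r ∈ clusterOf (boxGraph n) {w | k w = k l} l) (hlr : n < 2 * l1Dist l r) :
    IsFence (clusterOf (boxGraph n) {w | k w = k l} l) k where
  connected := connectedIn_clusterOf
  far := ⟨l, mem_clusterOf_self rfl, r, hr, hlr⟩
  bad z hz a ha hza := by
    refine ⟨a, hza, fun h => hz ?_⟩
    have ha' : k a = k l := apply_of_mem_clusterOf ha
    exact clusterOf_step ha (by rw [Set.mem_ofPred_eq, ← h, ha']) hza.symm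

/-- The good vertices together with the left side must reach the right side: otherwise the whole
right side would lie in one island, far larger than islands can be. -/
theorem exists_spanning_cluster {k : Box n → ℤ} (hn : 1 ≤ n)
    (hk : ∀ e L, n < 8 * L → ¬ HasBadChain k e L) :
    ∃ l r : Box n, l.1.1 = -n ∧ r.1.1 = n ∧ r ∈ clusterOf (boxGraph n) {w | k w = k l} l := by
  let S : Set (Box n) := {z | z.1.1 = -n ∨ ¬ IsBad k z}
  let p₀ : Box n := Box.mk (-n) (-n) (by omega) (by omega)
  let p₁ : Box n := Box.mk (-n) n (by omega) (by omega)
  let q₀ : Box n := Box.mk n (-n) (by omega) (by omega)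
  let q₁ : Box n := Box.mk n n (by omega) (by omega)
  have hp₀ : p₀ ∈ S := Or.inl rfl
  have hA : IsFence (clusterOf (boxGraph n) S p₀) k := by
    refine ⟨connectedIn_clusterOf, ⟨p₀, mem_clusterOf_self hp₀, p₁, ?_, ?_⟩, ?_⟩
    · exact column_mem_clusterOf _ _ _ fun t ht => Or.inl rfl
    · simp only [p₀, p₁, l1Dist, Box.mk]; omega
    · intro z hz a ha hza
      by_contra hb
      exact hz (clusterOf_step ha (Or.inr hb) hza.symm)
  obtain ⟨r, hr, hrn⟩ : ∃ r ∈ clusterOf (boxGraph n) S p₀, r.1.1 = n := by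
    by_contra! hcon
    have hcol : ∀ t (ht : -(n : ℤ) ≤ t ∧ t ≤ n),
        Box.mk n t (by omega) ht ∈ (clusterOf (boxGraph n) S p₀)ᶜ := fun t ht h => hcon _ h rfl
    have := hA.supDist_le hk (x := q₀) (y := q₀) (y' := q₁) (mem_clusterOf_self (hcol _ _))
      (column_mem_clusterOf _ _ _ hcol)
    simp only [supDist, q₀, q₁, Box.mk] at this
    omega
  obtain ⟨l, hl, hlr⟩ : ∃ l : Box n, l.1.1 = -n ∧
      r ∈ clusterOf (boxGraph n) {w | k w = k l} l := by
    -- Steps into a good vertex preserve the label. Returning to the left side simply restarts the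
    -- cluster, so the last visit there supplies `l`.
    refine clusterOf_induction (p := fun r => ∃ l : Box n, l.1.1 = -n ∧
      r ∈ clusterOf (boxGraph n) {w | k w = k l} l) hr ⟨p₀, rfl, mem_clusterOf_self rfl⟩ ?_
    rintro a - b hb hab ⟨l, hl, ha⟩
    rcases hb with hb | hb
    · exact ⟨b, hb, mem_clusterOf_self rfl⟩
    · refine ⟨l, hl, clusterOf_step ha ?_ hab⟩
      have ha' : k a = k l := apply_of_mem_clusterOf ha
      by_contra hne
      refine hb ⟨a, hab.symm, fun h => hne ?_⟩
      exact (h.symm.trans ha' : _)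
  exact ⟨l, r, hl, hrn, hlr⟩

-- If the fence met a column in at most `n` points, detours along island boundaries would turn the
-- column into a king path of bad vertices and at most `n` others. This path has more than `3n/2`
-- vertices, so at least a quarter of them are bad: a long bad chain. This is why chains are only
-- required to be partly bad.
open Classical in
theorem column_card_of_isFence {k : Box n → ℤ} (hn : 1 ≤ n)
    (hk : ∀ e L, n < 8 * L → ¬ HasBadChain k e L) {A : Set (Box n)} (hA : IsFence A k) {i : ℤ}
    (hi : -(n : ℤ) ≤ i ∧ i ≤ n) :
    n + 1 ≤ (Finset.univ.filter fun p : Box n => p ∈ A ∧ p.1.1 = i).card := by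
  by_contra! hcard
  obtain ⟨u, hu, -⟩ := hA.far
  let T : Set (Box n) := {p | p ∈ A ∧ p.1.1 = i} ∪ {p | IsBad k p}
  -- A column vertex in `A` stands for itself; one outside `A` is replaced by the inner boundary of
  -- its island.
  let Rep : Box n → Set (Box n) := fun z =>
    {p | (z ∈ A ∧ p = z) ∨ (z ∉ A ∧ p ∈ innerBoundary (boxGraph n) (island A z))}
  have hbd : ∀ z, innerBoundary (boxGraph n) (island A z) ⊆ T := by
    rintro z w ⟨hw, a, ha, hwa⟩
    exact Or.inr (hA.bad w (clusterOf_subset hw) a (mem_of_adj_clusterOf_compl hw ha hwa) hwa)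
  have hbdc : ∀ z, ∀ p ∈ innerBoundary (boxGraph n) (island A z),
      ∀ q ∈ innerBoundary (boxGraph n) (island A z), q ∈ clusterOf (kingGraph n) T p :=
    fun z p hp q hq => clusterOf_mono (hbd z) (connectedIn_innerBoundary connectedIn_clusterOf
      (hA.connected.compl_clusterOf_compl ⟨u, hu⟩ boxGraph_preconnected z) p hp q hq)
  have hking : ∀ p q : Box n, (boxGraph n).Adj p q → (kingGraph n).Adj p q := fun p q h =>
    ⟨h.ne, by rw [boxGraph_adj] at h; simp only [supDist]; omega⟩
  have hRepne : ∀ z, (Rep z).Nonempty := by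
    intro z
    by_cases hz : z ∈ A
    · exact ⟨z, Or.inl ⟨hz, rfl⟩⟩
    · obtain ⟨p, hp⟩ := innerBoundary_nonempty (O := island A z) boxGraph_preconnected
        (mem_clusterOf_self hz) (fun h => clusterOf_subset h hu)
      exact ⟨p, Or.inr ⟨hz, hp⟩⟩
  have hRepc : ∀ z, z.1.1 = i → ∀ p ∈ Rep z, ∀ q ∈ Rep z, q ∈ clusterOf (kingGraph n) T p := by
    rintro z hzi p (⟨hz, rfl⟩ | ⟨hz, hp⟩) q (⟨hz', rfl⟩ | ⟨hz', hq⟩)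
    · exact mem_clusterOf_self (Or.inl ⟨hz, hzi⟩)
    · exact absurd hz hz'
    · exact absurd hz' hz
    · exact hbdc z p hp q hq
  have hRepadj : ∀ z z', z.1.1 = i → z'.1.1 = i → (boxGraph n).Adj z z' →
      ∀ p ∈ Rep z, ∀ q ∈ Rep z', q ∈ clusterOf (kingGraph n) T p := by
    rintro z z' hzi hzi' hadj p (⟨hz, rfl⟩ | ⟨hz, hp⟩) q (⟨hz', rfl⟩ | ⟨hz', hq⟩)
    · exact mem_clusterOf_of_adj (Or.inl ⟨hz, hzi⟩) (Or.inl ⟨hz', hzi'⟩) (hking _ _ hadj)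
    · have hb : z' ∈ innerBoundary (boxGraph n) (island A z') :=
        ⟨mem_clusterOf_self hz', p, fun h => clusterOf_subset h hz, hadj.symm⟩
      exact clusterOf_trans (mem_clusterOf_of_adj (Or.inl ⟨hz, hzi⟩) (hbd _ hb) (hking _ _ hadj))
        (hbdc z' z' hb q hq)
    · have hb : z ∈ innerBoundary (boxGraph n) (island A z) :=
        ⟨mem_clusterOf_self hz, q, fun h => clusterOf_subset h hz', hadj⟩
      exact clusterOf_step (hbdc z p hp z hb) (Or.inl ⟨hz', hzi'⟩) (hking _ _ hadj)
    · have : island A z' = island A z :=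
        clusterOf_eq_of_mem (mem_clusterOf_of_adj hz hz' hadj)
      rw [this] at hq
      exact hbdc z p hp q hq
  obtain ⟨p₀, hp₀⟩ := hRepne (Box.mk i (-n) hi (by omega))
  have hreach : ∀ s : ℕ, ∀ hs : -(n : ℤ) ≤ -(n : ℤ) + s ∧ -(n : ℤ) + s ≤ n,
      ∀ q ∈ Rep (Box.mk i (-(n : ℤ) + s) hi hs), q ∈ clusterOf (kingGraph n) T p₀ := by
    intro s
    induction s with
    | zero =>
      intro hs q hq
      refine hRepc _ rfl p₀ hp₀ q ?_
      simpa using hq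
    | succ s ih =>
      intro hs q hq
      obtain ⟨p, hp⟩ := hRepne (Box.mk i (-(n : ℤ) + s) hi (by omega))
      refine clusterOf_trans (ih _ p hp) (hRepadj _ _ rfl rfl ?_ p hp q hq)
      rw [boxGraph_adj]; simp only [Box.mk]; omega
  have hRepd : ∀ z, ∀ p ∈ Rep z, 8 * supDist z p ≤ 2 * n := by
    rintro z p (⟨hz, rfl⟩ | ⟨hz, hp⟩)
    · simp [supDist]
    · exact hA.supDist_le hk (mem_clusterOf_self hz) hp.1
  obtain ⟨p₁, hp₁⟩ := hRepne (Box.mk i (-(n : ℤ) + (2 * n : ℕ)) hi (by omega))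
  have h0 := hRepd _ p₀ hp₀
  have h1 := hRepd _ p₁ hp₁
  obtain ⟨l, hl, hhead, hnd, hlen, hlT⟩ := exists_king_path (hreach _ _ p₁ hp₁)
  -- The ends of the column are `2n` apart and each representative is within `n / 4` of its end.
  have hdist : 3 * n ≤ 2 * supDist p₀ p₁ := by
    simp only [supDist, Box.mk] at h0 h1 ⊢
    omega
  refine hk p₀ (l.length - 1) (by omega) ⟨l, hl, hhead, hnd, by omega,
    l.toFinset.filter (IsBad k), by simp, ?_⟩
  have hsub : l.toFinset ⊆ l.toFinset.filter (IsBad k) ∪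
      Finset.univ.filter fun p : Box n => p ∈ A ∧ p.1.1 = i := by
    intro v hv
    rw [List.mem_toFinset] at hv
    rcases hlT v hv with h | h
    · exact Finset.mem_union_right _ (by simpa using h)
    · exact Finset.mem_union_left _ (by simpa [hv] using h)
  have := (Finset.card_le_card hsub).trans (Finset.card_union_le _ _)
  rw [List.toFinset_card_of_nodup hnd] at this
  omega

theorem card_box : Fintype.card (Box n) = (2 * n + 1) ^ 2 := by
  rw [Fintype.card_coe, Finset.card_product, Int.card_Icc, sq]
  congr 1 <;> omega

/-- Summing over columns gives more than half of the `(2n+1)^2` vertices, so two disjoint sets of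
this size cannot coexist. -/
theorem ncard_of_isFence {k : Box n → ℤ} (hn : 1 ≤ n)
    (hk : ∀ e L, n < 8 * L → ¬ HasBadChain k e L) {A : Set (Box n)} (hA : IsFence A k) :
    (2 * n + 1) * (n + 1) ≤ A.ncard := by
  classical
  have h1 : A.ncard = (Finset.univ.filter fun p : Box n => p ∈ A).card := by
    rw [← Set.ncard_coe_finset]; simp
  rw [h1, Finset.card_eq_sum_card_fiberwise (f := fun p : Box n => p.1.1)
    (t := Finset.Icc (-(n : ℤ)) n) (fun p _ => by have := p.bounds; simp; omega)]
  have h2 : (Finset.Icc (-(n : ℤ)) n).card = 2 * n + 1 := by rw [Int.card_Icc]; omega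
  rw [← h2, ← smul_eq_mul]
  refine Finset.card_nsmul_le_sum _ _ _ fun i hi => ?_
  rw [Finset.mem_Icc] at hi
  rw [Finset.filter_filter]
  exact column_card_of_isFence hn hk hA hi

/-- A set of large diameter together with the information needed to use it as the set `I`. -/
structure IsSea (I : Set (Box n)) (k : Box n → ℤ) : Prop extends IsFence I k where
  const : ∀ x ∈ I, ∀ y ∈ I, k x = k y

open Classical in
/-- The member of a family of sets that has large diameter, if it is unique. -/
noncomputable def uniqueLarge (f : ℤ → Set (Box n)) : Set (Box n) :=
  if h : ∃! m : ℤ, HasLargeDiam (f m) then f h.choose else ∅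

/-- The set `I` for free boundary conditions, as a function of the labels. -/
noncomputable def labelSea (k : Box n → ℤ) : Set (Box n) :=
  uniqueLarge fun m => largestCluster (boxGraph n) {z | k z = m}

/-- The spanning cluster holds a strict majority of vertices, hence is the largest cluster of its
label. Clusters of any other label lie inside its islands, whose graph diameter is at most `n / 2`,
so no second label competes. -/
theorem isSea_labelSea {k : Box n → ℤ} (hn : 1 ≤ n)
    (hk : ∀ e L, n < 8 * L → ¬ HasBadChain k e L) : IsSea (labelSea k) k := by
  obtain ⟨l, r, hl, hr, hlr⟩ := exists_spanning_cluster hn hk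
  set A := clusterOf (boxGraph n) {w | k w = k l} l with hAdef
  have hfar : n < 2 * l1Dist l r := by simp only [l1Dist]; omega
  have hA : IsFence A k := isFence_clusterOf_label hlr hfar
  have hcard := ncard_of_isFence hn hk hA
  have hlarge : largestCluster (boxGraph n) {z | k z = k l} = A := by
    have hS : ({z | k z = k l} : Set (Box n)).Nonempty := ⟨l, rfl⟩
    rw [largestCluster, dif_pos hS]
    have hspec := (exists_largest_cluster (boxGraph n) hS).choose_spec
    generalize (exists_largest_cluster (boxGraph n) hS).choose = x at hspec
    have h1 := hspec.2 l rfl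
    by_cases hlx : l ∈ clusterOf (boxGraph n) {z | k z = k l} x
    · exact (clusterOf_eq_of_mem hlx).symm
    · exfalso
      have hdisj : Disjoint A (clusterOf (boxGraph n) {z | k z = k l} x) := by
        rw [Set.disjoint_left]
        exact fun y hy hy' => hlx (clusterOf_trans hy' (clusterOf_symm hy))
      have h2 := Set.ncard_union_eq hdisj (Set.toFinite _) (Set.toFinite _)
      have h3 := Set.ncard_le_card (A ∪ clusterOf (boxGraph n) {z | k z = k l} x)
      rw [Nat.card_eq_fintype_card, card_box, h2] at h3
      change A.ncard ≤ _ at h1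
      -- Both clusters would have at least `(2n+1)(n+1)` vertices, together more than the box
      -- contains.
      nlinarith
  have huniq : ∃! m : ℤ, HasLargeDiam (largestCluster (boxGraph n) {z | k z = m}) := by
    refine ⟨k l, ?_, ?_⟩
    · change HasLargeDiam (largestCluster (boxGraph n) {z | k z = k l})
      rw [hlarge, hasLargeDiam_iff]
      exact hA.far
    · intro m hm
      by_contra hne
      change HasLargeDiam _ at hm
      rw [hasLargeDiam_iff] at hm
      obtain ⟨u, hu, v, hv, huv⟩ := hm
      by_cases hS : ({z | k z = m} : Set (Box n)).Nonempty
      · rw [largestCluster, dif_pos hS] at hu hv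
        generalize (exists_largest_cluster (boxGraph n) hS).choose = x at hu hv
        have hsub : ({z | k z = m} : Set (Box n)) ⊆ Aᶜ := by
          intro z hz hzA
          have h1 : k z = k l := apply_of_mem_clusterOf hzA
          have h2 : k z = m := hz
          exact hne (h2.symm.trans h1)
        have := hA.supDist_le hk (clusterOf_mono hsub hu) (clusterOf_mono hsub hv)
        simp only [supDist, l1Dist] at this huv
        omega
      · rw [largestCluster, dif_neg hS] at hu
        exact hu
  have hsea : labelSea k = A := by
    rw [labelSea, uniqueLarge, dif_pos huniq]
    have := huniq.unique huniq.choose_spec.1 (y₂ := k l) (by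
      rw [hlarge, hasLargeDiam_iff]
      exact hA.far)
    rw [this, hlarge]
  rw [hsea]
  refine ⟨hA, fun x hx y hy => ?_⟩
  have h1 : k x = k l := apply_of_mem_clusterOf hx
  have h2 : k y = k l := apply_of_mem_clusterOf hy
  rw [h1, h2]

theorem freeSea_eq_labelSea {T : ℝ} {φ₁ φ₂ : Box n → ℝ} {k : Box n → ℤ}
    (h : ∀ z (m : ℤ), φ₁ z = φ₂ z + m * (2 * Real.pi / T) ↔ k z = m) :
    freeSea T φ₁ φ₂ = labelSea k := by
  have : levelSea T φ₁ φ₂ = fun m => largestCluster (boxGraph n) {z | k z = m} := by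
    funext m
    simp only [levelSea, h]
  change uniqueLarge (levelSea T φ₁ φ₂) = labelSea k
  rw [this, labelSea]

/-- The set `I` for Dirichlet boundary conditions, as a function of the labels. -/
def zeroSea (k : Box n → ℤ) : Set (Box n) :=
  {x | ∃ b ∈ boxBoundary n, x ∈ clusterOf (boxGraph n) {z | k z = 0} b}

theorem dirichletSea_eq_zeroSea {φ₁ φ₂ : Box n → ℝ} {k : Box n → ℤ}
    (h : ∀ z, φ₁ z = φ₂ z ↔ k z = 0) : dirichletSea φ₁ φ₂ = zeroSea k := by
  simp only [dirichletSea, zeroSea, h]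

theorem mem_boxBoundary {p : Box n} : p ∈ boxBoundary n ↔
    (p.1.1 = n ∨ p.1.1 = -n ∨ p.1.2 = n ∨ p.1.2 = -n) := by
  change |p.1.1| = (n : ℤ) ∨ |p.1.2| = (n : ℤ) ↔ _
  rw [abs_eq (by omega), abs_eq (by omega)]
  tauto

theorem corner_mem_clusterOf_boxBoundary {b : Box n} (hb : b ∈ boxBoundary n) :
    Box.mk (n := n) n n (by omega) (by omega) ∈ clusterOf (boxGraph n) (boxBoundary n) b := by
  have hbb := b.bounds
  have hcol : ∀ j (hj : -(n : ℤ) ≤ j ∧ j ≤ n), Box.mk (n := n) n n (by omega) (by omega) ∈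
      clusterOf (boxGraph n) (boxBoundary n) (Box.mk (n := n) n j (by omega) hj) := fun j hj =>
    column_mem_clusterOf _ _ _ fun t ht => mem_boxBoundary.2 (Or.inl rfl)
  have hrow : ∀ i (hi : -(n : ℤ) ≤ i ∧ i ≤ n), Box.mk (n := n) n n (by omega) (by omega) ∈
      clusterOf (boxGraph n) (boxBoundary n) (Box.mk (n := n) i n hi (by omega)) := fun i hi =>
    row_mem_clusterOf _ _ _ fun t ht => mem_boxBoundary.2 (Or.inr (Or.inr (Or.inl rfl)))
  have hbeq : b = Box.mk b.1.1 b.1.2 (by omega) (by omega) := rfl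
  rw [mem_boxBoundary] at hb
  by_cases h : b.1.2 = n ∨ b.1.2 = -n
  · refine clusterOf_trans (y := Box.mk (n := n) n b.1.2 (by omega) (by omega)) ?_ (hcol _ _)
    exact row_mem_clusterOf (i := b.1.1) (j := b.1.2) (by omega) _ (by omega) fun t ht =>
      mem_boxBoundary.2 (by simp only [Box.mk]; tauto)
  · refine clusterOf_trans (y := Box.mk (n := n) b.1.1 n (by omega) (by omega)) ?_ (hrow _ _)
    exact column_mem_clusterOf (i := b.1.1) (j := b.1.2) (by omega) (by omega) _ fun t ht =>
      mem_boxBoundary.2 (by simp only [Box.mk]; tauto)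

theorem apply_eq_zero_of_mem_zeroSea {k : Box n → ℤ} {x : Box n} (hx : x ∈ zeroSea k) :
    k x = 0 := by
  obtain ⟨b, -, hx⟩ := hx
  exact apply_of_mem_clusterOf hx

theorem mem_zeroSea_of_adj {k : Box n → ℤ} {x y : Box n} (hx : x ∈ zeroSea k) (hy : k y = 0)
    (h : (boxGraph n).Adj x y) : y ∈ zeroSea k := by
  obtain ⟨b, hb, hx⟩ := hx
  exact ⟨b, hb, clusterOf_step hx hy h⟩

theorem boxBoundary_subset_zeroSea {k : Box n → ℤ} (hk : ∀ z ∈ boxBoundary n, k z = 0) :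
    boxBoundary n ⊆ zeroSea k := fun b hb => ⟨b, hb, mem_clusterOf_self (hk b hb)⟩

/-- The boundary of the box is connected and lies in the zero set; opposite corners give diameter
`4n`. No condition on bad chains is needed here. -/
theorem isSea_zeroSea {k : Box n → ℤ} (hn : 1 ≤ n) (hk : ∀ z ∈ boxBoundary n, k z = 0) :
    IsSea (zeroSea k) k := by
  have hB := boxBoundary_subset_zeroSea hk
  have hcorner : ∀ b ∈ boxBoundary n, Box.mk (n := n) n n (by omega) (by omega) ∈
      clusterOf (boxGraph n) (zeroSea k) b := fun b hb =>
    clusterOf_mono hB (corner_mem_clusterOf_boxBoundary hb)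
  have hconn : ∀ x ∈ zeroSea k, Box.mk (n := n) n n (by omega) (by omega) ∈
      clusterOf (boxGraph n) (zeroSea k) x := by
    rintro x ⟨b, hb, hx⟩
    have hsub : clusterOf (boxGraph n) {z | k z = 0} b ⊆ zeroSea k := fun y hy => ⟨b, hb, hy⟩
    have := connectedIn_clusterOf (G := boxGraph n) x hx b
      (mem_clusterOf_self (left_mem_of_mem_clusterOf hx))
    exact clusterOf_trans (clusterOf_mono hsub this) (hcorner b hb)
  refine ⟨⟨fun x hx y hy => clusterOf_trans (hconn x hx) (clusterOf_symm (hconn y hy)),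
    ⟨Box.mk (n := n) (-n) (-n) (by omega) (by omega), hB (mem_boxBoundary.2 (by simp [Box.mk])),
      Box.mk (n := n) n n (by omega) (by omega), hB (mem_boxBoundary.2 (by simp [Box.mk])), ?_⟩,
    ?_⟩, ?_⟩
  · simp only [l1Dist, Box.mk]; omega
  · intro z hz a ha hza
    refine ⟨a, hza, fun h => hz (mem_zeroSea_of_adj ha ?_ hza.symm)⟩
    rw [← h, apply_eq_zero_of_mem_zeroSea ha]
  · intro x hx y hy
    rw [apply_eq_zero_of_mem_zeroSea hx, apply_eq_zero_of_mem_zeroSea hy]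

end LabelSea

/-! ### Counting chains -/

section ChainCount

variable {n : ℕ}

theorem card_supDist_le_one (e : Box n) :
    (Finset.univ.filter fun f : Box n => supDist e f ≤ 1).card ≤ 9 := by
  have h : ((Finset.univ.filter fun f : Box n => supDist e f ≤ 1).image fun f => f.1) ⊆
      Finset.Icc (e.1.1 - 1) (e.1.1 + 1) ×ˢ Finset.Icc (e.1.2 - 1) (e.1.2 + 1) := by
    intro p hp
    simp only [Finset.mem_image, Finset.mem_filter, Finset.mem_univ, true_and] at hp
    obtain ⟨f, hf, rfl⟩ := hp
    simp only [supDist] at hf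
    simp only [Finset.mem_product, Finset.mem_Icc]
    omega
  have h2 := Finset.card_le_card h
  rw [Finset.card_image_of_injective _ Subtype.val_injective, Finset.card_product, Int.card_Icc,
    Int.card_Icc] at h2
  refine h2.trans (le_of_eq ?_)
  rw [show e.1.1 + 1 + 1 - (e.1.1 - 1) = 3 by ring, show e.1.2 + 1 + 1 - (e.1.2 - 1) = 3 by ring]
  rfl

/-- The king walks of `L` steps from `e`. -/
noncomputable def kingWalks : ℕ → Box n → Finset (List (Box n))
  | 0, e => {[e]}
  | L + 1, e => (Finset.univ.filter fun f : Box n => supDist e f ≤ 1).biUnion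
      fun f => (kingWalks L f).image (e :: ·)

theorem card_kingWalks (L : ℕ) (e : Box n) : (kingWalks L e).card ≤ 9 ^ L := by
  induction L generalizing e with
  | zero => simp [kingWalks]
  | succ L ih =>
    rw [kingWalks, pow_succ']
    refine (Finset.card_biUnion_le_card_mul _ _ (9 ^ L) fun f _ => ?_).trans
      (Nat.mul_le_mul_right _ (card_supDist_le_one e))
    exact Finset.card_image_le.trans (ih f)

theorem mem_kingWalks {l : List (Box n)} {L : ℕ} {e : Box n}
    (hl : l.IsChain (fun a b => supDist a b ≤ 1)) (he : l.head? = some e)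
    (hL : l.length = L + 1) : l ∈ kingWalks L e := by
  induction L generalizing e l with
  | zero =>
    match l, he, hL with
    | [a], he, _ => simp only [List.head?_cons, Option.some.injEq] at he; simp [kingWalks, he]
  | succ L ih =>
    match l, hl, he, hL with
    | a :: b :: l, hl, he, hL =>
      simp only [List.head?_cons, Option.some.injEq] at he
      subst he
      rw [List.isChain_cons_cons] at hl
      simp only [kingWalks, Finset.mem_biUnion, Finset.mem_filter, Finset.mem_univ, true_and,
        Finset.mem_image]
      exact ⟨b, hl.1, b :: l, ih hl.2 rfl (by simpa using hL), rfl⟩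

open scoped ENNReal

/-- Union bound: at most `9 ^ L` king walks, at most `2 ^ (L + 1)` choices of the bad vertices, and
cost `q ^ F.card ≤ r ^ (4 * F.card) ≤ r ^ (L + 1)` since a quarter of the vertices are bad. -/
theorem measure_hasBadChain_le {κ : Measure (Box n → ℤ)} {q r : ℝ≥0∞}
    (hbad : ∀ F : Finset (Box n), κ {k | ∀ v ∈ F, IsBad k v} ≤ q ^ F.card) (hq : q ≤ r ^ 4)
    (hr : r ≤ 1) (e : Box n) (L : ℕ) :
    κ {k | HasBadChain k e L} ≤ (18 * r) ^ (L + 1) := by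
  classical
  have hsub : {k | HasBadChain k e L} ⊆ ⋃ l ∈ kingWalks L e,
      ⋃ F ∈ l.toFinset.powerset.filter (fun F => L + 1 ≤ 4 * F.card),
        {k : Box n → ℤ | ∀ v ∈ F, IsBad k v} := by
    rintro k ⟨l, hl, he, -, hlen, F, hF, hFc⟩
    simp only [Set.mem_iUnion, Finset.mem_filter, Finset.mem_powerset, exists_prop]
    exact ⟨l, mem_kingWalks hl he hlen, F, ⟨fun v hv => List.mem_toFinset.2 (hF v hv).1, hFc⟩,
      fun v hv => (hF v hv).2⟩
  have hF : ∀ F : Finset (Box n), L + 1 ≤ 4 * F.card →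
      κ {k : Box n → ℤ | ∀ v ∈ F, IsBad k v} ≤ r ^ (L + 1) := fun F hF =>
    (hbad F).trans ((pow_le_pow_left' hq _).trans (by
      rw [← pow_mul]; exact pow_le_pow_right_of_le_one' hr hF))
  have hlen : ∀ l ∈ kingWalks L e, l.toFinset.card ≤ L + 1 := by
    intro l hl
    refine l.toFinset_card_le.trans (le_of_eq ?_)
    clear hsub hF
    induction L generalizing e l with
    | zero => simp only [kingWalks, Finset.mem_singleton] at hl; simp [hl]
    | succ L ih =>
      simp only [kingWalks, Finset.mem_biUnion, Finset.mem_image] at hl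
      obtain ⟨f, -, l', hl', rfl⟩ := hl
      simp [ih f l' hl']
  calc κ {k | HasBadChain k e L}
      ≤ ∑ l ∈ kingWalks L e, ∑ F ∈ l.toFinset.powerset.filter (fun F => L + 1 ≤ 4 * F.card),
          κ {k : Box n → ℤ | ∀ v ∈ F, IsBad k v} :=
        (measure_mono hsub).trans ((measure_biUnion_finset_le _ _).trans
          (Finset.sum_le_sum fun l _ => measure_biUnion_finset_le _ _))
    _ ≤ ∑ l ∈ kingWalks L e, 2 ^ (L + 1) * r ^ (L + 1) := by
        refine Finset.sum_le_sum fun l hl => ?_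
        refine (Finset.sum_le_card_nsmul _ _ (r ^ (L + 1)) fun F hF' => hF F
          (Finset.mem_filter.1 hF').2).trans ?_
        rw [nsmul_eq_mul]
        refine mul_le_mul_left ?_ _
        refine (Nat.cast_le.2 ((Finset.card_filter_le _ _).trans ?_)).trans
          (le_of_eq (by push_cast; rfl : ((2 ^ (L + 1) : ℕ) : ℝ≥0∞) = 2 ^ (L + 1)))
        rw [Finset.card_powerset]
        exact Nat.pow_le_pow_right two_pos (hlen l hl)
    _ ≤ 9 ^ (L + 1) * (2 ^ (L + 1) * r ^ (L + 1)) := by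
        rw [Finset.sum_const, nsmul_eq_mul]
        refine mul_le_mul_left ?_ _
        refine (Nat.cast_le.2 ((card_kingWalks L e).trans
          (Nat.pow_le_pow_right (by norm_num) (Nat.le_succ L)))).trans (le_of_eq ?_)
        push_cast; rfl
    _ = (18 * r) ^ (L + 1) := by
        rw [← mul_pow, ← mul_pow, ← mul_assoc]; norm_num

/-- There is a bad chain from `e`, with a number of steps comparable to `j` or larger. -/
def HasFarBadChain (k : Box n → ℤ) (e : Box n) (j : ℕ) : Prop :=
  ∃ L, j ≤ 64 * L ∧ HasBadChain k e L

/-- With `r = β ^ 65 / 18` a chain of `L` steps costs `β ^ (65 * (L + 1))`. As `j ≤ 64 * L`, this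
contains the factor `β ^ (j + 1)` and still leaves `β ^ L` to sum over `L`. The ratio 64 makes
chains with `n < 8 * L` count as far for every `j ≤ 8 * n`, which covers all distances used later.
-/
theorem measure_hasFarBadChain_le {κ : Measure (Box n → ℤ)} {q β : ℝ≥0∞}
    (hbad : ∀ F : Finset (Box n), κ {k | ∀ v ∈ F, IsBad k v} ≤ q ^ F.card)
    (hq : q ≤ (β ^ 65 / 18) ^ 4) (hβ : β ≤ 2⁻¹) (e : Box n) (j : ℕ) :
    κ {k | HasFarBadChain k e j} ≤ 2 * β ^ (j + 1) := by
  have hβ1 : β ≤ 1 := hβ.trans (by norm_num)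
  have hr : β ^ 65 / 18 ≤ 1 := by
    refine ENNReal.div_le_of_le_mul ?_
    exact (pow_le_one' hβ1 65).trans (by norm_num)
  have hsub : {k : Box n → ℤ | HasFarBadChain k e j} ⊆
      ⋃ L : ℕ, {k | j ≤ 64 * L ∧ HasBadChain k e L} := by
    rintro k ⟨L, h⟩
    exact Set.mem_iUnion.2 ⟨L, h⟩
  calc κ {k | HasFarBadChain k e j}
      ≤ ∑' L : ℕ, κ {k | j ≤ 64 * L ∧ HasBadChain k e L} :=
        (measure_mono hsub).trans (measure_iUnion_le _)
    _ ≤ ∑' L : ℕ, β ^ (j + 1) * 2⁻¹ ^ L := by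
        refine ENNReal.tsum_le_tsum fun L => ?_
        by_cases hL : j ≤ 64 * L
        · have h1 : κ {k | j ≤ 64 * L ∧ HasBadChain k e L} ≤ (18 * (β ^ 65 / 18)) ^ (L + 1) := by
            refine (measure_mono ?_).trans (measure_hasBadChain_le hbad hq hr e L)
            exact fun k hk => hk.2
          rw [ENNReal.mul_div_cancel (by norm_num) (by norm_num), ← pow_mul] at h1
          refine h1.trans ((pow_le_pow_right_of_le_one' hβ1 (n := (j + 1) + L) (by omega)).trans ?_)
          rw [pow_add]
          gcongr
        · simp [hL]
    _ = 2 * β ^ (j + 1) := by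
        rw [ENNReal.tsum_mul_left, ENNReal.tsum_geometric, ENNReal.one_sub_inv_two, inv_inv,
          mul_comm]

theorem ENNReal.tsum_int (g : ℤ → ℝ≥0∞) :
    ∑' i, g i = ∑' m : ℕ, g m + ∑' m : ℕ, g (-(m + 1)) :=
  (ENNReal.summable.hasSum.of_nat_of_neg_add_one ENNReal.summable.hasSum).tsum_eq

/-- The sum is dominated by the square of a one-dimensional two-sided geometric series, bounded by
4. -/
theorem sum_half_pow_l1Dist_le (x : Box n) : ∑ e : Box n, (2⁻¹ : ℝ≥0∞) ^ l1Dist e x ≤ 16 := by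
  have hZ : ∑' i : ℤ, (2⁻¹ : ℝ≥0∞) ^ i.natAbs ≤ 4 := by
    have h : ∑' m : ℕ, (2⁻¹ : ℝ≥0∞) ^ m = 2 := by
      rw [ENNReal.tsum_geometric, ENNReal.one_sub_inv_two, inv_inv]
    rw [ENNReal.tsum_int]
    have h3 : ∑' m : ℕ, (2⁻¹ : ℝ≥0∞) ^ (-((m : ℤ) + 1)).natAbs ≤ 2 := by
      refine (ENNReal.tsum_le_tsum fun m => ?_).trans h.le
      exact pow_le_pow_right_of_le_one' (by norm_num) (by omega)
    have h4 : ∑' m : ℕ, (2⁻¹ : ℝ≥0∞) ^ (m : ℤ).natAbs = 2 := h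
    rw [h4]
    exact (add_le_add_right h3 2).trans (by norm_num)
  have hinj : Function.Injective fun e : Box n => ((e.1.1 - x.1.1, e.1.2 - x.1.2) : ℤ × ℤ) := by
    intro a b hab
    simp only [Prod.mk.injEq] at hab
    exact Subtype.ext (Prod.ext (by omega) (by omega))
  calc ∑ e : Box n, (2⁻¹ : ℝ≥0∞) ^ l1Dist e x
      = ∑' e : Box n, (fun p : ℤ × ℤ => (2⁻¹ : ℝ≥0∞) ^ p.1.natAbs * 2⁻¹ ^ p.2.natAbs)
          (e.1.1 - x.1.1, e.1.2 - x.1.2) := by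
        rw [tsum_fintype]
        simp only [l1Dist, pow_add]
    _ ≤ ∑' p : ℤ × ℤ, (2⁻¹ : ℝ≥0∞) ^ p.1.natAbs * 2⁻¹ ^ p.2.natAbs :=
        ENNReal.tsum_comp_le_tsum_of_injective hinj _
    _ = (∑' i : ℤ, (2⁻¹ : ℝ≥0∞) ^ i.natAbs) * ∑' i : ℤ, (2⁻¹ : ℝ≥0∞) ^ i.natAbs := by
        rw [ENNReal.tsum_prod']
        simp only [ENNReal.tsum_mul_left, ENNReal.tsum_mul_right]
    _ ≤ 4 * 4 := mul_le_mul' hZ hZ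
    _ = 16 := by norm_num

end ChainCount

/-! ### Moments of random labellings with few bad vertices -/

section RandomLabels

open scoped ENNReal

variable {n : ℕ}

theorem eLpNorm_indicator_le_rpow_mul {α : Type*} [MeasurableSpace α] {μ : Measure α}
    {f : α → ℝ} (hf : AEStronglyMeasurable f μ) {s : Set α} (hs : MeasurableSet s)
    {p q : ℝ≥0∞} (hpq : p ≤ q) :
    eLpNorm (s.indicator f) p μ ≤ μ s ^ (1 / p.toReal - 1 / q.toReal) * eLpNorm f q μ := by
  rw [eLpNorm_indicator_eq_eLpNorm_restrict hs, mul_comm]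
  refine (eLpNorm_le_eLpNorm_mul_rpow_measure_univ hpq hf.restrict).trans ?_
  rw [Measure.restrict_apply_univ]
  gcongr
  exact Measure.restrict_le_self

theorem ENNReal.rpow_eighth_le {x γ : ℝ≥0∞} {m : ℕ} (h : x ≤ 2 * (γ ^ 8) ^ m) :
    x ^ (1 / 8 : ℝ) ≤ 2 * γ ^ m := by
  have h' : x ≤ (2 * γ ^ m) ^ 8 := by
    refine h.trans ?_
    rw [mul_pow, ← pow_mul, ← pow_mul, mul_comm 8 m]
    gcongr
    norm_num
  calc x ^ (1 / 8 : ℝ) ≤ ((2 * γ ^ m) ^ 8) ^ (1 / 8 : ℝ) := by gcongr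
    _ = 2 * γ ^ m := by
      rw [← ENNReal.rpow_natCast, ← ENNReal.rpow_mul]; norm_num

/-- A random labelling `k` of the box, scaled by `c`, in which bad vertices are rare and which has
bounded gradients; `I k` is a set as in `IsSea` unless there is a long bad chain. -/
structure RareBad (κ : Measure (Box n → ℤ)) (c : ℝ) (q C : ℝ≥0∞) (x₀ : Box n)
    (I : (Box n → ℤ) → Set (Box n)) : Prop where
  bad : ∀ F : Finset (Box n), κ {k | ∀ v ∈ F, IsBad k v} ≤ q ^ F.card
  grad : ∀ x z, eLpNorm (fun k => c * (k x - k z : ℝ)) 8 κ ≤ C * l1Dist x z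
  root : ∀ᵐ k ∂κ, k x₀ = 0
  sea : ∀ᵐ k ∂κ, IsSea (I k) k ∨ ∃ e L, n < 8 * L ∧ HasBadChain k e L

variable {κ : Measure (Box n → ℤ)} {c : ℝ} {q C : ℝ≥0∞} {x₀ : Box n}
  {I : (Box n → ℤ) → Set (Box n)}

theorem supDist_le_two_mul (x y : Box n) : supDist x y ≤ 2 * n := by
  have := x.bounds
  have := y.bounds
  simp only [supDist]; omega

theorem l1Dist_le_four_mul (x y : Box n) : l1Dist x y ≤ 4 * n := by
  have := x.bounds
  have := y.bounds
  simp only [l1Dist]; omega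

/-- A linear factor is absorbed by `m + 1 ≤ 2 ^ m`. The exponent `2 * s` is wanted because the `l1`
distance is at most twice the sup distance. -/
theorem nat_mul_pow_le {γ : ℝ≥0∞} (hγ : γ ≤ 2000⁻¹) {m : ℕ} (s : ℕ) (hs : s ≤ m) :
    (m + 1 : ℕ) * γ ^ (m + 1) ≤ γ * 2⁻¹ ^ (2 * s) := by
  have h1 : ((m + 1 : ℕ) : ℝ≥0∞) ≤ 2 ^ m := by
    exact_mod_cast Nat.lt_two_pow_self
  calc ((m + 1 : ℕ) : ℝ≥0∞) * γ ^ (m + 1) ≤ 2 ^ m * γ ^ (m + 1) := by gcongr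
    _ = γ * (2 * γ) ^ m := by rw [mul_pow, pow_succ]; ring
    _ ≤ γ * (2⁻¹ ^ 2) ^ m := by
        gcongr
        calc 2 * γ ≤ 2 * 2000⁻¹ := by gcongr
          _ ≤ 2⁻¹ ^ 2 := by
            rw [← ENNReal.inv_pow, ← div_eq_mul_inv]
            refine ENNReal.div_le_of_le_mul ?_
            rw [← ENNReal.div_eq_inv_mul, ENNReal.le_div_iff_mul_le] <;> norm_num
    _ ≤ γ * 2⁻¹ ^ (2 * s) := by
        rw [← pow_mul]
        exact mul_le_mul_right (pow_le_pow_right_of_le_one' (by norm_num) (by omega)) _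

theorem two_inv_pow_supDist_le (e x : Box n) :
    (2⁻¹ : ℝ≥0∞) ^ (2 * supDist e x) ≤ 2⁻¹ ^ l1Dist e x :=
  pow_le_pow_right_of_le_one' (by norm_num) (by simp only [supDist, l1Dist]; omega)

theorem pow_eight_le {γ : ℝ≥0∞} (hγ : γ ≤ 1) : γ ^ 8 ≤ γ :=
  (pow_le_pow_right_of_le_one' hγ (by norm_num : 1 ≤ 8)).trans_eq (pow_one γ)

theorem pow_eight_le_half {γ : ℝ≥0∞} (hγ : γ ≤ 2000⁻¹) : γ ^ 8 ≤ 2⁻¹ :=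
  (pow_eight_le (hγ.trans (by norm_num))).trans (hγ.trans (ENNReal.inv_le_inv.2 (by norm_num)))

theorem measurable_labels {β : Type*} [MeasurableSpace β] (f : (Box n → ℤ) → β) : Measurable f :=
  Measurable.of_discrete

theorem aestronglyMeasurable_labels (f : (Box n → ℤ) → ℝ) : AEStronglyMeasurable f κ :=
  (measurable_labels f).aestronglyMeasurable

/-- Hölder between exponents 4 and 8 costs the probability to the power `1/4 - 1/8 = 1/8`; taking `β
= γ ^ 8` turns this into a power of `γ`. -/
theorem RareBad.eLpNorm_indicator_le [IsProbabilityMeasure κ] {γ : ℝ≥0∞} (hγ : γ ≤ 2000⁻¹)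
    (h : RareBad κ c q C x₀ I) (hq : q ≤ ((γ ^ 8) ^ 65 / 18) ^ 4) (e x z : Box n) (j : ℕ) :
    eLpNorm ({k | HasFarBadChain k e j}.indicator fun k => c * (k x - k z : ℝ)) 4 κ ≤
      2 * γ ^ (j + 1) * (C * l1Dist x z) := by
  have hγ8 := pow_eight_le_half hγ
  refine (eLpNorm_indicator_le_rpow_mul (aestronglyMeasurable_labels _)
    (MeasurableSet.of_discrete) (q := 8) (by norm_num)).trans ?_
  refine mul_le_mul' ?_ (h.grad x z)
  have : (1 / (4 : ℝ≥0∞).toReal - 1 / (8 : ℝ≥0∞).toReal) = 1 / 8 := by norm_num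
  rw [this]
  exact ENNReal.rpow_eighth_le (measure_hasFarBadChain_le h.bad hq hγ8 e j)

open Classical in
/-- Control on the difference between `k x` and the label of the sea. -/
noncomputable def seaGap (c : ℝ) (x : Box n) (k : Box n → ℤ) : ℝ :=
  ∑ e, ∑ z with (boxGraph n).Adj e z,
    ‖{k | HasFarBadChain k e (supDist e x)}.indicator (fun k => c * (k x - k z : ℝ)) k‖

/-- The label of the sea may be read at the neighbour `z ∈ I k` of the start `e` of the chain around
the island of `x`. The corresponding summand is then exactly the left side, and all other summands
are nonnegative. -/
theorem abs_sub_le_seaGap {k : Box n → ℤ} (hI : IsSea (I k) k) (x : Box n) {a : Box n}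
    (ha : a ∈ I k) : |c * (k x - k a : ℝ)| ≤ seaGap c x k := by
  classical
  have hnn : ∀ e z, 0 ≤ ‖{k | HasFarBadChain k e (supDist e x)}.indicator
      (fun k => c * (k x - k z : ℝ)) k‖ := fun _ _ => norm_nonneg _
  by_cases hx : x ∈ I k
  · rw [hI.const x hx a ha]
    rw [sub_self, mul_zero, abs_zero]
    exact Finset.sum_nonneg fun e _ => Finset.sum_nonneg fun z _ => hnn e z
  · obtain ⟨e, z, L, hz, hez, hL, hfar⟩ := hI.exists_hasBadChain hx
    have hmem : k ∈ {k | HasFarBadChain k e (supDist e x)} := by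
      refine ⟨L, ?_, hL⟩
      rcases hfar with h | h
      · have := supDist_le_two_mul e x; omega
      · have := h x (mem_clusterOf_self hx); omega
    calc |c * (k x - k a : ℝ)|
        = ‖{k | HasFarBadChain k e (supDist e x)}.indicator (fun k => c * (k x - k z : ℝ)) k‖ := by
          rw [Set.indicator_of_mem hmem, hI.const a ha z hz, Real.norm_eq_abs]
      _ ≤ ∑ z with (boxGraph n).Adj e z, ‖{k | HasFarBadChain k e (supDist e x)}.indicator
            (fun k => c * (k x - k z : ℝ)) k‖ :=
          Finset.single_le_sum (f := fun z => ‖{k | HasFarBadChain k e (supDist e x)}.indicator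
            (fun k => c * (k x - k z : ℝ)) k‖) (fun z _ => hnn e z) (by simpa using hez)
      _ ≤ seaGap c x k :=
          Finset.single_le_sum (f := fun e => ∑ z with (boxGraph n).Adj e z,
            ‖{k | HasFarBadChain k e (supDist e x)}.indicator (fun k => c * (k x - k z : ℝ)) k‖)
            (fun e _ => Finset.sum_nonneg fun z _ => hnn e z) (Finset.mem_univ e)

/-- The increment from `x` to `z` costs a factor linear in `supDist e x + 1`, which the exponential
rarity of chains from `e` absorbs. The constant is `4 * 9 * 16`: term, neighbours of `e`, sum over
`e`. -/
theorem RareBad.eLpNorm_seaGap_le [IsProbabilityMeasure κ] {γ : ℝ≥0∞} (hγ : γ ≤ 2000⁻¹)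
    (h : RareBad κ c q C x₀ I) (hq : q ≤ ((γ ^ 8) ^ 65 / 18) ^ 4) (x : Box n) :
    eLpNorm (seaGap c x) 4 κ ≤ 576 * (C * γ) := by
  classical
  have hm : ∀ f : (Box n → ℤ) → ℝ, AEStronglyMeasurable f κ := aestronglyMeasurable_labels
  have hterm : ∀ e z, (boxGraph n).Adj e z →
      eLpNorm ({k | HasFarBadChain k e (supDist e x)}.indicator fun k => c * (k x - k z : ℝ)) 4 κ ≤
        4 * (C * γ) * 2⁻¹ ^ l1Dist e x := by
    intro e z hez
    rw [boxGraph_adj] at hez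
    refine (h.eLpNorm_indicator_le hγ hq e x z _).trans ?_
    have hl : l1Dist x z ≤ 2 * (supDist e x + 1) := by
      simp only [l1Dist, supDist]; omega
    calc 2 * γ ^ (supDist e x + 1) * (C * l1Dist x z)
        ≤ 2 * γ ^ (supDist e x + 1) * (C * (2 * (supDist e x + 1) : ℕ)) := by gcongr
      _ = 4 * C * ((supDist e x + 1 : ℕ) * γ ^ (supDist e x + 1)) := by push_cast; ring
      _ ≤ 4 * C * (γ * 2⁻¹ ^ (2 * supDist e x)) := by
          refine mul_le_mul_right ?_ _
          exact nat_mul_pow_le hγ _ le_rfl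
      _ ≤ 4 * C * (γ * 2⁻¹ ^ l1Dist e x) := by
          gcongr 4 * C * (γ * ?_)
          exact two_inv_pow_supDist_le e x
      _ = 4 * (C * γ) * 2⁻¹ ^ l1Dist e x := by ring
  have hcard : ∀ e : Box n, ((Finset.univ.filter fun z => (boxGraph n).Adj e z).card : ℝ≥0∞) ≤ 9 := by
    intro e
    have : (Finset.univ.filter fun z => (boxGraph n).Adj e z).card ≤ 9 := by
      refine (Finset.card_le_card ?_).trans (card_supDist_le_one e)
      intro z hz
      simp only [Finset.mem_filter, Finset.mem_univ, true_and] at hz ⊢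
      rw [boxGraph_adj] at hz
      simp only [supDist]; omega
    exact_mod_cast this
  have hfun : seaGap c x = ∑ e, ∑ z with (boxGraph n).Adj e z, fun k =>
      ‖{k | HasFarBadChain k e (supDist e x)}.indicator (fun k => c * (k x - k z : ℝ)) k‖ := by
    funext k
    simp only [seaGap, Finset.sum_apply]
  rw [hfun]
  calc eLpNorm (∑ e, ∑ z with (boxGraph n).Adj e z, fun k =>
        ‖{k | HasFarBadChain k e (supDist e x)}.indicator (fun k => c * (k x - k z : ℝ)) k‖) 4 κ
      ≤ ∑ e, ∑ z with (boxGraph n).Adj e z, eLpNorm (fun k =>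
        ‖{k | HasFarBadChain k e (supDist e x)}.indicator (fun k => c * (k x - k z : ℝ)) k‖) 4 κ :=
        (eLpNorm_sum_le (fun _ _ => hm _) (by norm_num)).trans
          (Finset.sum_le_sum fun e _ => eLpNorm_sum_le (fun _ _ => hm _) (by norm_num))
    _ ≤ ∑ e : Box n, 9 * (4 * (C * γ) * 2⁻¹ ^ l1Dist e x) := by
        refine Finset.sum_le_sum fun e _ => ?_
        refine (Finset.sum_le_card_nsmul _ _ (4 * (C * γ) * 2⁻¹ ^ l1Dist e x) fun z hz => ?_).trans ?_
        · rw [eLpNorm_norm]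
          exact hterm e z (by simpa using hz)
        · rw [nsmul_eq_mul]
          exact mul_le_mul_left (hcard e) _
    _ = 36 * (C * γ) * ∑ e : Box n, 2⁻¹ ^ l1Dist e x := by
        rw [Finset.mul_sum]
        refine Finset.sum_congr rfl fun e _ => ?_
        ring
    _ ≤ 36 * (C * γ) * 16 := by
        gcongr
        exact sum_half_pow_l1Dist_le x
    _ = 576 * (C * γ) := by ring

/-- Control on `k x` when there is a long bad chain. -/
noncomputable def longGap (c : ℝ) (x₀ x : Box n) (k : Box n → ℤ) : ℝ :=
  ∑ e, ‖{k | HasFarBadChain k e (6 * n)}.indicator (fun k => c * (k x - k x₀ : ℝ)) k‖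

theorem abs_sub_le_longGap {k : Box n → ℤ} (hk : ∃ e L, n < 8 * L ∧ HasBadChain k e L)
    (x : Box n) : |c * (k x - k x₀ : ℝ)| ≤ longGap c x₀ x k := by
  obtain ⟨e, L, hL, he⟩ := hk
  have hmem : k ∈ {k | HasFarBadChain k e (6 * n)} := ⟨L, by omega, he⟩
  calc |c * (k x - k x₀ : ℝ)|
      = ‖{k | HasFarBadChain k e (6 * n)}.indicator (fun k => c * (k x - k x₀ : ℝ)) k‖ := by
        rw [Set.indicator_of_mem hmem, Real.norm_eq_abs]
    _ ≤ longGap c x₀ x k := Finset.single_le_sum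
        (f := fun e => ‖{k | HasFarBadChain k e (6 * n)}.indicator
          (fun k => c * (k x - k x₀ : ℝ)) k‖) (fun e _ => norm_nonneg _) (Finset.mem_univ e)

theorem RareBad.eLpNorm_longGap_le [IsProbabilityMeasure κ] {γ : ℝ≥0∞} (hγ : γ ≤ 2000⁻¹)
    (h : RareBad κ c q C x₀ I) (hq : q ≤ ((γ ^ 8) ^ 65 / 18) ^ 4) (x : Box n) :
    eLpNorm (longGap c x₀ x) 4 κ ≤ 32 * (C * γ) := by
  have hm : ∀ f : (Box n → ℤ) → ℝ, AEStronglyMeasurable f κ := aestronglyMeasurable_labels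
  have hfun : longGap c x₀ x = ∑ e, fun k =>
      ‖{k | HasFarBadChain k e (6 * n)}.indicator (fun k => c * (k x - k x₀ : ℝ)) k‖ := by
    funext k
    simp only [longGap, Finset.sum_apply]
  rw [hfun]
  calc _ ≤ ∑ e, eLpNorm (fun k =>
        ‖{k | HasFarBadChain k e (6 * n)}.indicator (fun k => c * (k x - k x₀ : ℝ)) k‖) 4 κ :=
        eLpNorm_sum_le (fun _ _ => hm _) (by norm_num)
    _ ≤ ∑ e : Box n, 2 * (C * γ) * 2⁻¹ ^ l1Dist e x := by
        refine Finset.sum_le_sum fun e _ => ?_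
        rw [eLpNorm_norm]
        refine (h.eLpNorm_indicator_le hγ hq e x x₀ _).trans ?_
        have hl : l1Dist x x₀ ≤ 6 * n + 1 := by
          have := l1Dist_le_four_mul x x₀; omega
        calc 2 * γ ^ (6 * n + 1) * (C * l1Dist x x₀)
            ≤ 2 * γ ^ (6 * n + 1) * (C * (6 * n + 1 : ℕ)) := by gcongr
          _ = 2 * C * ((6 * n + 1 : ℕ) * γ ^ (6 * n + 1)) := by ring
          _ ≤ 2 * C * (γ * 2⁻¹ ^ (2 * supDist e x)) := by
              refine mul_le_mul_right ?_ _
              exact nat_mul_pow_le hγ _ (by have := supDist_le_two_mul e x; omega)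
          _ ≤ 2 * C * (γ * 2⁻¹ ^ l1Dist e x) := by
              gcongr 2 * C * (γ * ?_)
              exact two_inv_pow_supDist_le e x
          _ = 2 * (C * γ) * 2⁻¹ ^ l1Dist e x := by ring
    _ = 2 * (C * γ) * ∑ e : Box n, 2⁻¹ ^ l1Dist e x := by rw [Finset.mul_sum]
    _ ≤ 2 * (C * γ) * 16 := by
        gcongr
        exact sum_half_pow_l1Dist_le x
    _ = 32 * (C * γ) := by ring

/-- The labels have bounded fourth moments. -/
theorem RareBad.eLpNorm_le_one [IsProbabilityMeasure κ] {γ : ℝ≥0∞} (hγ : γ ≤ 2000⁻¹)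
    (h : RareBad κ c q C x₀ I) (hq : q ≤ ((γ ^ 8) ^ 65 / 18) ^ 4) (hC : 1184 * (C * γ) ≤ 1)
    (x : Box n) : eLpNorm (fun k : Box n → ℤ => c * (k x : ℝ)) 4 κ ≤ 1 := by
  have hm : ∀ f : (Box n → ℤ) → ℝ, AEStronglyMeasurable f κ := aestronglyMeasurable_labels
  have hpt : ∀ᵐ k ∂κ, ‖c * (k x : ℝ)‖ ≤ (seaGap c x + seaGap c x₀ + longGap c x₀ x) k := by
    filter_upwards [h.root, h.sea] with k h0 hsea
    have hgap : ∀ y, 0 ≤ seaGap c y k := fun y =>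
      Finset.sum_nonneg fun e _ => Finset.sum_nonneg fun z _ => norm_nonneg _
    have hlong : 0 ≤ longGap c x₀ x k := Finset.sum_nonneg fun e _ => norm_nonneg _
    have e0 : c * (k x : ℝ) = c * (k x - k x₀ : ℝ) := by rw [h0]; simp
    simp only [Pi.add_apply, Real.norm_eq_abs]
    -- When there is a sea, its label is eliminated between `x` and the root `x₀`; otherwise the
    -- increment from the root is bounded directly, at a cost linear in `n` against a chain of
    -- length of order `n`.
    rcases hsea with hsea | hlongc
    · obtain ⟨a, ha, -⟩ := hsea.far
      have h1 := abs_sub_le_seaGap (c := c) hsea x ha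
      have h2 := abs_sub_le_seaGap (c := c) hsea x₀ ha
      have e1 : c * (k x : ℝ) = c * (k x - k a : ℝ) - c * (k x₀ - k a : ℝ) := by
        rw [e0]; ring
      rw [e1]
      have := abs_sub (c * (k x - k a : ℝ)) (c * (k x₀ - k a : ℝ))
      linarith
    · have := abs_sub_le_longGap (c := c) (x₀ := x₀) hlongc x
      rw [e0]
      have := hgap x
      have := hgap x₀
      linarith
  calc eLpNorm (fun k : Box n → ℤ => c * (k x : ℝ)) 4 κ
      ≤ eLpNorm (seaGap c x + seaGap c x₀ + longGap c x₀ x) 4 κ := eLpNorm_mono_ae_real hpt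
    _ ≤ eLpNorm (seaGap c x) 4 κ + eLpNorm (seaGap c x₀) 4 κ + eLpNorm (longGap c x₀ x) 4 κ :=
        (eLpNorm_add_le (hm _) (hm _) (by norm_num)).trans
          (add_le_add_left (eLpNorm_add_le (hm _) (hm _) (by norm_num)) _)
    _ ≤ 576 * (C * γ) + 576 * (C * γ) + 32 * (C * γ) :=
        add_le_add (add_le_add (h.eLpNorm_seaGap_le hγ hq x) (h.eLpNorm_seaGap_le hγ hq x₀))
          (h.eLpNorm_longGap_le hγ hq x)
    _ = 1184 * (C * γ) := by ring
    _ ≤ 1 := hC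

/-- Two points rarely lie in the same island. -/
theorem RareBad.measure_island_eq_le [IsProbabilityMeasure κ] {γ : ℝ≥0∞} (hγ : γ ≤ 2000⁻¹)
    (h : RareBad κ c q C x₀ I) (hq : q ≤ ((γ ^ 8) ^ 65 / 18) ^ 4) (x y : Box n) :
    κ {k | island (I k) x = island (I k) y ∧ (island (I k) x).Nonempty} ≤
      32 * γ * γ ^ l1Dist x y := by
  have hγ1 : γ ≤ 1 := hγ.trans (by norm_num)
  have hγ8 := pow_eight_le_half hγ
  have hsub : κ {k | island (I k) x = island (I k) y ∧ (island (I k) x).Nonempty} ≤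
      κ (⋃ e ∈ Finset.univ, {k | HasFarBadChain k e (supDist e x + l1Dist x y)}) := by
    refine measure_mono_ae ?_
    filter_upwards [h.sea] with k hsea hk
    obtain ⟨hxy, w, hw⟩ := hk
    have hx : x ∉ I k := left_mem_of_mem_clusterOf hw
    have hyx : y ∈ island (I k) x := by
      have hy : y ∉ I k := left_mem_of_mem_clusterOf (show w ∈ island (I k) y from hxy ▸ hw)
      rw [hxy]; exact mem_clusterOf_self hy
    change k ∈ ⋃ e ∈ Finset.univ, {k | HasFarBadChain k e (supDist e x + l1Dist x y)}
    simp only [Finset.mem_univ, Set.iUnion_true, Set.mem_iUnion]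
    have hl := l1Dist_le_four_mul x y
    -- An island containing both points forces a chain from some `e` whose length is comparable to
    -- the distance from `e` to `x` plus that from `x` to `y`, or a chain of order `n`, which
    -- exceeds both up to a constant.
    rcases hsea with hsea | ⟨e, L, hL, he⟩
    · obtain ⟨e, z, L, -, -, hL, hfar⟩ := hsea.exists_hasBadChain hx
      refine ⟨e, L, ?_, hL⟩
      rcases hfar with hfar | hfar
      · have := supDist_le_two_mul e x; omega
      · have h1 := hfar x (mem_clusterOf_self hx)
        have h2 := hfar y hyx
        simp only [supDist, l1Dist] at *
        omega
    · refine ⟨e, L, ?_, he⟩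
      have := supDist_le_two_mul e x; omega
  refine hsub.trans ((measure_biUnion_finset_le _ _).trans ?_)
  calc ∑ e, κ {k | HasFarBadChain k e (supDist e x + l1Dist x y)}
      ≤ ∑ e : Box n, 2 * γ * γ ^ l1Dist x y * 2⁻¹ ^ l1Dist e x := by
        refine Finset.sum_le_sum fun e _ => ?_
        refine (measure_hasFarBadChain_le h.bad hq hγ8 e _).trans ?_
        calc 2 * (γ ^ 8) ^ (supDist e x + l1Dist x y + 1)
            ≤ 2 * γ ^ (supDist e x + l1Dist x y + 1) := by
              gcongr
              exact pow_eight_le hγ1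
          _ = 2 * γ ^ l1Dist x y * γ ^ (supDist e x + 1) := by ring
          _ ≤ 2 * γ ^ l1Dist x y * ((supDist e x + 1 : ℕ) * γ ^ (supDist e x + 1)) := by
              gcongr
              refine le_mul_of_one_le_left' ?_
              exact_mod_cast Nat.succ_le_succ (Nat.zero_le _)
          _ ≤ 2 * γ ^ l1Dist x y * (γ * 2⁻¹ ^ (2 * supDist e x)) := by
              refine mul_le_mul_right ?_ _
              exact nat_mul_pow_le hγ _ le_rfl
          _ ≤ 2 * γ ^ l1Dist x y * (γ * 2⁻¹ ^ l1Dist e x) := by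
              gcongr 2 * γ ^ l1Dist x y * (γ * ?_)
              exact two_inv_pow_supDist_le e x
          _ = 2 * γ * γ ^ l1Dist x y * 2⁻¹ ^ l1Dist e x := by ring
    _ = 2 * γ * γ ^ l1Dist x y * ∑ e : Box n, 2⁻¹ ^ l1Dist e x := by rw [Finset.mul_sum]
    _ ≤ 2 * γ * γ ^ l1Dist x y * 16 := by
        gcongr
        exact sum_half_pow_l1Dist_le x
    _ = 32 * γ * γ ^ l1Dist x y := by ring

/-- Exponential decay of truncated two-point functions. -/
theorem RareBad.lintegral_island_le [IsProbabilityMeasure κ] {γ : ℝ≥0∞} (hγ : γ ≤ 2000⁻¹)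
    (h : RareBad κ c q C x₀ I) (hq : q ≤ ((γ ^ 8) ^ 65 / 18) ^ 4) (hC : 1184 * (C * γ) ≤ 1)
    (x y : Box n) :
    ∫⁻ k in {k | island (I k) x = island (I k) y ∧ (island (I k) x).Nonempty},
      ‖c * (k x : ℝ) * (c * (k y : ℝ))‖ₑ ∂κ ≤ ENNReal.ofReal (Real.exp (-(l1Dist x y : ℝ))) := by
  have hm : ∀ f : (Box n → ℤ) → ℝ, AEStronglyMeasurable f κ := aestronglyMeasurable_labels
  set S : Set (Box n → ℤ) := {k | island (I k) x = island (I k) y ∧ (island (I k) x).Nonempty}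
  have hS : MeasurableSet S := MeasurableSet.of_discrete
  have : ENNReal.HolderTriple 4 4 2 := ⟨by
    rw [← two_mul, show (4 : ℝ≥0∞) = 2 * 2 by norm_num, ENNReal.mul_inv (by simp) (by simp),
      ← mul_assoc, ENNReal.mul_inv_cancel (by simp) (by simp), one_mul]⟩
  have h2 : eLpNorm ((fun k : Box n → ℤ => c * (k x : ℝ)) • fun k : Box n → ℤ => c * (k y : ℝ)) 2 κ
      ≤ 1 := by
    refine (eLpNorm_smul_le_mul_eLpNorm (p := 4) (q := 4) (hm _) (hm _)).trans ?_
    exact mul_le_one' (h.eLpNorm_le_one hγ hq hC x) (h.eLpNorm_le_one hγ hq hC y)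
  -- The probability must decay at rate 2, because Cauchy-Schwarz takes its square root.
  have hS2 : κ S ≤ (ENNReal.ofReal (Real.exp (-(l1Dist x y : ℝ)))) ^ 2 := by
    refine (h.measure_island_eq_le hγ hq x y).trans ?_
    have hg1 : 32 * γ ≤ 1 := by
      calc 32 * γ ≤ 32 * 2000⁻¹ := by gcongr
        _ ≤ 1 := by
          rw [← div_eq_mul_inv]
          exact ENNReal.div_le_of_le_mul (by norm_num)
    have hg2 : γ ≤ ENNReal.ofReal (Real.exp (-2)) := by
      refine hγ.trans ?_
      rw [show (2000⁻¹ : ℝ≥0∞) = ENNReal.ofReal (2000⁻¹) by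
        rw [ENNReal.ofReal_inv_of_pos (by norm_num)]; norm_num]
      refine ENNReal.ofReal_le_ofReal ?_
      rw [Real.exp_neg]
      refine inv_anti₀ (Real.exp_pos _) ?_
      have := Real.exp_one_lt_d9
      calc Real.exp 2 = Real.exp 1 ^ 2 := by rw [← Real.exp_nat_mul]; norm_num
        _ ≤ 3 ^ 2 := by gcongr; linarith
        _ ≤ 2000 := by norm_num
    calc 32 * γ * γ ^ l1Dist x y ≤ 1 * (ENNReal.ofReal (Real.exp (-2))) ^ l1Dist x y := by gcongr
      _ = (ENNReal.ofReal (Real.exp (-(l1Dist x y : ℝ)))) ^ 2 := by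
          rw [one_mul, ← ENNReal.ofReal_pow (Real.exp_nonneg _),
            ← ENNReal.ofReal_pow (Real.exp_nonneg _), ← Real.exp_nat_mul, ← Real.exp_nat_mul]
          congr 2
          push_cast; ring
  calc ∫⁻ k in S, ‖c * (k x : ℝ) * (c * (k y : ℝ))‖ₑ ∂κ
      = eLpNorm (S.indicator
          ((fun k : Box n → ℤ => c * (k x : ℝ)) • fun k : Box n → ℤ => c * (k y : ℝ))) 1 κ := by
        rw [eLpNorm_indicator_eq_eLpNorm_restrict hS, eLpNorm_one_eq_lintegral_enorm]
        rfl
    _ ≤ κ S ^ (1 / (1 : ℝ≥0∞).toReal - 1 / (2 : ℝ≥0∞).toReal) * 1 :=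
        (eLpNorm_indicator_le_rpow_mul (hm _) hS (by norm_num)).trans (mul_le_mul_right h2 _)
    _ ≤ ((ENNReal.ofReal (Real.exp (-(l1Dist x y : ℝ)))) ^ 2) ^ (1 / 2 : ℝ) := by
        rw [mul_one]
        have : (1 / (1 : ℝ≥0∞).toReal - 1 / (2 : ℝ≥0∞).toReal) = 1 / 2 := by norm_num
        rw [this]
        gcongr
    _ = ENNReal.ofReal (Real.exp (-(l1Dist x y : ℝ))) := by
        rw [← ENNReal.rpow_natCast, ← ENNReal.rpow_mul]; norm_num

end RandomLabels

/-! ### Exponential moments of the Gaussian free field -/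

section GFFMoments

open scoped ENNReal

variable {V : Type*} [Fintype V] {G : SimpleGraph V} {B : Set V}

open Classical in
/-- The gradient along directed edges. -/
noncomputable def edgeGradient (G : SimpleGraph V) (φ : V → ℝ) (x y : V) : ℝ :=
  if G.Adj x y then φ y - φ x else 0

theorem dirichletEnergy_eq (φ : V → ℝ) :
    dirichletEnergy G φ = (1 / 2) * ∑ x, ∑ y, edgeGradient G φ x y ^ 2 := by
  simp only [dirichletEnergy, edgeGradient, ite_pow, ne_eq, OfNat.ofNat_ne_zero, not_false_eq_true,
    zero_pow]

theorem measurable_dirichletEnergy : Measurable (dirichletEnergy G) := by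
  classical
  unfold dirichletEnergy
  refine Measurable.const_mul (Finset.measurable_sum _ fun x _ => Finset.measurable_sum _ fun y _ => ?_) _
  split_ifs <;> fun_prop

theorem measurable_edgeGradient {V : Type*} {G : SimpleGraph V} (x y : V) :
    Measurable fun φ : V → ℝ => edgeGradient G φ x y := by
  unfold edgeGradient
  split_ifs <;> fun_prop

open Classical in
instance sigmaFinite_gffReference_apply (B : Set V) (x : V) :
    SigmaFinite (if x ∈ B then Measure.dirac (0 : ℝ) else volume) := by
  split_ifs <;> infer_instance

theorem ae_gffReference_eq_zero (B : Set V) :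
    ∀ᵐ φ ∂gffReference B, ∀ x ∈ B, φ x = 0 := by
  classical
  rw [ae_all_iff]
  intro x
  by_cases hx : x ∈ B
  · have h : ∀ᵐ t ∂(if x ∈ B then Measure.dirac (0 : ℝ) else volume), t = 0 := by
      rw [if_pos hx, ae_dirac_eq]
      exact Filter.eventually_pure.2 rfl
    filter_upwards [Measure.tendsto_eval_ae_ae.eventually h] with φ hφ _
    exact hφ
  · exact Filter.Eventually.of_forall fun _ h => absurd h hx

theorem measurePreserving_add_gffReference {h : V → ℝ} (hB : ∀ x ∈ B, h x = 0) :
    MeasurePreserving (fun φ : V → ℝ => φ + h) (gffReference B) (gffReference B) := by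
  classical
  have : ∀ x, MeasurePreserving (fun t : ℝ => t + h x)
      (if x ∈ B then Measure.dirac (0 : ℝ) else volume)
      (if x ∈ B then Measure.dirac (0 : ℝ) else volume) := by
    intro x
    by_cases hx : x ∈ B
    · simp only [hB x hx, add_zero]
      exact MeasurePreserving.id _
    · rw [if_neg hx]
      exact measurePreserving_add_right volume (h x)
  exact measurePreserving_pi _ _ this

/-- Every linear functional of the gradient is represented by the gradient of a field. -/
theorem exists_edgeGradient_representative (G : SimpleGraph V) (B : Set V) (b : V → V → ℝ) :
    ∃ h : V → ℝ, (∀ x ∈ B, h x = 0) ∧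
      (∀ φ : V → ℝ, (∀ x ∈ B, φ x = 0) →
        ∑ x, ∑ y, b x y * edgeGradient G φ x y = ∑ x, ∑ y, edgeGradient G h x y * edgeGradient G φ x y) ∧
      ∑ x, ∑ y, edgeGradient G h x y ^ 2 ≤ ∑ x, ∑ y, b x y ^ 2 := by
  let W : Submodule ℝ (V → ℝ) :=
    { carrier := {φ | ∀ x ∈ B, φ x = 0}
      add_mem' := fun {a c} ha hc x hx => by simp [ha x hx, hc x hx]
      zero_mem' := fun x _ => rfl
      smul_mem' := fun r a ha x hx => by simp [ha x hx] }
  let g : (V → ℝ) →ₗ[ℝ] EuclideanSpace ℝ (V × V) :=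
    { toFun := fun φ => WithLp.toLp 2 fun p => edgeGradient G φ p.1 p.2
      map_add' := fun φ ψ => by
        ext p; simp only [edgeGradient, Pi.add_apply, PiLp.add_apply]; split_ifs <;> ring
      map_smul' := fun r φ => by
        ext p
        simp only [edgeGradient, Pi.smul_apply, PiLp.smul_apply, smul_eq_mul, RingHom.id_apply]
        split_ifs <;> ring }
  let R := W.map g
  let β : EuclideanSpace ℝ (V × V) := WithLp.toLp 2 fun p => b p.1 p.2
  -- `h` is a field whose gradient is the orthogonal projection of `b` onto gradients of fields
  -- vanishing on `B`; projecting does not increase the norm.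
  obtain ⟨h, hW, hh⟩ := Submodule.mem_map.1 (R.starProjection_apply_mem β)
  have hg : ∀ φ p, g φ p = edgeGradient G φ p.1 p.2 := fun _ _ => rfl
  have hinner : ∀ u v : EuclideanSpace ℝ (V × V), inner ℝ u v = ∑ x, ∑ y, v (x, y) * u (x, y) := by
    intro u v
    rw [PiLp.inner_apply, Fintype.sum_prod_type]
    rfl
  refine ⟨h, hW, fun φ hφ => ?_, ?_⟩
  · have h0 : inner ℝ (g φ) (β - R.starProjection β) = 0 :=
      R.sub_starProjection_mem_orthogonal β (g φ) (Submodule.mem_map_of_mem hφ)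
    rw [inner_sub_right, sub_eq_zero, hinner, hinner, ← hh] at h0
    exact h0
  · have h1 := R.norm_starProjection_apply_le β
    rw [← hh] at h1
    have h2 : ‖g h‖ ^ 2 ≤ ‖β‖ ^ 2 := by gcongr
    rw [EuclideanSpace.norm_sq_eq, EuclideanSpace.norm_sq_eq, Fintype.sum_prod_type,
      Fintype.sum_prod_type] at h2
    simpa only [Real.norm_eq_abs, sq_abs, hg] using h2

/-- Completing the square: once the functional is represented by the gradient of `h`, multiplying
the weight by its exponential amounts to translating the field by `2h`, up to the constant `exp (∑
(∇h)^2)`. The factor 2 appears because the weight is `exp` of minus a quarter of the sum over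
directed edges. -/
theorem lintegral_exp_gffWeight_le (b : V → V → ℝ) :
    ∫⁻ φ, ENNReal.ofReal (Real.exp (∑ x, ∑ y, b x y * edgeGradient G φ x y)) ∂gffWeight G B ≤
      ENNReal.ofReal (Real.exp (∑ x, ∑ y, b x y ^ 2)) * gffWeight G B Set.univ := by
  obtain ⟨h, hB, hrep, hnorm⟩ := exists_edgeGradient_representative G B b
  have hw : Measurable fun φ : V → ℝ => ENNReal.ofReal (Real.exp (-(dirichletEnergy G φ) / 2)) :=
    (((measurable_dirichletEnergy.neg).div_const 2).exp).ennreal_ofReal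
  have hℓ : Measurable fun φ : V → ℝ =>
      ENNReal.ofReal (Real.exp (∑ x, ∑ y, b x y * edgeGradient G φ x y)) :=
    (Real.measurable_exp.comp (Finset.measurable_sum _ fun x _ => Finset.measurable_sum _ fun y _ =>
      (measurable_edgeGradient x y).const_mul _)).ennreal_ofReal
  rw [gffWeight, lintegral_withDensity_eq_lintegral_mul _ hw hℓ, withDensity_apply _ MeasurableSet.univ,
    Measure.restrict_univ]
  have hB' : ∀ x ∈ B, (-((2 : ℝ) • h)) x = 0 := fun x hx => by simp [hB x hx]
  have hshift : ∫⁻ φ, ENNReal.ofReal (Real.exp (-(dirichletEnergy G φ) / 2)) ∂gffReference B =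
      ∫⁻ φ, ENNReal.ofReal (Real.exp (-(dirichletEnergy G (φ + -((2 : ℝ) • h))) / 2)) ∂gffReference B :=
    ((measurePreserving_add_gffReference hB').lintegral_comp hw).symm
  rw [hshift, ← lintegral_const_mul' _ _ ENNReal.ofReal_ne_top]
  refine lintegral_mono_ae ?_
  filter_upwards [ae_gffReference_eq_zero B] with φ hφ
  simp only [Pi.mul_apply]
  rw [← ENNReal.ofReal_mul (Real.exp_nonneg _), ← ENNReal.ofReal_mul (Real.exp_nonneg _),
    ← Real.exp_add, ← Real.exp_add]
  refine ENNReal.ofReal_le_ofReal (Real.exp_le_exp.2 ?_)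
  have hexp : dirichletEnergy G (φ + -((2 : ℝ) • h)) = dirichletEnergy G φ
      - 2 * ∑ x, ∑ y, edgeGradient G h x y * edgeGradient G φ x y
      + 2 * ∑ x, ∑ y, edgeGradient G h x y ^ 2 := by
    have : ∀ x y, edgeGradient G (φ + -((2 : ℝ) • h)) x y ^ 2 = edgeGradient G φ x y ^ 2
        - 4 * (edgeGradient G h x y * edgeGradient G φ x y) + 4 * edgeGradient G h x y ^ 2 := by
      intro x y
      simp only [edgeGradient, Pi.add_apply, Pi.neg_apply, Pi.smul_apply, smul_eq_mul]
      split_ifs <;> ring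
    simp only [dirichletEnergy_eq, this, Finset.sum_add_distrib, Finset.sum_sub_distrib,
      ← Finset.mul_sum]
    ring
  rw [hrep φ hφ, hexp]
  linarith

variable {Ω : Type*} [MeasurableSpace Ω] {μ : Measure Ω} {φ : Ω → V → ℝ}

/-- Only `a⁻¹ * a ≤ 1` is used for the total mass, so its finiteness and positivity need not be
known. -/
theorem IsGFF.lintegral_exp_le (h : IsGFF G B μ φ) (b : V → V → ℝ) :
    ∫⁻ ω, ENNReal.ofReal (Real.exp (∑ x, ∑ y, b x y * edgeGradient G (φ ω) x y)) ∂μ ≤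
      ENNReal.ofReal (Real.exp (∑ x, ∑ y, b x y ^ 2)) := by
  have hℓ : Measurable fun φ : V → ℝ =>
      ENNReal.ofReal (Real.exp (∑ x, ∑ y, b x y * edgeGradient G φ x y)) :=
    (Real.measurable_exp.comp (Finset.measurable_sum _ fun x _ => Finset.measurable_sum _ fun y _ =>
      (measurable_edgeGradient x y).const_mul _)).ennreal_ofReal
  rw [← lintegral_map hℓ h.measurable, h.law, gffLaw, lintegral_smul_measure, smul_eq_mul]
  calc (gffWeight G B Set.univ)⁻¹ *
        ∫⁻ φ, ENNReal.ofReal (Real.exp (∑ x, ∑ y, b x y * edgeGradient G φ x y)) ∂gffWeight G B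
      ≤ (gffWeight G B Set.univ)⁻¹ *
        (ENNReal.ofReal (Real.exp (∑ x, ∑ y, b x y ^ 2)) * gffWeight G B Set.univ) := by
        gcongr
        exact lintegral_exp_gffWeight_le b
    _ = ENNReal.ofReal (Real.exp (∑ x, ∑ y, b x y ^ 2)) *
        ((gffWeight G B Set.univ)⁻¹ * gffWeight G B Set.univ) := by ring
    _ ≤ ENNReal.ofReal (Real.exp (∑ x, ∑ y, b x y ^ 2)) * 1 := by
        gcongr
        exact ENNReal.inv_mul_le_one _
    _ = _ := mul_one _

open Classical in
theorem IsGFF.lintegral_exp_sum_le (h : IsGFF G B μ φ) (F : Finset V) (u : V → V) (ε : V → ℝ)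
    (hu : ∀ v ∈ F, G.Adj v (u v)) :
    ∫⁻ ω, ENNReal.ofReal (Real.exp (∑ v ∈ F, ε v * (φ ω (u v) - φ ω v))) ∂μ ≤
      ENNReal.ofReal (Real.exp (∑ v ∈ F, ε v ^ 2)) := by
  have := h.lintegral_exp_le fun x y => if x ∈ F ∧ y = u x then ε x else 0
  have h1 : ∀ ψ : V → ℝ, ∑ x, ∑ y, (if x ∈ F ∧ y = u x then ε x else 0) * edgeGradient G ψ x y =
      ∑ v ∈ F, ε v * (ψ (u v) - ψ v) := by
    intro ψ
    rw [← Finset.sum_subset (Finset.subset_univ F)]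
    · refine Finset.sum_congr rfl fun v hv => ?_
      rw [Finset.sum_eq_single (u v)]
      · simp [hv, edgeGradient, hu v hv]
      · intro y _ hy; simp [hy]
      · simp
    · intro x _ hx; simp [hx]
  have h2 : ∑ x, ∑ y, (if x ∈ F ∧ y = u x then ε x else 0) ^ 2 = ∑ v ∈ F, ε v ^ 2 := by
    rw [← Finset.sum_subset (Finset.subset_univ F)]
    · refine Finset.sum_congr rfl fun v hv => ?_
      rw [Finset.sum_eq_single (u v)]
      · simp [hv]
      · intro y _ hy; simp [hy]
      · simp
    · intro x _ hx; simp [hx]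
  simp only [h1, h2] at this
  exact this

/-- Steep edges with prescribed directions. -/
theorem IsGFF.measure_steep_directed_le (h : IsGFF G B μ φ) (F : Finset V) (u : V → V)
    (ε : V → ℝ) (hu : ∀ v ∈ F, G.Adj v (u v)) (hε : ∀ v ∈ F, ε v ^ 2 = 1) {t : ℝ} (ht : 0 ≤ t) :
    μ {ω | ∀ v ∈ F, t ≤ ε v * (φ ω (u v) - φ ω v)} ≤
      ENNReal.ofReal (Real.exp (-(t ^ 2) / 4)) ^ F.card := by
  -- The parameter `t / 2` maximises `s * t - s ^ 2`, the exponent in the Chernoff bound.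
  have h1 := h.lintegral_exp_sum_le F u (fun v => t / 2 * ε v) hu
  have h2 : ∑ v ∈ F, (t / 2 * ε v) ^ 2 = F.card * (t ^ 2 / 4) := by
    rw [← nsmul_eq_mul, ← Finset.sum_const]
    refine Finset.sum_congr rfl fun v hv => ?_
    rw [mul_pow, hε v hv]; ring
  rw [h2] at h1
  have hsub : ∀ ω ∈ {ω | ∀ v ∈ F, t ≤ ε v * (φ ω (u v) - φ ω v)},
      ENNReal.ofReal (Real.exp (F.card * (t ^ 2 / 2))) ≤
        ENNReal.ofReal (Real.exp (∑ v ∈ F, t / 2 * ε v * (φ ω (u v) - φ ω v))) := by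
    intro ω hω
    refine ENNReal.ofReal_le_ofReal (Real.exp_le_exp.2 ?_)
    rw [← nsmul_eq_mul]
    refine Finset.card_nsmul_le_sum _ _ _ fun v hv => ?_
    have := hω v hv
    nlinarith
  have hmarkov : ENNReal.ofReal (Real.exp (F.card * (t ^ 2 / 2))) *
      μ {ω | ∀ v ∈ F, t ≤ ε v * (φ ω (u v) - φ ω v)} ≤
        ENNReal.ofReal (Real.exp (F.card * (t ^ 2 / 4))) := by
    refine le_trans ?_ h1
    refine le_trans ?_ (mul_meas_ge_le_lintegral₀ ?_
      (ENNReal.ofReal (Real.exp (F.card * (t ^ 2 / 2)))))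
    · exact mul_le_mul_right (measure_mono hsub) _
    · have hφ := h.measurable
      exact (Measurable.ennreal_ofReal (Real.measurable_exp.comp
        (Finset.measurable_sum _ fun v _ => by fun_prop))).aemeasurable
  have hpos : (0 : ℝ) < Real.exp (F.card * (t ^ 2 / 2)) := Real.exp_pos _
  rw [mul_comm, ← ENNReal.le_div_iff_mul_le (Or.inl (by simpa using hpos)) (Or.inl (by simp)),
    ← ENNReal.ofReal_div_of_pos hpos, ← Real.exp_sub] at hmarkov
  refine hmarkov.trans (le_of_eq ?_)
  rw [← ENNReal.ofReal_pow (Real.exp_nonneg _), ← Real.exp_nat_mul]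
  congr 2
  ring

/-- Many vertices with a steep edge are exponentially unlikely. -/
theorem IsGFF.measure_steep_le (h : IsGFF G B μ φ) {Δ : ℕ}
    (hΔ : ∀ v, {u | G.Adj v u}.ncard ≤ Δ) (F : Finset V) {t : ℝ} (ht : 0 ≤ t) :
    μ {ω | ∀ v ∈ F, ∃ u, G.Adj v u ∧ t ≤ |φ ω u - φ ω v|} ≤
      (2 * Δ * ENNReal.ofReal (Real.exp (-(t ^ 2) / 4))) ^ F.card := by
  classical
  -- One chooses a neighbour and a sign for each vertex of `F`; a single dummy choice elsewhere
  -- keeps the count at `(2 * Δ) ^ F.card`.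
  let s : V → Finset (V × ℝ) := fun v =>
    if v ∈ F then (Finset.univ.filter fun u => G.Adj v u) ×ˢ {1, -1} else {(v, 1)}
  have hcard : (Fintype.piFinset s).card ≤ (2 * Δ) ^ F.card := by
    rw [Fintype.card_piFinset, ← Finset.prod_subset (Finset.subset_univ F)]
    · refine (Finset.prod_le_prod' (g := fun _ => 2 * Δ) fun v hv => ?_).trans (by simp)
      simp only [s, if_pos hv]
      rw [Finset.card_product, mul_comm]
      refine Nat.mul_le_mul (Finset.card_le_two) ?_
      have := hΔ v
      rw [Set.ncard_eq_toFinset_card'] at this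
      simpa using this
    · intro v _ hv; simp [s, hv]
  have hsub : {ω | ∀ v ∈ F, ∃ u, G.Adj v u ∧ t ≤ |φ ω u - φ ω v|} ⊆
      ⋃ f ∈ Fintype.piFinset s, {ω | ∀ v ∈ F, t ≤ (f v).2 * (φ ω (f v).1 - φ ω v)} := by
    intro ω hω
    have : ∀ v, ∃ p : V × ℝ, p ∈ s v ∧ (v ∈ F → t ≤ p.2 * (φ ω p.1 - φ ω v)) := by
      intro v
      by_cases hv : v ∈ F
      · obtain ⟨u, hu, hut⟩ := hω v hv
        rcases le_abs.1 hut with h' | h'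
        · exact ⟨(u, 1), by simp [s, hv, hu], fun _ => by linarith⟩
        · exact ⟨(u, -1), by simp [s, hv, hu], fun _ => by linarith⟩
      · exact ⟨(v, 1), by simp [s, hv], fun h' => absurd h' hv⟩
    choose f hf hf' using this
    simp only [Set.mem_iUnion, Fintype.mem_piFinset, exists_prop]
    exact ⟨f, hf, fun v hv => hf' v hv⟩
  refine (measure_mono hsub).trans ((measure_biUnion_finset_le _ _).trans ?_)
  refine (Finset.sum_le_card_nsmul _ _ (ENNReal.ofReal (Real.exp (-(t ^ 2) / 4)) ^ F.card)
    fun f hf => ?_).trans ?_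
  · rw [Fintype.mem_piFinset] at hf
    refine h.measure_steep_directed_le F (fun v => (f v).1) (fun v => (f v).2) ?_ ?_ ht
    · intro v hv
      have := hf v
      simp only [s, if_pos hv, Finset.mem_product, Finset.mem_filter] at this
      exact this.1.2
    · intro v hv
      have := hf v
      simp only [s, if_pos hv, Finset.mem_product, Finset.mem_insert, Finset.mem_singleton] at this
      rcases this.2 with h' | h' <;> rw [h'] <;> norm_num
  · rw [nsmul_eq_mul, mul_pow]
    refine mul_le_mul_left ?_ _
    exact_mod_cast hcard

theorem pow_eight_le_exp (t : ℝ) : |t| ^ 8 ≤ 40320 * (Real.exp t + Real.exp (-t)) := by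
  have h1 := Real.pow_div_factorial_le_exp |t| (abs_nonneg t) 8
  have h2 : Real.exp |t| ≤ Real.exp t + Real.exp (-t) := by
    rcases abs_cases t with h | h <;> rw [h.1]
    · linarith [Real.exp_pos (-t)]
    · linarith [Real.exp_pos t]
  have h3 : ((Nat.factorial 8 : ℕ) : ℝ) = 40320 := by norm_num [Nat.factorial]
  rw [h3, div_le_iff₀ (by norm_num)] at h1
  linarith

/-- `|t| ^ 8` is at most `8!` times `exp t + exp (-t)`, and each exponential moment is at most `e ≤
3`; finally `40320 * 6 ≤ 5 ^ 8`. -/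
theorem IsGFF.eLpNorm_edge_le (h : IsGFF G B μ φ) {x z : V} (hxz : G.Adj x z) :
    eLpNorm (fun ω => φ ω x - φ ω z) 8 μ ≤ 5 := by
  classical
  have hφ := h.measurable
  have key : ∀ e : ℝ, e ^ 2 = 1 →
      ∫⁻ ω, ENNReal.ofReal (Real.exp (e * (φ ω z - φ ω x))) ∂μ ≤ ENNReal.ofReal 3 := by
    intro e he
    have := h.lintegral_exp_sum_le {x} (fun _ => z) (fun _ => e) (by simpa using hxz)
    simp only [Finset.sum_singleton, he] at this
    exact this.trans (ENNReal.ofReal_le_ofReal (by linarith [Real.exp_one_lt_d9]))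
  rw [eLpNorm_eq_lintegral_rpow_enorm_toReal (by norm_num) (by norm_num)]
  have h8 : (8 : ℝ≥0∞).toReal = ((8 : ℕ) : ℝ) := by norm_num
  have hle : ∫⁻ ω, ‖φ ω x - φ ω z‖ₑ ^ (8 : ℝ≥0∞).toReal ∂μ ≤ 5 ^ 8 := by
    calc ∫⁻ ω, ‖φ ω x - φ ω z‖ₑ ^ (8 : ℝ≥0∞).toReal ∂μ
        ≤ ∫⁻ ω, ENNReal.ofReal 40320 * (ENNReal.ofReal (Real.exp (1 * (φ ω z - φ ω x))) +
            ENNReal.ofReal (Real.exp (-1 * (φ ω z - φ ω x)))) ∂μ := by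
          refine lintegral_mono fun ω => ?_
          rw [h8, ENNReal.rpow_natCast, Real.enorm_eq_ofReal_abs, ← ENNReal.ofReal_pow (abs_nonneg _),
            ← ENNReal.ofReal_add (Real.exp_nonneg _) (Real.exp_nonneg _),
            ← ENNReal.ofReal_mul (by norm_num)]
          refine ENNReal.ofReal_le_ofReal ?_
          rw [abs_sub_comm, one_mul, neg_one_mul]
          exact pow_eight_le_exp _
      _ ≤ ENNReal.ofReal 40320 * (ENNReal.ofReal 3 + ENNReal.ofReal 3) := by
          rw [lintegral_const_mul' _ _ (by simp), lintegral_add_left (by fun_prop)]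
          gcongr
          · exact key 1 (by norm_num)
          · exact key (-1) (by norm_num)
      _ ≤ 5 ^ 8 := by
          rw [← ENNReal.ofReal_add (by norm_num) (by norm_num), ← ENNReal.ofReal_mul (by norm_num),
            show (5 : ℝ≥0∞) ^ 8 = ENNReal.ofReal (5 ^ 8) by
              rw [ENNReal.ofReal_pow (by norm_num)]; norm_num]
          exact ENNReal.ofReal_le_ofReal (by norm_num)
  calc _ ≤ ((5 : ℝ≥0∞) ^ 8) ^ (1 / (8 : ℝ≥0∞).toReal) := by gcongr
    _ = 5 := by
      rw [h8, ← ENNReal.rpow_natCast, ← ENNReal.rpow_mul]; norm_num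

theorem IsGFF.eLpNorm_sub_le (h : IsGFF G B μ φ) {x z : V} (w : G.Walk x z) :
    eLpNorm (fun ω => φ ω x - φ ω z) 8 μ ≤ 5 * w.length := by
  have hφ := h.measurable
  have hm : ∀ x z, AEStronglyMeasurable (fun ω => φ ω x - φ ω z) μ := fun x z => by
    have : Measurable fun ω => φ ω x - φ ω z := by fun_prop
    exact this.aestronglyMeasurable
  induction w with
  | nil => simp
  | @cons a b c hab w ih =>
    have : (fun ω => φ ω a - φ ω c) = (fun ω => φ ω a - φ ω b) + fun ω => φ ω b - φ ω c := by
      funext ω; simp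
    rw [this, SimpleGraph.Walk.length_cons]
    refine (eLpNorm_add_le (hm _ _) (hm _ _) (by norm_num)).trans ?_
    refine (add_le_add (h.eLpNorm_edge_le hab) ih).trans (le_of_eq ?_)
    push_cast; ring

theorem IsGFF.ae_eq_zero (h : IsGFF G B μ φ) : ∀ᵐ ω ∂μ, ∀ x ∈ B, φ ω x = 0 := by
  have h1 : ∀ᵐ ψ ∂gffLaw G B, ∀ x ∈ B, ψ x = 0 := by
    refine Measure.ae_smul_measure ?_ _
    exact (withDensity_absolutelyContinuous _ _).ae_le (ae_gffReference_eq_zero B)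
  rw [← h.law] at h1
  exact ae_of_ae_map h.measurable.aemeasurable h1

end GFFMoments

/-! ### Differences of two fields -/

section Differences

open scoped ENNReal

variable {V : Type*} [Fintype V] {G : SimpleGraph V} {B : Set V}
  {Ω : Type*} [MeasurableSpace Ω] {μ : Measure Ω} {φ₁ φ₂ : Ω → V → ℝ}

/-- A jump of `2t` in the difference needs a jump of `t` in one of the fields, and one of them is
responsible for at least half of `F`. A union bound over the subset and the field avoids any
independence; keeping only half the vertices is why the hypothesis involves `r ^ 2`. -/
theorem measure_steep_difference_le [IsProbabilityMeasure μ] (h₁ : IsGFF G B μ φ₁)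
    (h₂ : IsGFF G B μ φ₂) {Δ : ℕ}
    (hΔ : ∀ v, {u | G.Adj v u}.ncard ≤ Δ) (F : Finset V) {t : ℝ} (ht : 0 ≤ t) {r : ℝ≥0∞}
    (hr : 2 * Δ * ENNReal.ofReal (Real.exp (-(t ^ 2) / 4)) ≤ r ^ 2) (hr1 : r ≤ 1) :
    μ {ω | ∀ v ∈ F, ∃ u, G.Adj v u ∧ 2 * t ≤ |(φ₁ ω u - φ₂ ω u) - (φ₁ ω v - φ₂ ω v)|} ≤
      (4 * r) ^ F.card := by
  classical
  -- Nonemptiness is used to absorb the choice of the field into `2 ^ F.card`.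
  rcases F.eq_empty_or_nonempty with rfl | hne
  · simp
  let P : (Ω → V → ℝ) → Finset V → Set Ω := fun φ F' =>
    {ω | ∀ v ∈ F', ∃ u, G.Adj v u ∧ t ≤ |φ ω u - φ ω v|}
  have hsub : {ω | ∀ v ∈ F, ∃ u, G.Adj v u ∧ 2 * t ≤ |(φ₁ ω u - φ₂ ω u) - (φ₁ ω v - φ₂ ω v)|} ⊆
      ⋃ F' ∈ F.powerset.filter (fun F' => F.card ≤ 2 * F'.card), (P φ₁ F' ∪ P φ₂ F') := by
    intro ω hω
    have hor : ∀ v ∈ F, (∃ u, G.Adj v u ∧ t ≤ |φ₁ ω u - φ₁ ω v|) ∨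
        (∃ u, G.Adj v u ∧ t ≤ |φ₂ ω u - φ₂ ω v|) := by
      intro v hv
      obtain ⟨u, hu, hut⟩ := hω v hv
      by_contra! hcon
      have h1 := hcon.1 u hu
      have h2 := hcon.2 u hu
      have h3 := abs_sub (φ₁ ω u - φ₁ ω v) (φ₂ ω u - φ₂ ω v)
      rw [show φ₁ ω u - φ₁ ω v - (φ₂ ω u - φ₂ ω v) = φ₁ ω u - φ₂ ω u - (φ₁ ω v - φ₂ ω v) by ring]
        at h3
      linarith
    let F₁ := F.filter fun v => ∃ u, G.Adj v u ∧ t ≤ |φ₁ ω u - φ₁ ω v|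
    let F₂ := F.filter fun v => ¬ ∃ u, G.Adj v u ∧ t ≤ |φ₁ ω u - φ₁ ω v|
    have hcard : F₁.card + F₂.card = F.card := Finset.card_filter_add_card_filter_not _
    simp only [Set.mem_iUnion, Finset.mem_filter, Finset.mem_powerset, exists_prop]
    by_cases hc : F.card ≤ 2 * F₁.card
    · exact ⟨F₁, ⟨Finset.filter_subset _ _, hc⟩, Or.inl fun v hv => (Finset.mem_filter.1 hv).2⟩
    · refine ⟨F₂, ⟨Finset.filter_subset _ _, by omega⟩, Or.inr fun v hv => ?_⟩
      obtain ⟨hvF, hv1⟩ := Finset.mem_filter.1 hv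
      exact (hor v hvF).resolve_left hv1
  have hterm : ∀ F' : Finset V, F.card ≤ 2 * F'.card → μ (P φ₁ F' ∪ P φ₂ F') ≤ 2 * r ^ F.card := by
    intro F' hF'
    have hb : ∀ φ, IsGFF G B μ φ → μ (P φ F') ≤ r ^ F.card := fun φ h =>
      (h.measure_steep_le hΔ F' ht).trans ((pow_le_pow_left' hr _).trans (by
        rw [← pow_mul]; exact pow_le_pow_right_of_le_one' hr1 hF'))
    rw [two_mul]
    exact (measure_union_le _ _).trans (add_le_add (hb _ h₁) (hb _ h₂))
  refine (measure_mono hsub).trans ((measure_biUnion_finset_le _ _).trans ?_)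
  refine (Finset.sum_le_card_nsmul _ _ (2 * r ^ F.card) fun F' hF' =>
    hterm F' (Finset.mem_filter.1 hF').2).trans ?_
  rw [nsmul_eq_mul]
  have hc : ((F.powerset.filter fun F' => F.card ≤ 2 * F'.card).card : ℝ≥0∞) ≤ 2 ^ F.card := by
    have := Finset.card_filter_le F.powerset fun F' => F.card ≤ 2 * F'.card
    rw [Finset.card_powerset] at this
    exact_mod_cast this
  calc _ ≤ (2 : ℝ≥0∞) ^ F.card * (2 ^ F.card * r ^ F.card) := by
        gcongr
        exact le_self_pow₀ (by norm_num) hne.card_ne_zero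
    _ = (4 * r) ^ F.card := by rw [← mul_pow, ← mul_pow, ← mul_assoc]; norm_num

theorem eLpNorm_difference_le (h₁ : IsGFF G B μ φ₁) (h₂ : IsGFF G B μ φ₂) {x z : V}
    (w : G.Walk x z) :
    eLpNorm (fun ω => (φ₁ ω x - φ₂ ω x) - (φ₁ ω z - φ₂ ω z)) 8 μ ≤ 10 * w.length := by
  have hφ₁ := h₁.measurable
  have hφ₂ := h₂.measurable
  have hm₁ : Measurable fun ω => φ₁ ω x - φ₁ ω z := by fun_prop
  have hm₂ : Measurable fun ω => φ₂ ω x - φ₂ ω z := by fun_prop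
  have : (fun ω => (φ₁ ω x - φ₂ ω x) - (φ₁ ω z - φ₂ ω z)) =
      (fun ω => φ₁ ω x - φ₁ ω z) - fun ω => φ₂ ω x - φ₂ ω z := by
    funext ω; simp only [Pi.sub_apply]; ring
  rw [this]
  refine (eLpNorm_sub_le hm₁.aestronglyMeasurable hm₂.aestronglyMeasurable (by norm_num)).trans ?_
  refine (add_le_add (h₁.eLpNorm_sub_le w) (h₂.eLpNorm_sub_le w)).trans (le_of_eq ?_)
  ring

end Differences

/-! ### Phases and integer labels -/

section Phases

open scoped ENNReal

variable {V : Type*} {T : ℝ}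

/-- The representative in `(-π / T, π / T]` of a phase. -/
noncomputable def phaseOffset (T : ℝ) (p : V → ℂ) (x : V) : ℝ := Complex.arg (p x) / T

/-- The multiple of `2 π / T` by which a field exceeds the representative of its phase. -/
noncomputable def phaseLabel (T : ℝ) (φ : V → ℝ) (x : V) : ℤ :=
  ⌊(φ x - phaseOffset T (phase T φ) x) / (2 * Real.pi / T)⌋

theorem exists_eq_phaseOffset_add (hT : 0 < T) (φ : V → ℝ) (x : V) :
    ∃ m : ℤ, φ x = phaseOffset T (phase T φ) x + 2 * Real.pi / T * m := by
  refine ⟨toIocDiv Real.two_pi_pos (-Real.pi) (T * φ x), ?_⟩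
  have h1 : Complex.arg (phase T φ x) = toIocMod Real.two_pi_pos (-Real.pi) (T * φ x) := by
    rw [← Complex.arg_exp_mul_I, phase]
    congr 2
    push_cast; ring
  have h2 := toIocMod_add_toIocDiv_zsmul Real.two_pi_pos (-Real.pi) (T * φ x)
  rw [phaseOffset, h1]
  rw [zsmul_eq_mul] at h2
  have h3 : φ x = T * φ x / T := by field_simp
  rw [← h2] at h3
  exact h3.trans (by ring)

theorem phaseLabel_eq_of_eq (hT : 0 < T) {φ : V → ℝ} {x : V} {m : ℤ}
    (h : φ x = phaseOffset T (phase T φ) x + 2 * Real.pi / T * m) : phaseLabel T φ x = m := by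
  have hc : 0 < 2 * Real.pi / T := div_pos Real.two_pi_pos hT
  rw [phaseLabel, h, add_sub_cancel_left, mul_div_cancel_left₀ _ hc.ne', Int.floor_intCast]

theorem eq_phaseOffset_add (hT : 0 < T) (φ : V → ℝ) (x : V) :
    φ x = phaseOffset T (phase T φ) x + 2 * Real.pi / T * phaseLabel T φ x := by
  obtain ⟨m, hm⟩ := exists_eq_phaseOffset_add hT φ x
  rw [phaseLabel_eq_of_eq hT hm]
  exact hm

/-- The field with the given phases and labels. -/
noncomputable def fieldOf (T : ℝ) (p : V → ℂ) (m : V → ℤ) : V → ℝ :=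
  fun x => phaseOffset T p x + 2 * Real.pi / T * m x

theorem fieldOf_phase_phaseLabel (hT : 0 < T) (φ : V → ℝ) :
    fieldOf T (phase T φ) (phaseLabel T φ) = φ :=
  funext fun x => (eq_phaseOffset_add hT φ x).symm

/-- The translation of a field by a multiple of `2 π / T`. -/
noncomputable def labelShift (T : ℝ) (m : V → ℤ) : V → ℝ := fun x => 2 * Real.pi / T * m x

theorem phase_add_labelShift (hT : 0 < T) (φ : V → ℝ) (m : V → ℤ) :
    phase T (φ + labelShift T m) = phase T φ := by
  funext x
  simp only [phase, Pi.add_apply, labelShift]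
  rw [Complex.exp_eq_exp_iff_exists_int]
  refine ⟨m x, ?_⟩
  have : (T : ℂ) ≠ 0 := by exact_mod_cast hT.ne'
  push_cast
  field_simp

theorem phaseLabel_add_labelShift (hT : 0 < T) (φ : V → ℝ) (m : V → ℤ) :
    phaseLabel T (φ + labelShift T m) = phaseLabel T φ + m := by
  funext x
  apply phaseLabel_eq_of_eq hT
  rw [phase_add_labelShift hT, Pi.add_apply, eq_phaseOffset_add hT φ x, labelShift]
  push_cast [Pi.add_apply]
  ring_nf

theorem fieldOf_add (p : V → ℂ) (m m' : V → ℤ) :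
    fieldOf T p m + labelShift T m' = fieldOf T p (m + m') := by
  funext x
  simp only [fieldOf, labelShift, Pi.add_apply]
  push_cast; ring

theorem phaseLabel_eq_zero {φ : V → ℝ} {x : V} (h : φ x = 0) : phaseLabel T φ x = 0 := by
  simp [phaseLabel, phaseOffset, phase, h]

theorem measurable_phase : Measurable (phase T : (V → ℝ) → V → ℂ) := by
  refine measurable_pi_lambda _ fun x => ?_
  unfold phase
  fun_prop

theorem measurable_phaseOffset : Measurable (phaseOffset T : (V → ℂ) → V → ℝ) := by
  refine measurable_pi_lambda _ fun x => ?_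
  unfold phaseOffset
  exact (Complex.measurable_arg.comp (measurable_pi_apply x)).div_const T

theorem measurable_fieldOf (m : V → ℤ) : Measurable fun p : V → ℂ => fieldOf T p m := by
  refine measurable_pi_lambda _ fun x => ?_
  unfold fieldOf
  exact ((measurable_pi_apply x).comp measurable_phaseOffset).add_const _

theorem measurable_phaseLabel : Measurable (phaseLabel T : (V → ℝ) → V → ℤ) := by
  refine measurable_pi_lambda _ fun x => Measurable.floor ?_
  exact ((measurable_pi_apply x).sub ((measurable_pi_apply x).comp
    (measurable_phaseOffset.comp measurable_phase))).div_const _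

theorem sub_eq_mul_phaseLabel_sub (hT : 0 < T) {φ₁ φ₂ : V → ℝ} (h : phase T φ₁ = phase T φ₂)
    (x : V) : φ₁ x - φ₂ x = 2 * Real.pi / T * (phaseLabel T φ₁ - phaseLabel T φ₂) x := by
  rw [eq_phaseOffset_add hT φ₁ x, eq_phaseOffset_add hT φ₂ x, h]
  push_cast [Pi.sub_apply]
  ring

end Phases

/-! ### The conditional law of the labels given the phases -/

section ConditionalLaw

open scoped ENNReal

variable {V : Type*} [Fintype V] {G : SimpleGraph V} {B : Set V} {T : ℝ}

/-- The Boltzmann weight of a field. -/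
noncomputable def boltzmann (G : SimpleGraph V) (φ : V → ℝ) : ℝ :=
  Real.exp (-(dirichletEnergy G φ) / 2)

theorem measurable_boltzmann : Measurable (boltzmann G) :=
  ((measurable_dirichletEnergy.neg).div_const 2).exp

theorem dirichletEnergy_nonneg (φ : V → ℝ) : 0 ≤ dirichletEnergy G φ := by
  rw [dirichletEnergy_eq]
  exact mul_nonneg (by norm_num)
    (Finset.sum_nonneg fun x _ => Finset.sum_nonneg fun y _ => sq_nonneg _)

theorem boltzmann_pos (φ : V → ℝ) : 0 < boltzmann G φ := Real.exp_pos _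

theorem boltzmann_le_one (φ : V → ℝ) : boltzmann G φ ≤ 1 :=
  Real.exp_le_one_iff.2 (by have := dirichletEnergy_nonneg (G := G) φ; linarith)

/-- Both sides integrate the product of the two Boltzmann weights against the reference measure.
Translating by `2π/T * (b - a)` keeps the phases, turns label `a` into `b`, and preserves the
reference measure since the shift vanishes on `B`. -/
theorem setLIntegral_gffWeight_exchange (hT : 0 < T) {a b : V → ℤ} (ha : ∀ x ∈ B, a x = 0)
    (hb : ∀ x ∈ B, b x = 0) {S : Set (V → ℂ)} (hS : MeasurableSet S) :
    ∫⁻ ψ in {ψ | phase T ψ ∈ S ∧ phaseLabel T ψ = a},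
        ENNReal.ofReal (boltzmann G (fieldOf T (phase T ψ) b)) ∂gffWeight G B =
      ∫⁻ ψ in {ψ | phase T ψ ∈ S ∧ phaseLabel T ψ = b},
        ENNReal.ofReal (boltzmann G (fieldOf T (phase T ψ) a)) ∂gffWeight G B := by
  have hset : ∀ a : V → ℤ, MeasurableSet {ψ : V → ℝ | phase T ψ ∈ S ∧ phaseLabel T ψ = a} :=
    fun a => (measurable_phase hS).inter (measurable_phaseLabel (measurableSet_singleton a))
  have hw : Measurable fun ψ : V → ℝ => ENNReal.ofReal (boltzmann G ψ) :=
    measurable_boltzmann.ennreal_ofReal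
  have hf : ∀ a : V → ℤ, Measurable fun ψ : V → ℝ =>
      ENNReal.ofReal (boltzmann G (fieldOf T (phase T ψ) a)) := fun a =>
    hw.comp ((measurable_fieldOf a).comp measurable_phase)
  have hrw : ∀ a b : V → ℤ, ∫⁻ ψ in {ψ | phase T ψ ∈ S ∧ phaseLabel T ψ = a},
        ENNReal.ofReal (boltzmann G (fieldOf T (phase T ψ) b)) ∂gffWeight G B =
      ∫⁻ ψ, {ψ | phase T ψ ∈ S ∧ phaseLabel T ψ = a}.indicator (fun ψ =>
        ENNReal.ofReal (boltzmann G ψ) *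
          ENNReal.ofReal (boltzmann G (fieldOf T (phase T ψ) b))) ψ ∂gffReference B := by
    intro a b
    have hgw : gffWeight G B =
        (gffReference B).withDensity fun ψ => ENNReal.ofReal (boltzmann G ψ) := rfl
    rw [hgw, restrict_withDensity (hset a), lintegral_withDensity_eq_lintegral_mul _ hw (hf b),
      lintegral_indicator (hset a)]
    rfl
  rw [hrw, hrw]
  have hB : ∀ x ∈ B, labelShift T (b - a) x = 0 := fun x hx => by
    simp [labelShift, ha x hx, hb x hx]
  refine Eq.trans (lintegral_congr fun ψ => ?_) ((measurePreserving_add_gffReference hB).lintegral_comp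
    ((hw.mul (hf a)).indicator (hset b)))
  have hmem : ψ + labelShift T (b - a) ∈ {ψ | phase T ψ ∈ S ∧ phaseLabel T ψ = b} ↔
      ψ ∈ {ψ | phase T ψ ∈ S ∧ phaseLabel T ψ = a} := by
    simp only [Set.mem_ofPred_eq, phase_add_labelShift hT, phaseLabel_add_labelShift hT]
    refine and_congr_right fun _ => ?_
    constructor
    · intro h; rw [← sub_eq_zero, ← sub_eq_zero.2 h]; abel
    · intro h; rw [h]; abel
  by_cases h : ψ ∈ {ψ | phase T ψ ∈ S ∧ phaseLabel T ψ = a}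
  · rw [Set.indicator_of_mem h, Set.indicator_of_mem (hmem.2 h)]
    simp only [phase_add_labelShift hT]
    have e1 : fieldOf T (phase T ψ) a = ψ := by
      rw [← h.2]; exact fieldOf_phase_phaseLabel hT ψ
    have e2 : ψ + labelShift T (b - a) = fieldOf T (phase T ψ) b := by
      conv_lhs => rw [← e1]
      rw [fieldOf_add]; congr 1; abel
    rw [e1, e2, mul_comm]
  · rw [Set.indicator_of_notMem h, Set.indicator_of_notMem (fun h' => h (hmem.1 h'))]

variable {Ω : Type*} [MeasurableSpace Ω] {μ : Measure Ω} [IsProbabilityMeasure μ]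
  {φ ψ φ₁ φ₂ : Ω → V → ℝ}

theorem phaseSigma_le {V : Type*} {T : ℝ} {φ : Ω → V → ℝ} (hφ : Measurable φ) :
    phaseSigma T φ ≤ ‹MeasurableSpace Ω› :=
  (measurable_phase.comp hφ).comap_le

/-- The conditional probability of a labelling is proportional to its Boltzmann weight. Stating this
as a cross-multiplied identity between two labellings avoids the normalising sum over all
labellings. -/
theorem IsGFF.condExp_label_mul (hT : 0 < T) (hψ : IsGFF G B μ ψ) (hφ : Measurable φ)
    (hphase : ∀ᵐ ω ∂μ, phase T (ψ ω) = phase T (φ ω)) {a b : V → ℤ} (ha : ∀ x ∈ B, a x = 0)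
    (hb : ∀ x ∈ B, b x = 0) :
    (fun ω => (μ⟦ψ ⁻¹' {χ | phaseLabel T χ = a} | phaseSigma T φ⟧) ω *
        boltzmann G (fieldOf T (phase T (φ ω)) b)) =ᵐ[μ]
      fun ω => (μ⟦ψ ⁻¹' {χ | phaseLabel T χ = b} | phaseSigma T φ⟧) ω *
        boltzmann G (fieldOf T (phase T (φ ω)) a) := by
  have hm := phaseSigma_le (T := T) hφ
  have hset : ∀ a : V → ℤ, MeasurableSet (ψ ⁻¹' {χ | phaseLabel T χ = a}) := fun a =>
    hψ.measurable (measurable_phaseLabel (measurableSet_singleton a))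
  have hwm : ∀ a : V → ℤ, Measurable[phaseSigma T φ] fun ω =>
      boltzmann G (fieldOf T (phase T (φ ω)) a) := fun a =>
    (measurable_boltzmann.comp (measurable_fieldOf a)).comp (comap_measurable _)
  have hint1 : ∀ a : V → ℤ, Integrable
      ((ψ ⁻¹' {χ | phaseLabel T χ = a}).indicator fun _ => (1 : ℝ)) μ := fun a =>
    (integrable_const _).indicator (hset a)
  have hint : ∀ a b : V → ℤ, Integrable
      (((ψ ⁻¹' {χ | phaseLabel T χ = a}).indicator fun _ => (1 : ℝ)) *
        fun ω => boltzmann G (fieldOf T (phase T (φ ω)) b)) μ := fun a b =>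
    (hint1 a).mul_bdd (c := 1) ((hwm b).mono hm le_rfl).aestronglyMeasurable
      (Filter.Eventually.of_forall fun ω => by
        rw [Real.norm_eq_abs, abs_of_pos (boltzmann_pos _)]; exact boltzmann_le_one _)
  have hpull : ∀ a b : V → ℤ,
      μ[((ψ ⁻¹' {χ | phaseLabel T χ = a}).indicator fun _ => (1 : ℝ)) *
        (fun ω => boltzmann G (fieldOf T (phase T (φ ω)) b)) | phaseSigma T φ] =ᵐ[μ]
      fun ω => (μ⟦ψ ⁻¹' {χ | phaseLabel T χ = a} | phaseSigma T φ⟧) ω *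
        boltzmann G (fieldOf T (phase T (φ ω)) b) := fun a b =>
    condExp_mul_of_stronglyMeasurable_right (hwm b).stronglyMeasurable (hint a b) (hint1 a)
  -- Since `ψ` and `φ` share their phases, integrals over phase events depend on the law of `ψ`
  -- alone, where the exchange identity applies.
  have hlint : ∀ a b : V → ℤ, ∀ S : Set (V → ℂ), MeasurableSet S →
      ∫ ω in (fun ω => phase T (φ ω)) ⁻¹' S,
        (((ψ ⁻¹' {χ | phaseLabel T χ = a}).indicator fun _ => (1 : ℝ)) *
          fun ω => boltzmann G (fieldOf T (phase T (φ ω)) b)) ω ∂μ =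
      ((gffWeight G B Set.univ)⁻¹ * ∫⁻ ψ in {ψ | phase T ψ ∈ S ∧ phaseLabel T ψ = a},
        ENNReal.ofReal (boltzmann G (fieldOf T (phase T ψ) b)) ∂gffWeight G B).toReal := by
    intro a b S hS
    refine (integral_eq_lintegral_of_nonneg_ae (Filter.Eventually.of_forall fun ω =>
      mul_nonneg (Set.indicator_nonneg (fun _ _ => zero_le_one) _) (boltzmann_pos _).le)
      (hint a b).aestronglyMeasurable.restrict).trans ?_
    congr 1
    have hS' : MeasurableSet {χ : V → ℝ | phase T χ ∈ S ∧ phaseLabel T χ = a} :=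
      (measurable_phase hS).inter (measurable_phaseLabel (measurableSet_singleton a))
    have hF : Measurable fun χ : V → ℝ =>
        ENNReal.ofReal (boltzmann G (fieldOf T (phase T χ) b)) :=
      (measurable_boltzmann.comp ((measurable_fieldOf b).comp measurable_phase)).ennreal_ofReal
    have hrhs : (gffWeight G B Set.univ)⁻¹ *
        ∫⁻ ψ in {ψ | phase T ψ ∈ S ∧ phaseLabel T ψ = a},
          ENNReal.ofReal (boltzmann G (fieldOf T (phase T ψ) b)) ∂gffWeight G B =
        ∫⁻ ω in ψ ⁻¹' {χ | phase T χ ∈ S ∧ phaseLabel T χ = a},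
          ENNReal.ofReal (boltzmann G (fieldOf T (phase T (ψ ω)) b)) ∂μ := by
      rw [← smul_eq_mul, ← lintegral_smul_measure, ← Measure.restrict_smul]
      change ∫⁻ χ in _, _ ∂gffLaw G B = _
      rw [← hψ.law, setLIntegral_map hS' hF hψ.measurable]
    rw [hrhs, ← lintegral_indicator (hm _ ⟨S, hS, rfl⟩), ← lintegral_indicator (hψ.measurable hS')]
    refine lintegral_congr_ae ?_
    filter_upwards [hphase] with ω hω
    by_cases h1 : phase T (ψ ω) ∈ S
    · by_cases h2 : phaseLabel T (ψ ω) = a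
      · rw [Set.indicator_of_mem (show ω ∈ (fun ω => phase T (φ ω)) ⁻¹' S by
          change phase T (φ ω) ∈ S; rwa [← hω]), Set.indicator_of_mem
          (show ω ∈ ψ ⁻¹' {χ | phase T χ ∈ S ∧ phaseLabel T χ = a} from ⟨h1, h2⟩),
          Set.indicator_of_mem (show ω ∈ ψ ⁻¹' {χ | phaseLabel T χ = a} from h2), one_mul, hω]
      · rw [Set.indicator_of_notMem (s := ψ ⁻¹' {χ | phase T χ ∈ S ∧ phaseLabel T χ = a})
          (fun h => h2 h.2)]
        refine Set.indicator_apply_eq_zero.2 fun _ => ?_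
        rw [Set.indicator_of_notMem (s := ψ ⁻¹' {χ | phaseLabel T χ = a}) h2]
        simp
    · rw [Set.indicator_of_notMem (s := ψ ⁻¹' {χ | phase T χ ∈ S ∧ phaseLabel T χ = a})
        (fun h => h1 h.1), Set.indicator_of_notMem]
      intro h
      refine h1 ?_
      rw [hω]; exact h
  have hcond : μ[((ψ ⁻¹' {χ | phaseLabel T χ = a}).indicator fun _ => (1 : ℝ)) *
        (fun ω => boltzmann G (fieldOf T (phase T (φ ω)) b)) | phaseSigma T φ] =ᵐ[μ]
      μ[((ψ ⁻¹' {χ | phaseLabel T χ = b}).indicator fun _ => (1 : ℝ)) *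
        (fun ω => boltzmann G (fieldOf T (phase T (φ ω)) a)) | phaseSigma T φ] := by
    refine ae_eq_condExp_of_forall_setIntegral_eq hm (hint b a)
      (fun s _ _ => integrable_condExp.integrableOn) ?_
      stronglyMeasurable_condExp.aestronglyMeasurable
    intro s hs _
    rw [setIntegral_condExp hm (hint a b) hs]
    obtain ⟨S, hS, rfl⟩ := hs
    rw [hlint a b S hS, hlint b a S hS, setLIntegral_gffWeight_exchange hT ha hb hS]
  exact (hpull a b).symm.trans (hcond.trans (hpull b a))

/-- Exchanging parts of the labels of a coupled pair. -/
theorem IsCoupledGFF.measure_labels_eq (hT : 0 < T) (h : IsCoupledGFF G B T μ φ φ₁ φ₂)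
    {a b a' b' : V → ℤ} (ha : ∀ x ∈ B, a x = 0) (hb : ∀ x ∈ B, b x = 0)
    (ha' : ∀ x ∈ B, a' x = 0) (hb' : ∀ x ∈ B, b' x = 0)
    (hE : ∀ p : V → ℂ, dirichletEnergy G (fieldOf T p a) + dirichletEnergy G (fieldOf T p b) =
      dirichletEnergy G (fieldOf T p a') + dirichletEnergy G (fieldOf T p b')) :
    μ {ω | phaseLabel T (φ₁ ω) = a ∧ phaseLabel T (φ₂ ω) = b} =
      μ {ω | phaseLabel T (φ₁ ω) = a' ∧ phaseLabel T (φ₂ ω) = b'} := by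
  have hφ := h.gff.measurable
  have hm := phaseSigma_le (T := T) hφ
  have hlab : ∀ a : V → ℤ, MeasurableSet {χ : V → ℝ | phaseLabel T χ = a} := fun a =>
    measurable_phaseLabel (measurableSet_singleton a)
  have hset : ∀ a b : V → ℤ, MeasurableSet
      (φ₁ ⁻¹' {χ | phaseLabel T χ = a} ∩ φ₂ ⁻¹' {χ | phaseLabel T χ = b}) := fun a b =>
    (h.gff₁.measurable (hlab a)).inter (h.gff₂.measurable (hlab b))
  have hreal : ∀ a b : V → ℤ,
      μ.real (φ₁ ⁻¹' {χ | phaseLabel T χ = a} ∩ φ₂ ⁻¹' {χ | phaseLabel T χ = b}) =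
      ∫ ω, (μ⟦φ₁ ⁻¹' {χ | phaseLabel T χ = a} | phaseSigma T φ⟧) ω *
        (μ⟦φ₂ ⁻¹' {χ | phaseLabel T χ = b} | phaseSigma T φ⟧) ω ∂μ := by
    intro a b
    rw [← integral_indicator_one (hset a b)]
    have h1 := integral_condExp (μ := μ) (f := (φ₁ ⁻¹' {χ | phaseLabel T χ = a} ∩
      φ₂ ⁻¹' {χ | phaseLabel T χ = b}).indicator fun _ => (1 : ℝ)) hm
    refine h1.symm.trans (integral_congr_ae ?_)
    exact h.condIndep _ _ (hlab a) (hlab b)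
  have key : ∀ᵐ ω ∂μ, (μ⟦φ₁ ⁻¹' {χ | phaseLabel T χ = a} | phaseSigma T φ⟧) ω *
        (μ⟦φ₂ ⁻¹' {χ | phaseLabel T χ = b} | phaseSigma T φ⟧) ω =
      (μ⟦φ₁ ⁻¹' {χ | phaseLabel T χ = a'} | phaseSigma T φ⟧) ω *
        (μ⟦φ₂ ⁻¹' {χ | phaseLabel T χ = b'} | phaseSigma T φ⟧) ω := by
    filter_upwards [h.gff₁.condExp_label_mul hT hφ h.phase₁ ha ha',
      h.gff₂.condExp_label_mul hT hφ h.phase₂ hb hb'] with ω h1 h2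
    have hw : boltzmann G (fieldOf T (phase T (φ ω)) a) * boltzmann G (fieldOf T (phase T (φ ω)) b) =
        boltzmann G (fieldOf T (phase T (φ ω)) a') *
          boltzmann G (fieldOf T (phase T (φ ω)) b') := by
      have := hE (phase T (φ ω))
      simp only [boltzmann]
      rw [← Real.exp_add, ← Real.exp_add]
      congr 1
      linarith
    have hpos := mul_pos (boltzmann_pos (G := G) (fieldOf T (phase T (φ ω)) a))
      (boltzmann_pos (G := G) (fieldOf T (phase T (φ ω)) b))
    -- Equal total energies make the two products of weights equal; this common positive factor is
    -- cancelled from the product of the two cross-multiplied identities.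
    refine mul_right_cancel₀ hpos.ne' ?_
    conv_lhs => rw [hw]
    calc _ = ((μ⟦φ₁ ⁻¹' {χ | phaseLabel T χ = a} | phaseSigma T φ⟧) ω *
            boltzmann G (fieldOf T (phase T (φ ω)) a')) *
          ((μ⟦φ₂ ⁻¹' {χ | phaseLabel T χ = b} | phaseSigma T φ⟧) ω *
            boltzmann G (fieldOf T (phase T (φ ω)) b')) := by ring
      _ = _ := by rw [h1, h2]; ring
  have hfin := (hreal a b).trans ((integral_congr_ae key).trans (hreal a' b').symm)
  exact (measureReal_eq_measureReal_iff (measure_ne_top _ _) (measure_ne_top _ _)).1 hfin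

open Classical in
/-- Exchange the values of two functions on a set. -/
noncomputable def exchange {α : Type*} (O : Set V) (a b : V → α) : V → α :=
  fun z => if z ∈ O then b z else a z

/-- On an edge leaving `O` the labels agree at the outer endpoint, so the exchange merely swaps the
two squared gradients, as it does inside `O`. -/
theorem dirichletEnergy_exchange {O : Set V} {a b : V → ℤ}
    (hO : ∀ z ∈ O, ∀ y, y ∉ O → G.Adj z y → a y = b y) (p : V → ℂ) :
    dirichletEnergy G (fieldOf T p a) + dirichletEnergy G (fieldOf T p b) =
      dirichletEnergy G (fieldOf T p (exchange O a b)) +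
        dirichletEnergy G (fieldOf T p (exchange O b a)) := by
  simp only [dirichletEnergy_eq, ← mul_add, ← Finset.sum_add_distrib]
  congr 1
  refine Finset.sum_congr rfl fun x _ => Finset.sum_congr rfl fun y _ => ?_
  simp only [edgeGradient, fieldOf, exchange]
  by_cases hxy : G.Adj x y
  · simp only [if_pos hxy]
    by_cases hx : x ∈ O <;> by_cases hy : y ∈ O <;> simp only [hx, hy, if_true, if_false]
    · ring
    · rw [hO x hx y hy hxy]; ring
    · rw [hO y hy x hx hxy.symm]; ring
  · simp only [if_neg hxy]

end ConditionalLaw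

/-! ### Symmetry under exchange on an island -/

section IslandExchange

variable {n : ℕ} {T : ℝ} {Ω : Type*} [MeasurableSpace Ω] {μ : Measure Ω}
  {φ φ₁ φ₂ : Ω → Box n → ℝ}

/-- Exchange a pair of labellings on the island of `x`. -/
noncomputable def islandExchange (x : Box n) (p : (Box n → ℤ) × (Box n → ℤ)) :
    (Box n → ℤ) × (Box n → ℤ) :=
  (exchange (island (zeroSea (p.1 - p.2)) x) p.1 p.2,
    exchange (island (zeroSea (p.1 - p.2)) x) p.2 p.1)

/-- Exchanging only changes the sign of the difference on the island, so the zero set, the sea and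
the island itself are unchanged. This makes the exchange an involution. -/
theorem zeroSea_islandExchange (x : Box n) (p : (Box n → ℤ) × (Box n → ℤ)) :
    zeroSea ((islandExchange x p).1 - (islandExchange x p).2) = zeroSea (p.1 - p.2) := by
  have : ∀ z, ((islandExchange x p).1 - (islandExchange x p).2) z = 0 ↔ (p.1 - p.2) z = 0 := by
    intro z
    simp only [islandExchange, exchange, Pi.sub_apply]
    split_ifs <;> omega
  simp only [zeroSea, this]

theorem islandExchange_involutive (x : Box n) : Function.Involutive (islandExchange x) := by
  intro p
  refine Prod.ext ?_ ?_ <;> funext z <;> rw [islandExchange, zeroSea_islandExchange] <;>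
    simp only [islandExchange, exchange] <;> split_ifs <;> rfl

/-- The joint law of the labels of a pair of fields. -/
noncomputable def labelPairLaw (T : ℝ) (μ : Measure Ω) (φ₁ φ₂ : Ω → Box n → ℝ) :
    Measure ((Box n → ℤ) × (Box n → ℤ)) :=
  μ.map fun ω => (phaseLabel T (φ₁ ω), phaseLabel T (φ₂ ω))

theorem measurable_labelPair (h₁ : Measurable φ₁) (h₂ : Measurable φ₂) :
    Measurable fun ω => (phaseLabel T (φ₁ ω), phaseLabel T (φ₂ ω)) :=
  (measurable_phaseLabel.comp h₁).prodMk (measurable_phaseLabel.comp h₂)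

theorem labelPairLaw_singleton (h₁ : Measurable φ₁) (h₂ : Measurable φ₂)
    (p : (Box n → ℤ) × (Box n → ℤ)) : labelPairLaw T μ φ₁ φ₂ {p} =
      μ {ω | phaseLabel T (φ₁ ω) = p.1 ∧ phaseLabel T (φ₂ ω) = p.2} := by
  rw [labelPairLaw, Measure.map_apply (measurable_labelPair h₁ h₂) (measurableSet_singleton p)]
  congr 1
  ext ω
  exact Prod.ext_iff

/-- Labellings are countably many, so it is enough to compare point masses; there the exchanged set
is deterministic and `measure_labels_eq` applies. -/
theorem IsCoupledGFF.map_islandExchange [IsProbabilityMeasure μ] (hT : 0 < T)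
    (h : IsCoupledGFF (boxGraph n) (boxBoundary n) T μ φ φ₁ φ₂) (x : Box n) :
    (labelPairLaw T μ φ₁ φ₂).map (islandExchange x) = labelPairLaw T μ φ₁ φ₂ := by
  refine Measure.ext_of_singleton fun p => ?_
  have hpre : islandExchange x ⁻¹' {p} = {islandExchange x p} := by
    ext q
    exact (islandExchange_involutive x).eq_iff
  rw [Measure.map_apply Measurable.of_discrete (measurableSet_singleton p), hpre,
    labelPairLaw_singleton h.gff₁.measurable h.gff₂.measurable,
    labelPairLaw_singleton h.gff₁.measurable h.gff₂.measurable]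
  set O := island (zeroSea (p.1 - p.2)) x with hO
  have hp' : islandExchange x p = (exchange O p.1 p.2, exchange O p.2 p.1) := rfl
  by_cases hB : ∀ z ∈ boxBoundary n, p.1 z = 0 ∧ p.2 z = 0
  · have hex : ∀ z ∈ boxBoundary n, (islandExchange x p).1 z = 0 ∧ (islandExchange x p).2 z = 0 := by
      intro z hz
      have := hB z hz
      simp only [hp', exchange]
      split_ifs <;> simp [this]
    refine (h.measure_labels_eq hT (fun z hz => (hB z hz).1) (fun z hz => (hB z hz).2)
      (fun z hz => (hex z hz).1) (fun z hz => (hex z hz).2)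
      (dirichletEnergy_exchange fun z hz y hy hzy => ?_)).symm
    have := apply_eq_zero_of_mem_zeroSea (mem_of_adj_clusterOf_compl hz hy hzy)
    rw [Pi.sub_apply] at this
    omega
  -- Labellings that do not vanish on the boundary have mass zero, and the exchange preserves this
  -- class.
  · have hzero : ∀ q : (Box n → ℤ) × (Box n → ℤ),
        (¬ ∀ z ∈ boxBoundary n, q.1 z = 0 ∧ q.2 z = 0) →
        μ {ω | phaseLabel T (φ₁ ω) = q.1 ∧ phaseLabel T (φ₂ ω) = q.2} = 0 := by
      intro q hq
      have h0 : ∀ᵐ ω ∂μ, ¬ (phaseLabel T (φ₁ ω) = q.1 ∧ phaseLabel T (φ₂ ω) = q.2) := by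
        filter_upwards [h.gff₁.ae_eq_zero, h.gff₂.ae_eq_zero] with ω h1 h2 hω
        refine hq fun z hz => ?_
        rw [← hω.1, ← hω.2]
        exact ⟨phaseLabel_eq_zero (h1 z hz), phaseLabel_eq_zero (h2 z hz)⟩
      simpa only [not_not] using ae_iff.1 h0
    rw [hzero p hB, hzero]
    intro hex
    refine hB fun z hz => ?_
    have := hex z hz
    simp only [hp', exchange] at this
    split_ifs at this <;> tauto

/-- Distinct islands are uncorrelated. -/
theorem IsCoupledGFF.integral_distinct_islands [IsProbabilityMeasure μ] (hT : 0 < T)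
    (h : IsCoupledGFF (boxGraph n) (boxBoundary n) T μ φ φ₁ φ₂) (c : ℝ) (x y : Box n) :
    ∫ p in {p : (Box n → ℤ) × (Box n → ℤ) |
        island (zeroSea (p.1 - p.2)) x = island (zeroSea (p.1 - p.2)) y}ᶜ,
      c * ((p.1 - p.2) x : ℝ) * (c * ((p.1 - p.2) y : ℝ)) ∂labelPairLaw T μ φ₁ φ₂ = 0 := by
  set S := {p : (Box n → ℤ) × (Box n → ℤ) |
    island (zeroSea (p.1 - p.2)) x = island (zeroSea (p.1 - p.2)) y}
  have hS : MeasurableSet Sᶜ := MeasurableSet.of_discrete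
  set g : (Box n → ℤ) × (Box n → ℤ) → ℝ := Sᶜ.indicator fun p =>
    c * ((p.1 - p.2) x : ℝ) * (c * ((p.1 - p.2) y : ℝ))
  -- The integrand is odd under the exchange: `x` lies in its island and `y` does not, while for `x`
  -- in the sea it vanishes.
  have hg : ∀ p, g (islandExchange x p) = - g p := by
    intro p
    have hsea := zeroSea_islandExchange x p
    have hmem : islandExchange x p ∈ Sᶜ ↔ p ∈ Sᶜ := by
      simp only [S, Set.mem_compl_iff, Set.mem_ofPred_eq, hsea]
    by_cases hp : p ∈ Sᶜ
    · simp only [g]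
      rw [Set.indicator_of_mem hp, Set.indicator_of_mem (hmem.2 hp)]
      by_cases hx : x ∈ zeroSea (p.1 - p.2)
      · have h1 := apply_eq_zero_of_mem_zeroSea hx
        have h2 := apply_eq_zero_of_mem_zeroSea (hsea ▸ hx)
        simp only [h1, h2]; simp
      · have hxO : x ∈ island (zeroSea (p.1 - p.2)) x := mem_clusterOf_self hx
        have hyO : y ∉ island (zeroSea (p.1 - p.2)) x := fun hy =>
          hp (clusterOf_eq_of_mem hy).symm
        have e1 : ((islandExchange x p).1 - (islandExchange x p).2) x = -(p.1 - p.2) x := by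
          simp only [islandExchange, exchange, Pi.sub_apply, if_pos hxO]; ring
        have e2 : ((islandExchange x p).1 - (islandExchange x p).2) y = (p.1 - p.2) y := by
          simp only [islandExchange, exchange, Pi.sub_apply, if_neg hyO]
        rw [e1, e2]; push_cast; ring
    · simp only [g]
      rw [Set.indicator_of_notMem hp, Set.indicator_of_notMem (fun h' => hp (hmem.1 h')), neg_zero]
  have h1 : ∫ p, g p ∂labelPairLaw T μ φ₁ φ₂ = - ∫ p, g p ∂labelPairLaw T μ φ₁ φ₂ := by
    conv_lhs => rw [← h.map_islandExchange hT x]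
    rw [integral_map Measurable.of_discrete.aemeasurable
      (Measurable.of_discrete (f := g)).aestronglyMeasurable]
    simp only [hg, integral_neg]
  rw [← integral_indicator hS]
  change ∫ p, g p ∂labelPairLaw T μ φ₁ φ₂ = 0
  linarith

end IslandExchange

/-! ### The difference of a coupled pair -/

section CoupledPair

open scoped ENNReal

variable {n : ℕ} {T : ℝ} {B : Set (Box n)} {Ω : Type*} [MeasurableSpace Ω] {μ : Measure Ω}
  {φ φ₁ φ₂ : Ω → Box n → ℝ}

/-- The difference of the labels of a pair of fields. -/
noncomputable def labelDiff (T : ℝ) (φ₁ φ₂ : Ω → Box n → ℝ) (ω : Ω) : Box n → ℤ :=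
  phaseLabel T (φ₁ ω) - phaseLabel T (φ₂ ω)

theorem measurable_labelDiff (h₁ : Measurable φ₁) (h₂ : Measurable φ₂) :
    Measurable (labelDiff T φ₁ φ₂) :=
  (Measurable.of_discrete (f := fun p : (Box n → ℤ) × (Box n → ℤ) => p.1 - p.2)).comp
    (measurable_labelPair h₁ h₂)

theorem IsCoupledGFF.measurable_labelDiff (h : IsCoupledGFF (boxGraph n) B T μ φ φ₁ φ₂) :
    Measurable (labelDiff T φ₁ φ₂) :=
  _root_.measurable_labelDiff h.gff₁.measurable h.gff₂.measurable

theorem IsCoupledGFF.sub_eq (hT : 0 < T) (h : IsCoupledGFF (boxGraph n) B T μ φ φ₁ φ₂) :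
    ∀ᵐ ω ∂μ, ∀ x, φ₁ ω x - φ₂ ω x = 2 * Real.pi / T * labelDiff T φ₁ φ₂ ω x := by
  filter_upwards [h.phase₁, h.phase₂] with ω h1 h2 x
  exact sub_eq_mul_phaseLabel_sub hT (h1.trans h2.symm) x

theorem ncard_neighbours_le (v : Box n) : {u | (boxGraph n).Adj v u}.ncard ≤ 9 := by
  refine le_trans ?_ (card_supDist_le_one v)
  rw [← Set.ncard_coe_finset]
  refine Set.ncard_le_ncard (fun u hu => ?_) (Set.toFinite _)
  have hu' := boxGraph_adj.1 hu
  refine Finset.mem_coe.2 (Finset.mem_filter.2 ⟨Finset.mem_univ u, ?_⟩)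
  simp only [supDist]
  omega

theorem IsCoupledGFF.rareBad [IsProbabilityMeasure μ] (hT : 0 < T)
    (h : IsCoupledGFF (boxGraph n) B T μ φ φ₁ φ₂) {x₀ : Box n} (hx₀ : x₀ ∈ B) {r : ℝ≥0∞}
    (hr : 18 * ENNReal.ofReal (Real.exp (-((Real.pi / T) ^ 2) / 4)) ≤ r ^ 2) (hr1 : r ≤ 1)
    {I : (Box n → ℤ) → Set (Box n)}
    (hI : ∀ᵐ ω ∂μ, IsSea (I (labelDiff T φ₁ φ₂ ω)) (labelDiff T φ₁ φ₂ ω) ∨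
      ∃ e L, n < 8 * L ∧ HasBadChain (labelDiff T φ₁ φ₂ ω) e L) :
    RareBad (μ.map (labelDiff T φ₁ φ₂)) (2 * Real.pi / T) (4 * r) 10 x₀ I := by
  have hc : 0 < 2 * Real.pi / T := div_pos Real.two_pi_pos hT
  have hm := h.measurable_labelDiff
  have hae : ∀ p : (Box n → ℤ) → Prop, (∀ᵐ ω ∂μ, p (labelDiff T φ₁ φ₂ ω)) →
      ∀ᵐ k ∂μ.map (labelDiff T φ₁ φ₂), p k := fun p hp =>
    (ae_map_iff hm.aemeasurable (MeasurableSet.of_discrete (s := {k | p k}))).2 hp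
  refine ⟨fun F => ?_, fun x z => ?_, hae _ ?_, hae _ hI⟩
  · rw [Measure.map_apply hm MeasurableSet.of_discrete]
    -- Different integer labels differ by at least 1, so `φ₁ - φ₂` jumps by `2π/T`, twice the
    -- threshold `π/T`. The factor 18 is `2 * Δ` with the bound `Δ = 9` on degrees.
    refine le_trans (measure_mono_ae ?_) (measure_steep_difference_le h.gff₁ h.gff₂
      ncard_neighbours_le F (div_pos Real.pi_pos hT).le (by norm_num at hr ⊢; exact hr) hr1)
    filter_upwards [h.sub_eq hT] with ω hω hbad v hv
    obtain ⟨u, hu, hne⟩ := hbad v hv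
    refine ⟨u, hu, ?_⟩
    rw [hω, hω, ← mul_sub, abs_mul, abs_of_pos hc]
    have h1 : (1 : ℝ) ≤ |(labelDiff T φ₁ φ₂ ω u : ℝ) - labelDiff T φ₁ φ₂ ω v| := by
      exact_mod_cast Int.one_le_abs (sub_ne_zero.2 hne)
    calc 2 * (Real.pi / T) = 2 * Real.pi / T * 1 := by ring
      _ ≤ _ := mul_le_mul_of_nonneg_left h1 hc.le
  · obtain ⟨w, hw⟩ := (boxGraph_preconnected x z).exists_walk_length_eq_dist
    rw [eLpNorm_map_measure (aestronglyMeasurable_labels _) hm.aemeasurable]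
    refine le_trans (le_of_eq (eLpNorm_congr_ae ?_)) (le_trans
      (eLpNorm_difference_le h.gff₁ h.gff₂ w) (by rw [hw, boxGraph_dist]))
    filter_upwards [h.sub_eq hT] with ω hω
    simp only [Function.comp, hω, mul_sub]
  · filter_upwards [h.gff₁.ae_eq_zero, h.gff₂.ae_eq_zero] with ω h1 h2
    simp [labelDiff, phaseLabel_eq_zero (h1 _ hx₀), phaseLabel_eq_zero (h2 _ hx₀)]

theorem IsCoupledGFF.isSea_zeroSea [IsProbabilityMeasure μ] (hn : 1 ≤ n)
    (h : IsCoupledGFF (boxGraph n) (boxBoundary n) T μ φ φ₁ φ₂) :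
    ∀ᵐ ω ∂μ, IsSea (zeroSea (labelDiff T φ₁ φ₂ ω)) (labelDiff T φ₁ φ₂ ω) := by
  filter_upwards [h.gff₁.ae_eq_zero, h.gff₂.ae_eq_zero] with ω h1 h2
  refine _root_.isSea_zeroSea hn fun z hz => ?_
  simp [labelDiff, phaseLabel_eq_zero (h1 _ hz), phaseLabel_eq_zero (h2 _ hz)]

theorem isSea_labelSea_or (hn : 1 ≤ n) (k : Box n → ℤ) :
    IsSea (labelSea k) k ∨ ∃ e L, n < 8 * L ∧ HasBadChain k e L := by
  by_cases hk : ∃ e L, n < 8 * L ∧ HasBadChain k e L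
  · exact Or.inr hk
  · push Not at hk
    exact Or.inl (isSea_labelSea hn hk)

theorem IsCoupledGFF.dirichletSea_eq (hT : 0 < T)
    (h : IsCoupledGFF (boxGraph n) B T μ φ φ₁ φ₂) :
    ∀ᵐ ω ∂μ, dirichletSea (φ₁ ω) (φ₂ ω) = zeroSea (labelDiff T φ₁ φ₂ ω) := by
  have hc : 2 * Real.pi / T ≠ 0 := (div_pos Real.two_pi_pos hT).ne'
  filter_upwards [h.sub_eq hT] with ω hω
  refine dirichletSea_eq_zeroSea fun z => ?_
  rw [← sub_eq_zero, hω, mul_eq_zero, or_iff_right hc, Int.cast_eq_zero]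

theorem IsCoupledGFF.freeSea_eq (hT : 0 < T) (h : IsCoupledGFF (boxGraph n) B T μ φ φ₁ φ₂) :
    ∀ᵐ ω ∂μ, freeSea T (φ₁ ω) (φ₂ ω) = labelSea (labelDiff T φ₁ φ₂ ω) := by
  have hc : 2 * Real.pi / T ≠ 0 := (div_pos Real.two_pi_pos hT).ne'
  filter_upwards [h.sub_eq hT] with ω hω
  refine freeSea_eq_labelSea fun z m => ?_
  rw [← sub_eq_iff_eq_add', hω, mul_comm (m : ℝ), mul_right_inj' hc, Int.cast_inj]

theorem IsCoupledGFF.eLpNorm_sub_eq (hT : 0 < T) (h : IsCoupledGFF (boxGraph n) B T μ φ φ₁ φ₂)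
    (x : Box n) (p : ℝ≥0∞) : eLpNorm (fun ω => φ₁ ω x - φ₂ ω x) p μ =
      eLpNorm (fun k : Box n → ℤ => 2 * Real.pi / T * (k x : ℝ)) p
        (μ.map (labelDiff T φ₁ φ₂)) := by
  rw [eLpNorm_map_measure (aestronglyMeasurable_labels _) h.measurable_labelDiff.aemeasurable]
  refine eLpNorm_congr_ae ?_
  filter_upwards [h.sub_eq hT] with ω hω
  exact hω x

theorem IsCoupledGFF.setIntegral_eq (hT : 0 < T) (h : IsCoupledGFF (boxGraph n) B T μ φ φ₁ φ₂)
    (x y : Box n) {A : Set Ω} {S : Set (Box n → ℤ)}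
    (hA : ∀ᵐ ω ∂μ, ω ∈ A ↔ labelDiff T φ₁ φ₂ ω ∈ S) :
    ∫ ω in A, (φ₁ ω x - φ₂ ω x) * (φ₁ ω y - φ₂ ω y) ∂μ =
      ∫ k in S, 2 * Real.pi / T * (k x : ℝ) * (2 * Real.pi / T * (k y : ℝ))
        ∂μ.map (labelDiff T φ₁ φ₂) := by
  rw [setIntegral_map MeasurableSet.of_discrete (aestronglyMeasurable_labels _)
    h.measurable_labelDiff.aemeasurable]
  have hset : A =ᵐ[μ] labelDiff T φ₁ φ₂ ⁻¹' S := by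
    filter_upwards [hA] with ω hω using propext hω
  rw [setIntegral_congr_set hset]
  refine integral_congr_ae (ae_restrict_of_ae ?_)
  filter_upwards [h.sub_eq hT] with ω hω
  simp only [hω]

theorem IsCoupledGFF.memLp_sub [IsFiniteMeasure μ] (h : IsCoupledGFF (boxGraph n) B T μ φ φ₁ φ₂)
    {x : Box n} (hx : eLpNorm (fun ω => φ₁ ω x - φ₂ ω x) 4 μ ≤ 1) :
    MemLp (fun ω => φ₁ ω x - φ₂ ω x) 2 μ := by
  have h1 := h.gff₁.measurable
  have h2 := h.gff₂.measurable
  have hm : Measurable fun ω => φ₁ ω x - φ₂ ω x := by fun_prop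
  have h4 : MemLp (fun ω => φ₁ ω x - φ₂ ω x) 4 μ :=
    ⟨hm.aestronglyMeasurable, hx.trans_lt ENNReal.one_lt_top⟩
  exact h4.mono_exponent (by norm_num)

theorem IsCoupledGFF.integral_sq_le [IsProbabilityMeasure μ]
    (h : IsCoupledGFF (boxGraph n) B T μ φ φ₁ φ₂) {x : Box n}
    (hx : eLpNorm (fun ω => φ₁ ω x - φ₂ ω x) 4 μ ≤ 1) :
    ∫ ω, (φ₁ ω x - φ₂ ω x) ^ 2 ∂μ ≤ 1 := by
  have hL := h.memLp_sub hx
  have h2 : eLpNorm (fun ω => φ₁ ω x - φ₂ ω x) 2 μ ≤ 1 :=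
    (eLpNorm_le_eLpNorm_of_exponent_le (by norm_num) hL.1).trans hx
  have h3 : eLpNorm (fun ω => φ₁ ω x - φ₂ ω x) 2 μ ^ 2 =
      ∫⁻ ω, ‖φ₁ ω x - φ₂ ω x‖ₑ ^ 2 ∂μ := by
    have := eLpNorm_nnreal_pow_eq_lintegral (μ := μ) (f := fun ω => φ₁ ω x - φ₂ ω x) (p := 2)
      (by norm_num)
    simpa using this
  rw [integral_eq_lintegral_of_nonneg_ae (Filter.Eventually.of_forall fun ω => sq_nonneg _)
    (hL.1.pow 2)]
  refine ENNReal.toReal_le_of_le_ofReal zero_le_one ?_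
  rw [ENNReal.ofReal_one]
  calc ∫⁻ ω, ENNReal.ofReal ((φ₁ ω x - φ₂ ω x) ^ 2) ∂μ = ∫⁻ ω, ‖φ₁ ω x - φ₂ ω x‖ₑ ^ 2 ∂μ := by
        refine lintegral_congr fun ω => ?_
        rw [← sq_abs, ENNReal.ofReal_pow (abs_nonneg _), ← Real.norm_eq_abs, ofReal_norm]
    _ ≤ 1 := by rw [← h3]; exact pow_le_one' h2 2

theorem abs_setIntegral_le_of_lintegral_le {α : Type*} [MeasurableSpace α] {κ : Measure α}
    {S : Set α} {f : α → ℝ} {a : ℝ} (ha : 0 ≤ a) (h : ∫⁻ k in S, ‖f k‖ₑ ∂κ ≤ ENNReal.ofReal a) :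
    |∫ k in S, f k ∂κ| ≤ a := by
  have h1 := enorm_integral_le_lintegral_enorm (μ := κ.restrict S) f
  have h2 := h1.trans h
  rwa [← ofReal_norm, ENNReal.ofReal_le_ofReal_iff ha, Real.norm_eq_abs] at h2

/-- The smallness conditions on `T`. -/
structure IsSmallPeriod (T : ℝ) (γ r : ℝ≥0∞) : Prop where
  pos : 0 < T
  rate_le : γ ≤ 2000⁻¹
  rate_mul_le : 1184 * (10 * γ) ≤ 1
  edge_le_one : r ≤ 1
  edge_le : 4 * r ≤ ((γ ^ 8) ^ 65 / 18) ^ 4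
  exp_le : 18 * ENNReal.ofReal (Real.exp (-((Real.pi / T) ^ 2) / 4)) ≤ r ^ 2

theorem exists_isSmallPeriod : ∃ T₀ : ℝ, 0 < T₀ ∧ ∀ T : ℝ, 0 < T → T < T₀ →
    ∃ γ r : ℝ≥0∞, IsSmallPeriod T γ r := by
  -- The rate is fixed first, small enough for `1184 * 10 * γ ≤ 1`; then `r` is chosen in terms of
  -- it, and only then is `T` made small.
  set γ : ℝ≥0∞ := 20000⁻¹ with hγ
  have hγ0 : γ ≠ 0 := ENNReal.inv_ne_zero.2 (by norm_num)
  set ε : ℝ≥0∞ := ((γ ^ 8) ^ 65 / 18) ^ 4 with hε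
  have hε0 : ε ≠ 0 := pow_ne_zero _ (ENNReal.div_pos (pow_ne_zero _ (pow_ne_zero _ hγ0))
    (by norm_num)).ne'
  clear_value ε
  set r : ℝ≥0∞ := min 1 (ε / 4) with hr
  have hr0 : r ^ 2 ≠ 0 := pow_ne_zero _ (lt_min one_pos (ENNReal.div_pos hε0 (by norm_num))).ne'
  have hlim : Filter.Tendsto (fun T : ℝ =>
      18 * ENNReal.ofReal (Real.exp (-((Real.pi / T) ^ 2) / 4))) (nhdsWithin 0 (Set.Ioi 0))
      (nhds 0) := by
    have h1 : Filter.Tendsto (fun T : ℝ => (Real.pi / T) ^ 2 / 4) (nhdsWithin 0 (Set.Ioi 0))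
        Filter.atTop := by
      refine Filter.Tendsto.atTop_div_const (by norm_num)
        ((Filter.tendsto_pow_atTop two_ne_zero).comp ?_)
      exact tendsto_inv_nhdsGT_zero.const_mul_atTop Real.pi_pos
    have h2 := ENNReal.tendsto_ofReal (Real.tendsto_exp_neg_atTop_nhds_zero.comp h1)
    rw [ENNReal.ofReal_zero] at h2
    have h3 := ENNReal.Tendsto.const_mul (a := 18) h2 (Or.inr (by norm_num))
    rw [mul_zero] at h3
    simpa only [Function.comp_def, neg_div] using h3
  have hev := hlim.eventually (gt_mem_nhds (pos_iff_ne_zero.2 hr0))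
  obtain ⟨T₀, hT₀, hsub⟩ := mem_nhdsGT_iff_exists_Ioo_subset.1 hev
  refine ⟨T₀, hT₀, fun T hT hTT => ⟨γ, r, hT, ?_, ?_, min_le_left _ _, ?_, (hsub ⟨hT, hTT⟩).le⟩⟩
  · exact ENNReal.inv_le_inv.2 (by norm_num)
  · rw [← mul_assoc, hγ, ← div_eq_mul_inv]
    exact ENNReal.div_le_of_le_mul (by norm_num)
  · rw [← hε]
    calc 4 * r ≤ 4 * (ε / 4) := by gcongr; exact min_le_right _ _
      _ = ε := ENNReal.mul_div_cancel (by norm_num) (by norm_num)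

theorem Real.exp_neg_l1Dist (x y : Box n) :
    Real.exp (-1 * (boxGraph n).dist x y) = Real.exp (-(l1Dist x y : ℝ)) := by
  rw [boxGraph_dist, neg_one_mul]

theorem IsCoupledGFF.free_bounds [IsProbabilityMeasure μ] {γ r : ℝ≥0∞} (hT : IsSmallPeriod T γ r)
    (hn : 1 ≤ n) {x₀ : Box n} (h : IsCoupledGFF (boxGraph n) {x₀} T μ φ φ₁ φ₂) (x y : Box n) :
    eLpNorm (fun ω => φ₁ ω x - φ₂ ω x) 4 μ ≤ 1 ∧
      |∫ ω in {ω | island (freeSea T (φ₁ ω) (φ₂ ω)) x = island (freeSea T (φ₁ ω) (φ₂ ω)) y ∧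
            (island (freeSea T (φ₁ ω) (φ₂ ω)) x).Nonempty},
          (φ₁ ω x - φ₂ ω x) * (φ₁ ω y - φ₂ ω y) ∂μ| ≤ Real.exp (-(l1Dist x y : ℝ)) := by
  have := Measure.isProbabilityMeasure_map (μ := μ) h.measurable_labelDiff.aemeasurable
  have hrare := h.rareBad hT.pos (Set.mem_singleton x₀) hT.exp_le hT.edge_le_one (I := labelSea)
    (Filter.Eventually.of_forall fun ω => isSea_labelSea_or hn _)
  refine ⟨?_, ?_⟩
  · rw [h.eLpNorm_sub_eq hT.pos]
    exact hrare.eLpNorm_le_one hT.rate_le hT.edge_le hT.rate_mul_le x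
  · rw [h.setIntegral_eq hT.pos x y (S := {k | island (labelSea k) x = island (labelSea k) y ∧
      (island (labelSea k) x).Nonempty})]
    · exact abs_setIntegral_le_of_lintegral_le (Real.exp_pos _).le
        (hrare.lintegral_island_le hT.rate_le hT.edge_le hT.rate_mul_le x y)
    · filter_upwards [h.freeSea_eq hT.pos] with ω hω
      simp only [hω]

theorem IsCoupledGFF.dirichlet_bounds [IsProbabilityMeasure μ] {γ r : ℝ≥0∞}
    (hT : IsSmallPeriod T γ r) (hn : 1 ≤ n)
    (h : IsCoupledGFF (boxGraph n) (boxBoundary n) T μ φ φ₁ φ₂) (x y : Box n) :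
    eLpNorm (fun ω => φ₁ ω x - φ₂ ω x) 4 μ ≤ 1 ∧
      |∫ ω in {ω | island (dirichletSea (φ₁ ω) (φ₂ ω)) x = island (dirichletSea (φ₁ ω) (φ₂ ω)) y},
          (φ₁ ω x - φ₂ ω x) * (φ₁ ω y - φ₂ ω y) ∂μ| ≤ Real.exp (-(l1Dist x y : ℝ)) := by
  have := Measure.isProbabilityMeasure_map (μ := μ) h.measurable_labelDiff.aemeasurable
  have hcorner : Box.mk (n := n) n n (by omega) (by omega) ∈ boxBoundary n :=
    mem_boxBoundary.2 (Or.inl rfl)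
  have hrare := h.rareBad hT.pos hcorner hT.exp_le hT.edge_le_one (I := zeroSea)
    ((h.isSea_zeroSea hn).mono fun ω hω => Or.inl hω)
  refine ⟨?_, ?_⟩
  · rw [h.eLpNorm_sub_eq hT.pos]
    exact hrare.eLpNorm_le_one hT.rate_le hT.edge_le hT.rate_mul_le x
  · rw [h.setIntegral_eq hT.pos x y (S := {k | island (zeroSea k) x = island (zeroSea k) y})]
    · have hsub : {k : Box n → ℤ | island (zeroSea k) x = island (zeroSea k) y ∧
          (island (zeroSea k) x).Nonempty} ⊆ {k | island (zeroSea k) x = island (zeroSea k) y} :=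
        fun k hk => hk.1
      -- Equal empty islands mean that `x` is in the sea, where the integrand vanishes, so
      -- nonemptiness may be imposed for free.
      rw [setIntegral_eq_of_subset_of_forall_sdiff_eq_zero MeasurableSet.of_discrete hsub]
      · exact abs_setIntegral_le_of_lintegral_le (Real.exp_pos _).le
          (hrare.lintegral_island_le hT.rate_le hT.edge_le hT.rate_mul_le x y)
      · intro k hk
        have hx : x ∈ zeroSea k := by
          by_contra hx
          exact hk.2 ⟨hk.1, x, mem_clusterOf_self hx⟩
        rw [apply_eq_zero_of_mem_zeroSea hx]
        simp
    · filter_upwards [h.dirichletSea_eq hT.pos] with ω hω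
      simp only [hω]

/-- The exchange symmetry removes the contribution of distinct islands, leaving the one already
bounded. -/
theorem IsCoupledGFF.abs_integral_mul_le [IsProbabilityMeasure μ] {γ r : ℝ≥0∞}
    (hT : IsSmallPeriod T γ r) (hn : 1 ≤ n)
    (h : IsCoupledGFF (boxGraph n) (boxBoundary n) T μ φ φ₁ φ₂) (x y : Box n) :
    |∫ ω, (φ₁ ω x - φ₂ ω x) * (φ₁ ω y - φ₂ ω y) ∂μ| ≤ Real.exp (-(l1Dist x y : ℝ)) := by
  have hmp := measurable_labelPair (T := T) h.gff₁.measurable h.gff₂.measurable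
  set S : Set Ω := labelDiff T φ₁ φ₂ ⁻¹' {k | island (zeroSea k) x = island (zeroSea k) y}
  have hS : MeasurableSet S := h.measurable_labelDiff MeasurableSet.of_discrete
  have hint : Integrable (fun ω => (φ₁ ω x - φ₂ ω x) * (φ₁ ω y - φ₂ ω y)) μ :=
    (h.memLp_sub (h.dirichlet_bounds hT hn x x).1).integrable_mul
      (h.memLp_sub (h.dirichlet_bounds hT hn y y).1)
  have hzero : ∫ ω in Sᶜ, (φ₁ ω x - φ₂ ω x) * (φ₁ ω y - φ₂ ω y) ∂μ = 0 := by
    rw [← h.integral_distinct_islands hT.pos (2 * Real.pi / T) x y, labelPairLaw,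
      setIntegral_map MeasurableSet.of_discrete Measurable.of_discrete.aestronglyMeasurable
      hmp.aemeasurable]
    refine integral_congr_ae (ae_restrict_of_ae ?_)
    filter_upwards [h.sub_eq hT.pos] with ω hω
    simp only [hω, labelDiff]
  have hset : ({ω | island (dirichletSea (φ₁ ω) (φ₂ ω)) x =
      island (dirichletSea (φ₁ ω) (φ₂ ω)) y} : Set Ω) =ᵐ[μ] S := by
    filter_upwards [h.dirichletSea_eq hT.pos] with ω hω
    refine propext ?_
    change island (dirichletSea (φ₁ ω) (φ₂ ω)) x = island (dirichletSea (φ₁ ω) (φ₂ ω)) y ↔ _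
    rw [hω]
    rfl
  rw [← integral_add_compl hS hint, hzero, add_zero, ← setIntegral_congr_set hset]
  exact (h.dirichlet_bounds hT hn x y).2

end CoupledPair

/-! ### Conditional resampling -/

section Resample

variable {Ω β E : Type*} [MeasurableSpace Ω] [MeasurableSpace β] [MeasurableSpace E]
  [StandardBorelSpace E] [Nonempty E] {μ : Measure Ω} [IsProbabilityMeasure μ] {X : Ω → β}
  {Y : Ω → E}

/-- The law of a random point together with a copy of `Y` which is drawn from the conditional law of
`Y` given `X`. -/
noncomputable def resample (Y : Ω → E) (μ : Measure Ω) [IsProbabilityMeasure μ]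
    (hX : Measurable X) : Measure (Ω × E) :=
  μ ⊗ₘ (condDistrib Y X μ).comap X hX

instance (hX : Measurable X) : IsProbabilityMeasure (resample Y μ hX) := by
  unfold resample; infer_instance

theorem fst_resample (hX : Measurable X) : (resample Y μ hX).map Prod.fst = μ :=
  Measure.fst_compProd _ _

/-- Given `X`, the original `Y` and its copy are independent with the same conditional law; every
property of the construction is read off from this joint law. -/
theorem map_resample (hX : Measurable X) (hY : Measurable Y) :
    (resample Y μ hX).map (fun z => (X z.1, (Y z.1, z.2))) =
      μ.map X ⊗ₘ (condDistrib Y X μ ×ₖ condDistrib Y X μ) := by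
  refine Measure.ext fun s hs => ?_
  have hm : Measurable fun z : Ω × E => (X z.1, (Y z.1, z.2)) := by fun_prop
  rw [Measure.map_apply hm hs, resample, Measure.compProd_apply (hm hs), Measure.compProd_apply hs]
  have hF : Measurable fun p : β × E => condDistrib Y X μ p.1 ((fun e => (p.1, (p.2, e))) ⁻¹' s) := by
    have h1 : MeasurableSet ((fun z : (β × E) × E => (z.1.1, (z.1.2, z.2))) ⁻¹' s) :=
      (show Measurable fun z : (β × E) × E => (z.1.1, (z.1.2, z.2)) by fun_prop) hs
    exact Kernel.measurable_kernel_prodMk_left (κ := (condDistrib Y X μ).comap Prod.fst measurable_fst)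
      h1
  have h2 := Measure.lintegral_compProd (μ := μ.map X) (κ := condDistrib Y X μ) hF
  rw [compProd_map_condDistrib hY.aemeasurable, lintegral_map hF (hX.prodMk hY)] at h2
  refine Eq.trans ?_ (h2.trans (lintegral_congr fun b => ?_))
  · rfl
  · rw [Kernel.prod_apply' _ _ _ (measurable_prodMk_left hs)]
    rfl

theorem map_resample_snd (hX : Measurable X) (hY : Measurable Y) :
    (resample Y μ hX).map (fun z => (X z.1, z.2)) = μ.map fun ω => (X ω, Y ω) := by
  have h := congrArg (Measure.map (Prod.map id Prod.snd)) (map_resample (μ := μ) hX hY)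
  rw [← Measure.compProd_map measurable_snd, Measure.map_map (by fun_prop) (by fun_prop)] at h
  rw [← compProd_map_condDistrib hY.aemeasurable]
  refine h.trans ?_
  congr 1
  exact (Kernel.snd_eq _).symm.trans
    (Kernel.snd_prod (condDistrib Y X μ) (condDistrib Y X μ))

theorem map_resample_left (hX : Measurable X) :
    (resample Y μ hX).map (fun z => X z.1) = μ.map X := by
  conv_rhs => rw [← fst_resample (Y := Y) (μ := μ) hX]
  rw [Measure.map_map (by fun_prop) (by fun_prop)]
  rfl

theorem condExp_resample_pair (hX : Measurable X) (hY : Measurable Y) {s : Set (E × E)}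
    (hs : MeasurableSet s) :
    (resample Y μ hX)⟦(fun z => (Y z.1, z.2)) ⁻¹' s |
        MeasurableSpace.comap (fun z => X z.1) inferInstance⟧ =ᵐ[resample Y μ hX]
      fun z => ((condDistrib Y X μ ×ₖ condDistrib Y X μ) (X z.1)).real s := by
  have hX' : Measurable fun z : Ω × E => X z.1 := by fun_prop
  have hY' : Measurable fun z : Ω × E => (Y z.1, z.2) := by fun_prop
  refine (condDistrib_ae_eq_condExp (μ := resample Y μ hX) hX' hY' hs).symm.trans ?_
  have h := condDistrib_ae_eq_of_measure_eq_compProd (μ := resample Y μ hX) (fun z => X z.1)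
    hY'.aemeasurable (κ := condDistrib Y X μ ×ₖ condDistrib Y X μ)
    (by rw [map_resample hX hY, map_resample_left])
  filter_upwards [ae_of_ae_map hX'.aemeasurable h] with z hz
  rw [hz]

theorem condIndep_resample (hX : Measurable X) (hY : Measurable Y) {s t : Set E}
    (hs : MeasurableSet s) (ht : MeasurableSet t) :
    (resample Y μ hX)⟦(fun z => Y z.1) ⁻¹' s ∩ Prod.snd ⁻¹' t |
        MeasurableSpace.comap (fun z => X z.1) inferInstance⟧ =ᵐ[resample Y μ hX]
      (resample Y μ hX)⟦(fun z => Y z.1) ⁻¹' s |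
          MeasurableSpace.comap (fun z => X z.1) inferInstance⟧ *
        (resample Y μ hX)⟦Prod.snd ⁻¹' t |
          MeasurableSpace.comap (fun z => X z.1) inferInstance⟧ := by
  have h1 := condExp_resample_pair (μ := μ) hX hY (hs.prod ht)
  have h2 := condExp_resample_pair (μ := μ) hX hY (hs.prod MeasurableSet.univ)
  have h3 := condExp_resample_pair (μ := μ) hX hY (MeasurableSet.univ.prod ht)
  have e2 : (fun z : Ω × E => (Y z.1, z.2)) ⁻¹' (s ×ˢ Set.univ) = (fun z => Y z.1) ⁻¹' s := by
    ext z; simp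
  have e3 : (fun z : Ω × E => (Y z.1, z.2)) ⁻¹' (Set.univ ×ˢ t) = Prod.snd ⁻¹' t := by
    ext z; simp
  rw [e2] at h2
  rw [e3] at h3
  filter_upwards [h1, h2, h3] with z hz1 hz2 hz3
  rw [Pi.mul_apply, hz2, hz3]
  refine hz1.trans ?_
  simp only [measureReal_def, Kernel.prod_apply_prod, ENNReal.toReal_mul, measure_univ, mul_one,
    one_mul]

theorem integral_condVar_eq_sub {α : Type*} {m m₀ : MeasurableSpace α} {ν : Measure α}
    [IsFiniteMeasure ν] (hm : m ≤ m₀) {Z : α → ℝ} (hZ : MemLp Z 2 ν) :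
    ∫ ω, (condVar m Z ν) ω ∂ν = ∫ ω, Z ω ^ 2 ∂ν - ∫ ω, Z ω * (ν[Z | m]) ω ∂ν := by
  have hcross : ∫ ω, Z ω * (ν[Z | m]) ω ∂ν = ∫ ω, (ν[Z | m]) ω ^ 2 ∂ν := by
    have h1 : Integrable (Z * ν[Z | m]) ν := hZ.integrable_mul (hZ.condExp one_le_two)
    have h2 := condExp_mul_of_stronglyMeasurable_right stronglyMeasurable_condExp h1
      (hZ.integrable one_le_two)
    refine (integral_condExp (f := Z * ν[Z | m]) hm).symm.trans (integral_congr_ae ?_)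
    filter_upwards [h2] with ω hω
    rw [hω, Pi.mul_apply, sq]
  have hsq : Integrable ((ν[Z | m]) ^ 2) ν := (hZ.condExp one_le_two).integrable_sq
  rw [hcross, integral_congr_ae (condVar_ae_eq_condExp_sq_sub_sq_condExp hm hZ),
    integral_sub' integrable_condExp hsq, integral_condExp hm]
  rfl

/-- The conditional variance is half the mean square difference of two conditionally independent
copies. -/
theorem integral_condVar_eq (hX : Measurable X) (hY : Measurable Y) {g : E → ℝ} (hg : Measurable g)
    (hL : MemLp (fun ω => g (Y ω)) 2 μ) :
    ∫ ω, (condVar (MeasurableSpace.comap X inferInstance) (fun ω => g (Y ω)) μ) ω ∂μ =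
      (∫ z, (g (Y z.1) - g z.2) ^ 2 ∂resample Y μ hX) / 2 := by
  set Z : Ω → ℝ := fun ω => g (Y ω)
  have h₁ : MemLp (fun z : Ω × E => g (Y z.1)) 2 (resample Y μ hX) := by
    have := (fst_resample (Y := Y) (μ := μ) hX).symm ▸ hL
    exact (memLp_map_measure_iff (hg.comp hY).aestronglyMeasurable
      measurable_fst.aemeasurable).1 this
  have hmapsnd : (resample Y μ hX).map Prod.snd = μ.map Y := by
    have h := congrArg (Measure.map Prod.snd) (map_resample_snd (μ := μ) hX hY)
    rw [Measure.map_map (by fun_prop) (by fun_prop), Measure.map_map (by fun_prop) (by fun_prop)] at h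
    exact h
  have h₂ : MemLp (fun z : Ω × E => g z.2) 2 (resample Y μ hX) := by
    have h3 : MemLp g 2 (μ.map Y) :=
      (memLp_map_measure_iff hg.aestronglyMeasurable hY.aemeasurable).2 hL
    rw [← hmapsnd] at h3
    exact (memLp_map_measure_iff hg.aestronglyMeasurable measurable_snd.aemeasurable).1 h3
  have i₁ : ∫ z, g (Y z.1) ^ 2 ∂resample Y μ hX = ∫ ω, Z ω ^ 2 ∂μ := by
    conv_rhs => rw [← fst_resample (Y := Y) (μ := μ) hX]
    have hg2 : Measurable fun ω => Z ω ^ 2 := (hg.comp hY).pow_const 2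
    rw [integral_map measurable_fst.aemeasurable hg2.aestronglyMeasurable]
  have i₂ : ∫ z, g z.2 ^ 2 ∂resample Y μ hX = ∫ ω, Z ω ^ 2 ∂μ := by
    have hg2 : Measurable fun e => g e ^ 2 := hg.pow_const 2
    rw [← integral_map (f := fun e => g e ^ 2) measurable_snd.aemeasurable
      hg2.aestronglyMeasurable, hmapsnd, integral_map hY.aemeasurable hg2.aestronglyMeasurable]
  have hint : Integrable (fun z : Ω × E => g (Y z.1) * g z.2) (resample Y μ hX) :=
    h₁.integrable_mul h₂
  -- Given the original point, the copy averages to the conditional expectation, so the cross term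
  -- is that in `integral_condVar_eq_sub`.
  have i₁₂ : ∫ z, g (Y z.1) * g z.2 ∂resample Y μ hX =
      ∫ ω, Z ω * (μ[Z | MeasurableSpace.comap X inferInstance]) ω ∂μ := by
    rw [resample, Measure.integral_compProd hint]
    refine integral_congr_ae ?_
    filter_upwards [condExp_ae_eq_integral_condDistrib hX hY.aemeasurable hg.stronglyMeasurable
      (hL.integrable one_le_two)] with ω hω
    rw [hω]
    exact integral_const_mul _ _
  have hexp : ∫ z, (g (Y z.1) - g z.2) ^ 2 ∂resample Y μ hX =
      ∫ z, g (Y z.1) ^ 2 ∂resample Y μ hX + ∫ z, g z.2 ^ 2 ∂resample Y μ hX -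
        2 * ∫ z, g (Y z.1) * g z.2 ∂resample Y μ hX := by
    have hadd : Integrable (fun z : Ω × E => g (Y z.1) ^ 2 + g z.2 ^ 2) (resample Y μ hX) :=
      h₁.integrable_sq.add h₂.integrable_sq
    rw [← integral_const_mul, ← integral_add h₁.integrable_sq h₂.integrable_sq,
      ← integral_sub hadd (hint.const_mul 2)]
    exact integral_congr_ae (Filter.Eventually.of_forall fun z => by ring)
  rw [integral_condVar_eq_sub hX.comap_le hL, hexp, i₁, i₂, i₁₂]
  ring

end Resample

/-! ### The conditional variance of linear functionals -/

section ConditionalVariance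

open scoped ENNReal

variable {V : Type*} [Fintype V] {G : SimpleGraph V} {B : Set V} {T : ℝ}
  {Ω : Type*} [MeasurableSpace Ω] {μ : Measure Ω} [IsProbabilityMeasure μ] {φ : Ω → V → ℝ}

/-- The field itself plays both `φ` and `φ₁`; the copy is `φ₂`. The copy has the right phases almost
surely because its joint law with the phases is that of the original field. -/
theorem IsGFF.isCoupledGFF_resample (h : IsGFF G B μ φ) :
    IsCoupledGFF G B T (resample φ μ (measurable_phase.comp h.measurable : Measurable fun ω =>
      phase T (φ ω))) (fun z => φ z.1) (fun z => φ z.1) Prod.snd := by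
  have hφ := h.measurable
  have hX : Measurable fun ω => phase T (φ ω) := measurable_phase.comp hφ
  have hX₂ : Measurable fun z : Ω × (V → ℝ) => (phase T (φ z.1), z.2) :=
    (hX.comp measurable_fst).prodMk measurable_snd
  have hfst : IsGFF G B (resample φ μ hX) fun z => φ z.1 := by
    refine ⟨hφ.comp measurable_fst, ?_⟩
    have : (fun z : Ω × (V → ℝ) => φ z.1) = φ ∘ Prod.fst := rfl
    rw [this, ← Measure.map_map hφ measurable_fst, fst_resample, h.law]
  have hsnd : IsGFF G B (resample φ μ hX) Prod.snd := by
    refine ⟨measurable_snd, ?_⟩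
    have h1 := congrArg (Measure.map Prod.snd) (map_resample_snd (μ := μ) hX hφ)
    rw [Measure.map_map measurable_snd hX₂, Measure.map_map measurable_snd (hX.prodMk hφ)] at h1
    exact h1.trans h.law
  refine ⟨hfst, hfst, hsnd, Filter.Eventually.of_forall fun _ => rfl, ?_,
    fun A₁ A₂ h₁ h₂ => condIndep_resample hX hφ h₁ h₂⟩
  have hset : MeasurableSet {p : (V → ℂ) × (V → ℝ) | phase T p.2 = p.1} :=
    measurableSet_eq_fun (measurable_phase.comp measurable_snd) measurable_fst
  have h1 : ∀ᵐ p ∂μ.map (fun ω => (phase T (φ ω), φ ω)), phase T p.2 = p.1 :=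
    (ae_map_iff (hX.prodMk hφ).aemeasurable hset).2 (Filter.Eventually.of_forall fun _ => rfl)
  rw [← map_resample_snd (μ := μ) hX hφ] at h1
  exact ae_of_ae_map hX₂.aemeasurable h1

theorem IsGFF.memLp_apply (h : IsGFF G B μ φ) (hG : G.Preconnected) (hB : B.Nonempty) (x : V) :
    MemLp (fun ω => φ ω x) 2 μ := by
  obtain ⟨b, hb⟩ := hB
  obtain ⟨w⟩ := hG x b
  have hm : Measurable fun ω => φ ω x := (measurable_pi_apply x).comp h.measurable
  have h8 : MemLp (fun ω => φ ω x) 8 μ := by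
    refine ⟨hm.aestronglyMeasurable, lt_of_eq_of_lt (eLpNorm_congr_ae ?_)
      ((h.eLpNorm_sub_le w).trans_lt (ENNReal.mul_lt_top (by norm_num) (by simp)))⟩
    filter_upwards [h.ae_eq_zero] with ω hω
    rw [hω b hb, sub_zero]
  exact h8.mono_exponent (by norm_num)

end ConditionalVariance

/-! ### The variance bound on the box -/

section BoxVariance

open scoped ENNReal

variable {n : ℕ}

theorem sum_exp_neg_l1Dist_le (x : Box n) : ∑ e : Box n, Real.exp (-(l1Dist e x : ℝ)) ≤ 16 := by
  have h1 : ∀ d : ℕ, Real.exp (-(d : ℝ)) ≤ (2⁻¹ : ℝ) ^ d := fun d => by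
    have h2 : Real.exp (-1) ≤ 2⁻¹ := by
      rw [Real.exp_neg]
      have := Real.add_one_le_exp (1 : ℝ)
      exact inv_anti₀ two_pos (by linarith)
    rw [← mul_neg_one, Real.exp_nat_mul]
    exact pow_le_pow_left₀ (Real.exp_pos _).le h2 d
  refine (Finset.sum_le_sum fun e _ => h1 _).trans ?_
  have h3 := sum_half_pow_l1Dist_le x
  have h4 : ENNReal.ofReal (∑ e : Box n, (2⁻¹ : ℝ) ^ l1Dist e x) ≤ ENNReal.ofReal 16 := by
    rw [ENNReal.ofReal_sum_of_nonneg fun e _ => by positivity]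
    refine le_trans (le_of_eq (Finset.sum_congr rfl fun e _ => ?_)) (h3.trans (by norm_num))
    rw [ENNReal.ofReal_pow (by norm_num), ENNReal.ofReal_inv_of_pos two_pos, ENNReal.ofReal_ofNat]
  exact (ENNReal.ofReal_le_ofReal_iff (by norm_num)).1 h4

/-- Expanding the square leaves a double sum of two-point functions, each at most `exp` of minus the
distance. Every row sums to at most 16 and there are `(2n+1)^2 ≤ (3n)^2` rows, giving `144 = 9 *
16`. -/
theorem IsCoupledGFF.integral_linear_sq_le {T : ℝ} {Ω : Type*} [MeasurableSpace Ω] {μ : Measure Ω}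
    {φ φ₁ φ₂ : Ω → Box n → ℝ} [IsProbabilityMeasure μ] {γ r : ℝ≥0∞}
    (hT : IsSmallPeriod T γ r) (hn : 1 ≤ n)
    (h : IsCoupledGFF (boxGraph n) (boxBoundary n) T μ φ φ₁ φ₂) (f : Box n → ℝ) :
    ∫ ω, (∑ x, (φ₁ ω x - φ₂ ω x) * f x) ^ 2 ∂μ ≤ 144 * n ^ 2 * ‖f‖ ^ 2 := by
  have hL := fun x => h.memLp_sub (h.dirichlet_bounds hT hn x x).1
  have hint : ∀ x y, Integrable (fun ω => (φ₁ ω x - φ₂ ω x) * (φ₁ ω y - φ₂ ω y)) μ := fun x y =>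
    (hL x).integrable_mul (hL y)
  have hexp : ∀ ω, (∑ x, (φ₁ ω x - φ₂ ω x) * f x) ^ 2 =
      ∑ y, ∑ x, f x * f y * ((φ₁ ω x - φ₂ ω x) * (φ₁ ω y - φ₂ ω y)) := by
    intro ω
    rw [sq, Finset.sum_mul_sum, Finset.sum_comm]
    exact Finset.sum_congr rfl fun x _ => Finset.sum_congr rfl fun y _ => by ring
  simp only [hexp]
  rw [integral_finsetSum _ fun y _ => integrable_finsetSum _ fun x _ => (hint x y).const_mul _]
  have hterm : ∀ y x, ∫ ω, f x * f y * ((φ₁ ω x - φ₂ ω x) * (φ₁ ω y - φ₂ ω y)) ∂μ ≤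
      ‖f‖ ^ 2 * Real.exp (-(l1Dist x y : ℝ)) := by
    intro y x
    rw [integral_const_mul]
    refine (le_abs_self _).trans ?_
    rw [abs_mul, abs_mul, sq]
    gcongr
    · exact norm_le_pi_norm f x
    · exact norm_le_pi_norm f y
    · exact h.abs_integral_mul_le hT hn x y
  have hn' : (1 : ℝ) ≤ n := by exact_mod_cast hn
  calc ∑ y, ∫ ω, ∑ x, f x * f y * ((φ₁ ω x - φ₂ ω x) * (φ₁ ω y - φ₂ ω y)) ∂μ
      ≤ ∑ y : Box n, ‖f‖ ^ 2 * 16 := by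
        refine Finset.sum_le_sum fun y _ => ?_
        rw [integral_finsetSum _ fun x _ => (hint x y).const_mul _]
        refine (Finset.sum_le_sum fun x _ => hterm y x).trans ?_
        rw [← Finset.mul_sum]
        gcongr
        exact sum_exp_neg_l1Dist_le y
    _ = (2 * n + 1) ^ 2 * (‖f‖ ^ 2 * 16) := by
        rw [Finset.sum_const, Finset.card_univ, card_box, nsmul_eq_mul]; push_cast; ring
    _ ≤ (3 * n) ^ 2 * (‖f‖ ^ 2 * 16) := by gcongr; linarith
    _ = 144 * n ^ 2 * ‖f‖ ^ 2 := by ring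

theorem boxBoundary_nonempty (n : ℕ) : (boxBoundary n).Nonempty :=
  ⟨Box.mk n n (by omega) (by omega), mem_boxBoundary.2 (Or.inl rfl)⟩

theorem IsGFF.memLp_linear {Ω : Type*} [MeasurableSpace Ω] {μ : Measure Ω} [IsProbabilityMeasure μ]
    {φ : Ω → Box n → ℝ} (h : IsGFF (boxGraph n) (boxBoundary n) μ φ) (a : ℝ) (f : Box n → ℝ) :
    MemLp (fun ω => a * ∑ x, φ ω x * f x) 2 μ :=
  (memLp_finsetSum _ fun x _ => (h.memLp_apply boxGraph_preconnected
    (boxBoundary_nonempty n) x).mul_const (f x)).const_mul a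

theorem IsGFF.integral_condVar_le {T : ℝ} {Ω : Type*} [MeasurableSpace Ω] {μ : Measure Ω}
    [IsProbabilityMeasure μ] {φ : Ω → Box n → ℝ} {γ r : ℝ≥0∞} (hT : IsSmallPeriod T γ r)
    (hn : 1 ≤ n) (h : IsGFF (boxGraph n) (boxBoundary n) μ φ) (f : Box n → ℝ) :
    ∫ ω, (condVar (phaseSigma T φ) (fun ω => ((n : ℝ) ^ 2)⁻¹ * ∑ x, φ ω x * f x) μ) ω ∂μ ≤
      72 * ‖f‖ ^ 2 / (n : ℝ) ^ 2 := by
  have hX : Measurable fun ω => phase T (φ ω) := measurable_phase.comp h.measurable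
  have hg : Measurable fun ψ : Box n → ℝ => ((n : ℝ) ^ 2)⁻¹ * ∑ x, ψ x * f x := by fun_prop
  have hn' : (0 : ℝ) < n := by exact_mod_cast hn
  have key := (h.isCoupledGFF_resample (T := T)).integral_linear_sq_le hT hn f
  have heq := integral_condVar_eq hX h.measurable hg (h.memLp_linear _ f)
  refine heq.trans_le ?_
  have hpt : ∀ z : Ω × (Box n → ℝ), (((n : ℝ) ^ 2)⁻¹ * ∑ x, φ z.1 x * f x -
      ((n : ℝ) ^ 2)⁻¹ * ∑ x, z.2 x * f x) ^ 2 =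
      (((n : ℝ) ^ 2)⁻¹) ^ 2 * (∑ x, (φ z.1 x - z.2 x) * f x) ^ 2 := by
    intro z
    rw [← mul_sub, ← Finset.sum_sub_distrib, mul_pow]
    simp only [sub_mul]
  simp only [hpt]
  rw [integral_const_mul]
  calc (((n : ℝ) ^ 2)⁻¹) ^ 2 * _ / 2 ≤ (((n : ℝ) ^ 2)⁻¹) ^ 2 * (144 * n ^ 2 * ‖f‖ ^ 2) / 2 := by
        gcongr
    _ = 72 * ‖f‖ ^ 2 / (n : ℝ) ^ 2 := by field_simp; ring

end BoxVariance

/-! ### The main theorem -/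

theorem proposition3p4 :
    ∃ T₀ : ℝ, 0 < T₀ ∧ ∀ T : ℝ, 0 < T → T < T₀ →
      -- bounds on the one-point and two-point functions of `φ₁ - φ₂`
      (∃ K : ℝ, 0 < K ∧ ∀ n : ℕ, 1 ≤ n →
        ∀ (Ω : Type u) [MeasurableSpace Ω] (μ : Measure Ω) [IsProbabilityMeasure μ]
          (φ φ₁ φ₂ : Ω → Box n → ℝ),
          -- Dirichlet boundary condition
          (IsCoupledGFF (boxGraph n) (boxBoundary n) T μ φ φ₁ φ₂ → ∀ x y : Box n,
            MemLp (fun ω => φ₁ ω x - φ₂ ω x) 2 μ ∧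
            ∫ ω, (φ₁ ω x - φ₂ ω x) ^ 2 ∂μ ≤ K ∧
            |∫ ω in {ω | island (dirichletSea (φ₁ ω) (φ₂ ω)) x =
                  island (dirichletSea (φ₁ ω) (φ₂ ω)) y},
                (φ₁ ω x - φ₂ ω x) * (φ₁ ω y - φ₂ ω y) ∂μ| ≤
              Real.exp (-K * (boxGraph n).dist x y) ∧
            |∫ ω, (φ₁ ω x - φ₂ ω x) * (φ₁ ω y - φ₂ ω y) ∂μ| ≤
              Real.exp (-K * (boxGraph n).dist x y)) ∧
          -- free boundary condition, rooted at `x₀`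
          (∀ x₀ : Box n, IsCoupledGFF (boxGraph n) {x₀} T μ φ φ₁ φ₂ → ∀ x y : Box n,
            MemLp (fun ω => φ₁ ω x - φ₂ ω x) 2 μ ∧
            ∫ ω, (φ₁ ω x - φ₂ ω x) ^ 2 ∂μ ≤ K ∧
            |∫ ω in {ω | island (freeSea T (φ₁ ω) (φ₂ ω)) x =
                    island (freeSea T (φ₁ ω) (φ₂ ω)) y ∧
                  (island (freeSea T (φ₁ ω) (φ₂ ω)) x).Nonempty},
                (φ₁ ω x - φ₂ ω x) * (φ₁ ω y - φ₂ ω y) ∂μ| ≤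
              Real.exp (-K * (boxGraph n).dist x y))) ∧
      -- bound on the conditional variance, Dirichlet boundary condition
      (∃ K : ℝ, 0 < K ∧ ∀ n : ℕ, 1 ≤ n →
        ∀ (Ω : Type u) [MeasurableSpace Ω] (μ : Measure Ω) [IsProbabilityMeasure μ]
          (φ : Ω → Box n → ℝ), IsGFF (boxGraph n) (boxBoundary n) μ φ →
          ∀ f : Box n → ℝ,
            MemLp (fun ω => ((n : ℝ) ^ 2)⁻¹ * ∑ x, φ ω x * f x) 2 μ ∧
            ∫ ω, (condVar (phaseSigma T φ)
                (fun ω => ((n : ℝ) ^ 2)⁻¹ * ∑ x, φ ω x * f x) μ) ω ∂μ ≤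
              K * ‖f‖ ^ 2 / (n : ℝ) ^ 2) := by
  obtain ⟨T₀, hT₀, hsmall⟩ := exists_isSmallPeriod
  refine ⟨T₀, hT₀, fun T hT hTT => ?_⟩
  obtain ⟨γ, r, hTr⟩ := hsmall T hT hTT
  -- For `T < T₀` the constant 1 serves both as second-moment bound and as decay rate; 72 is half of
  -- 144, from the conditional variance identity.
  refine ⟨⟨1, one_pos, ?_⟩, ⟨72, by norm_num, ?_⟩⟩
  · intro n hn Ω _ μ _ φ φ₁ φ₂
    refine ⟨fun h x y => ?_, fun x₀ h x y => ?_⟩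
    · rw [Real.exp_neg_l1Dist]
      obtain ⟨h4, hisl⟩ := h.dirichlet_bounds hTr hn x y
      exact ⟨h.memLp_sub h4, h.integral_sq_le h4, hisl, h.abs_integral_mul_le hTr hn x y⟩
    · rw [Real.exp_neg_l1Dist]
      obtain ⟨h4, hisl⟩ := h.free_bounds hTr hn x y
      exact ⟨h.memLp_sub h4, h.integral_sq_le h4, hisl⟩
  · intro n hn Ω _ μ _ φ h f
    exact ⟨h.memLp_linear _ f, h.integral_condVar_le hTr hn f⟩
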